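/- Let $\Sigma$ be a tree signature: every constant $a\in\Sigma$ has a type $o^{i}\to o$, $i\ge 0$. Let $\mathcal A=\langle Q,\Sigma,q^0,\delta,\rho\rangle$ be a weak alternating automaton: $Q$ is finite, $\rho:Q\to\mathbb N$, $\delta(q,a)\subseteq\mathcal P(Q)^{i}$ for $a$ of type $o^i\to o$, and all states occurring in a tuple of $\delta(q,a)$ have rank at most $\rho(q)$. Write $Q_{\le k}=\{q:\rho(q)\le k\}$ and $m=\max\rho$. $\mathcal A$ accepts a tree from $q$ if Eve wins the following game from the root and $q$: at a node labelled $a$ in state $q$, Eve picks $(S_1,\dots,S_i)\in\delta(q,a)$, Adam picks $j$ and $q'\in S_j$, and the play goes on from the $j$-th son in state $q'$; a player who cannot move loses; at a node labelled $\Omega$ Eve wins iff the rank of the current state is even; an infinite play is won by Eve iff its ranks stabilize at an even value. Simply typed $\lambda Y$-terms are built from variables, constants of $\Sigma$, the undefined terms $\Omega^A$, application, $\lambda$-abstraction and recursion $Yx.M$ (the combinator $Y$ being $\lambda f.Yx.fx$), with $\beta\delta$-reduction, $Yx.M\to(\lambda x.M)(Yx.M)$. The Böhm tree $BT(M)$ of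 a closed term $M$ of type $o$ has root $a$ and immediate subtrees $BT(N_1),\dots,BT(N_i)$ if $M$ reduces to $aN_1\dots N_i$ with $a\in\Sigma$, and is the single node $\Omega$ if $M$ has no such reduct. **The model.** $\mathcal D^0$ is the model of monotone functions over $\mathcal D^0_o=\mathcal P(Q_{\le 0})$. For $k>0$, by induction on types, $\mathcal D^k_o=\mathcal P(Q_{\le k})$, $\mathcal L^k_o=\{(P\cap Q_{\le k-1},P)\}$; $\mathcal L^k_{A\to B}$ consists of the pairs of $f_1\in\mathcal D^{k-1}_{A\to B}$ and a monotone $f_2:\mathcal D^k_A\to\mathcal D^k_B$ with $(f_1(g_1),f_2(g_2))\in\mathcal L^k_B$ for all $(g_1,g_2)\in\mathcal L^k_A$; and $\mathcal D^k_{A\to B}$ is the set of second components of $\mathcal L^k_{A\to B}$. For $e\in \mathcal D^k_A$, $e^{\downarrow}$ is the unique element of $\mathcal D^{k-1}_A$ that is related to $e$; for $d\in\mathcal D^{k-1}_A$, $d^{\wedge}$ and $d^{\vee}$ are the least and the greatest element of $\mathcal D^{k}_A$ related to $d$. Put $\mathrm{fix}^0(f)=\bigwedge_n f^n(\top)$;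 $\mathrm{fix}^k(f)=\bigwedge_n f^n\big(\mathrm{fix}^{k-1}(f^\downarrow)^{\vee}\big)$ for even $k>0$; $\mathrm{fix}^k(f)=\bigvee_n f^n\big(\mathrm{fix}^{k-1}(f^\downarrow)^{\wedge}\big)$ for odd $k$. Terms are interpreted in $\mathcal D^k$ as usual, with $[\![Yx.M]\!]^k=\mathrm{fix}^k([\![\lambda x.M]\!]^k)$, $[\![a]\!]^k(P_1,\dots,P_i)=\{q\in Q_{\le k}:\exists (T_1,\dots,T_i)\in\delta(q,a)\ \forall j\ T_j\subseteq P_j\}$, $[\![\Omega^o]\!]^k=\{q\in Q_{\le k}:\rho(q)\text{ even}\}$, and $[\![\Omega^{A\to B}]\!]^k$ the constant function $[\![\Omega^B]\!]^k$. Write $[\![M]\!]=[\![M]\!]^m$. For $S\subseteq Q$, $[\![S]\!]=[\![S]\!]^m$ is the join of the $[\![q]\!]^m=\{q\}$ for $q\in S$. **Types.** $\mathrm{types}^k_o=\{q:\rho(q)=k\}$, $\mathrm{types}^k_{A\to B}=\{T\to s: T\subseteq\mathrm{Types}^k_A,\ s\in\mathrm{types}^k_B\}$, $\mathrm{Types}^k_A=\bigcup_{0\le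 l\le k}\mathrm{types}^l_A$ (so $\mathrm{Types}^{-1}_A=\emptyset$). Subsumption: $s\sqsubseteq_o t$ iff $s=t$; $(S\to s)\sqsubseteq(T\to t)$ iff $T\sqsubseteq S$ and $s\sqsubseteq t$; for sets, $S\sqsubseteq T$ iff every $s\in S$ is $\sqsubseteq$ some $t\in T$. Put $S\to T=\{S\to t:t\in T\}$ and $S(T)=\{t:\exists U\ (U\to t)\in S,\ U\sqsubseteq T\}$. Judgements $\Gamma\vdash M\ge S$, for $M$ of type $A$ and $S\subseteq\mathrm{Types}^m_A$, are derived by the following rules. - $\Gamma,x\ge S\vdash x\ge S$; $\Gamma\vdash M\ge\emptyset$; from $M\ge S$ and $M\ge T$ infer $M\ge S\cup T$; from $M\ge S$ and $T\sqsubseteq S$, where $T\subseteq\mathrm{Types}^m_A$, infer $M\ge T$. - $\Gamma\vdash a\ge\{S_1\to\dots\to S_i\to q\}$ for $(S_1,\dots,S_i)\in\delta(q,a)$; $\Gamma\vdash\Omega^A\ge S$ for $S\subseteq\mathrm{types}^{2k}_A$. - From $M\ge S$ and $N\ge T$ infer $MN\ge S(T)$; from $\Gamma,x\ge S\vdash M\ge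 T$, where $S\subseteq\mathrm{Types}^k$ and $T\subseteq\mathrm{types}^k$, infer $\Gamma\vdash\lambda x.M\ge S\to T$. - ($Y$ odd) From $\lambda x.M\ge S$ and $Yx.M\ge T$ infer $Yx.M\ge S(T)$. - ($Y$ even) From $\lambda x.M\ge(S\cup T)\to S$ and $Yx.M\ge T$, where $S\subseteq\mathrm{types}^{2k}_A$ and $T\subseteq\mathrm{Types}^{2k-1}_A$, infer $Yx.M\ge S\cup T$. Judgements $\Gamma\vdash M\not\ge S$ of the dual system have the same rules for variables, $\emptyset$, union, subsumption, application and abstraction, and moreover the following ones. - $\Gamma\vdash a\not\ge\{T_1\to\dots\to T_i\to q\}$ if $T_j\subseteq Q_{\le\rho(q)}$ for all $j$ and for every $(S_1,\dots,S_i)\in\delta(q,a)$ some $T_j\cap S_j$ is not empty; $\Gamma\vdash\Omega^A\not\ge S$ for $S\subseteq\mathrm{types}^{2k+1}_A$. - ($Y$ odd) From $\lambda x.M\not\ge(S\cup T)\to S$ and $Yx.M\not\ge T$, where $S\subseteq\mathrm{types}^{2k+1}_A$ and $T\subseteq\mathrm{Types}^{2k}_A$, infer $Yx.M\not\ge S\cup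 T$. - ($Y$ even) From $\lambda x.M\not\ge S$ and $Yx.M\not\ge T$ infer $Yx.M\not\ge S(T)$. **Corollary.** For every closed term $M$ of type $o$ and every $S\subseteq Q$, $$[\![M]\!]=[\![S]\!]\quad\text{iff}\quad \vdash M\ge S\ \text{ and }\ \vdash M\not\ge(Q\setminus S)\ \text{ are both derivable},$$ and likewise $$\{q\in Q:\mathcal A\text{ accepts }BT(M)\text{ from }q\}=S\quad\text{iff}\quad \vdash M\ge S\ \text{ and }\ \vdash M\not\ge(Q\setminus S)\ \text{ are both derivable}.$$ -/

import Mathlib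

namespace LambdaY

universe u v

/-! ### Simple types and terms -/

/-- Simple types over the unique base type `o`. -/
inductive SType : Type
  | o : SType
  | arr : SType → SType → SType

/-- The type `o ^ i → o` of order at most one. -/
def SType.ord1 : ℕ → SType
  | 0 => .o
  | n + 1 => .arr .o (SType.ord1 n)

/-- Typed de Bruijn variables: `Var Γ A` is the type of variables of type `A` in the context `Γ`. -/
inductive Var : List SType → SType → Type
  | zero {Γ : List SType} {A : SType} : Var (A :: Γ) A
  | succ {Γ : List SType} {A B : SType} : Var Γ A → Var (B :: Γ) A

/-- Simply typed `λY`-terms over a tree signature: `C` is the set of constants, and `a : C` has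
type `o ^ (ar a) → o`. Recursion is written `Y x. M` (constructor `fix`); the combinator `Y`
itself is `λ f. Y x. f x`. Terms are taken up to `α`-conversion (de Bruijn indices). -/
inductive Tm {C : Type v} (ar : C → ℕ) : List SType → SType → Type v
  | var {Γ : List SType} {A : SType} : Var Γ A → Tm ar Γ A
  | const {Γ : List SType} (a : C) : Tm ar Γ (SType.ord1 (ar a))
  | omega {Γ : List SType} (A : SType) : Tm ar Γ A
  | app {Γ : List SType} {A B : SType} : Tm ar Γ (.arr A B) → Tm ar Γ A → Tm ar Γ B
  | lam {Γ : List SType} {A B : SType} : Tm ar (A :: Γ) B → Tm ar Γ (.arr A B)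
  | fix {Γ : List SType} {A : SType} : Tm ar (A :: Γ) A → Tm ar Γ A

section Terms

variable {C : Type v} {ar : C → ℕ}

/-- Extension of a renaming under a binder. -/
def liftRen {Γ Δ : List SType} (r : ∀ A, Var Γ A → Var Δ A) (B : SType) :
    ∀ A, Var (B :: Γ) A → Var (B :: Δ) A
  | _, .zero => .zero
  | _, .succ x => .succ (r _ x)

/-- Renaming of variables. -/
def Tm.rename : {Γ : List SType} → {A : SType} → Tm ar Γ A →
    {Δ : List SType} → (∀ A, Var Γ A → Var Δ A) → Tm ar Δ A
  | _, _, .var x, _, r => .var (r _ x)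
  | _, _, .const a, _, _ => .const a
  | _, _, .omega A, _, _ => .omega A
  | _, _, .app M N, _, r => .app (M.rename r) (N.rename r)
  | _, _, .lam M, _, r => .lam (M.rename (liftRen r _))
  | _, _, .fix M, _, r => .fix (M.rename (liftRen r _))

/-- Extension of a substitution under a binder. -/
def liftSub {Γ Δ : List SType} (s : ∀ A, Var Γ A → Tm ar Δ A) (B : SType) :
    ∀ A, Var (B :: Γ) A → Tm ar (B :: Δ) A
  | _, .zero => .var .zero
  | _, .succ x => (s _ x).rename (fun _ y => .succ y)

/-- Simultaneous capture-avoiding substitution. -/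
def Tm.subst : {Γ : List SType} → {A : SType} → Tm ar Γ A →
    {Δ : List SType} → (∀ A, Var Γ A → Tm ar Δ A) → Tm ar Δ A
  | _, _, .var x, _, s => s _ x
  | _, _, .const a, _, _ => .const a
  | _, _, .omega A, _, _ => .omega A
  | _, _, .app M N, _, s => .app (M.subst s) (N.subst s)
  | _, _, .lam M, _, s => .lam (M.subst (liftSub s _))
  | _, _, .fix M, _, s => .fix (M.subst (liftSub s _))

/-- The substitution replacing the last variable by `N`. -/
def instSub {Γ : List SType} {B : SType} (N : Tm ar Γ B) : ∀ A, Var (B :: Γ) A → Tm ar Γ A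
  | _, .zero => N
  | _, .succ x => .var x

/-- `M[x := N]`, where `x` is the last variable of the context of `M`. -/
def Tm.inst {Γ : List SType} {A B : SType} (M : Tm ar (B :: Γ) A) (N : Tm ar Γ B) : Tm ar Γ A :=
  M.subst (instSub N)

/-- One step of `βδ`-reduction, in any context. The `δ`-rule is `Y N → N (Y N)` with
`N = λ x. M`. -/
inductive Step : {Γ : List SType} → {A : SType} → Tm ar Γ A → Tm ar Γ A → Prop
  | beta {Γ : List SType} {A B : SType} (M : Tm ar (A :: Γ) B) (N : Tm ar Γ A) :
      Step (.app (.lam M) N) (M.inst N)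
  | delta {Γ : List SType} {A : SType} (M : Tm ar (A :: Γ) A) :
      Step (.fix M) (.app (.lam M) (.fix M))
  | appL {Γ : List SType} {A B : SType} {M M' : Tm ar Γ (.arr A B)} (N : Tm ar Γ A) :
      Step M M' → Step (.app M N) (.app M' N)
  | appR {Γ : List SType} {A B : SType} (M : Tm ar Γ (.arr A B)) {N N' : Tm ar Γ A} :
      Step N N' → Step (.app M N) (.app M N')
  | lam {Γ : List SType} {A B : SType} {M M' : Tm ar (A :: Γ) B} :
      Step M M' → Step (.lam M) (.lam M')
  | fix {Γ : List SType} {A : SType} {M M' : Tm ar (A :: Γ) A} :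
      Step M M' → Step (.fix M) (.fix M')

/-- `βδ`-reduction: the reflexive transitive closure of `Step`. -/
def Red {Γ : List SType} {A : SType} (M N : Tm ar Γ A) : Prop :=
  Relation.ReflTransGen Step M N

/-- `M N₁ … Nₙ` for `M` of type `o ^ n → o`. -/
def apps {Γ : List SType} : (n : ℕ) → Tm ar Γ (SType.ord1 n) → (Fin n → Tm ar Γ .o) → Tm ar Γ .o
  | 0, M, _ => M
  | n + 1, M, N => apps n (.app M (N 0)) (Fin.tail N)

/-- `M` reduces to the head normal form `a N₁ … Nᵢ`, where `p = (a, N)`. -/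
def HasHnf (M : Tm ar [] .o) (p : (a : C) × (Fin (ar a) → Tm ar [] .o)) : Prop :=
  Red M (apps (ar p.1) (.const p.1) p.2)

/-- Trees labelled by constants and `Ω`, as partial functions on `ℕ*`: at a node `w`, the value
`none` means that `w` is outside the domain, `some none` is the label `Ω`, and `some (some a)` is
the label `a`. Sons are numbered from `0`. -/
abbrev LTree (C : Type v) : Type v := List ℕ → Option (Option C)

open Classical in
/-- The Böhm tree of a closed term of type `o`. The choice of a head normal form is immaterial,
since `βδ`-reduction is confluent. -/
noncomputable def BT : Tm ar [] .o → LTree C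
  | M, [] => if h : ∃ p, HasHnf M p then some (some h.choose.1) else some none
  | M, j :: w =>
    if h : ∃ p, HasHnf M p then
      if hj : j < ar h.choose.1 then BT (h.choose.2 ⟨j, hj⟩) w else none
    else none

end Terms

/-! ### Weak alternating automata and acceptance -/

/-- A weak alternating automaton with states `Q` over the signature `ar : C → ℕ`. -/
structure WeakAutomaton (Q : Type u) {C : Type v} (ar : C → ℕ) where
  /-- the initial state -/
  init : Q
  /-- the transition function -/
  δ : Q → (a : C) → Set (Fin (ar a) → Set Q)
  /-- the rank function -/
  rank : Q → ℕ
  /-- transitions never increase the rank -/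
  weak : ∀ q a S, S ∈ δ q a → ∀ j, ∀ q' ∈ S j, rank q' ≤ rank q

namespace WeakAutomaton

variable {Q : Type u} {C : Type v} {ar : C → ℕ} (𝒜 : WeakAutomaton Q ar)

/-- The maximal rank. -/
def maxRank [Fintype Q] : ℕ := Finset.univ.sup 𝒜.rank

/-- A strategy of Eve in the acceptance game. A partial play is recorded as the list of the moves
`(j, q')` of Adam, in order; Eve answers a partial play that arrives at a node labelled `a` with
a tuple of sets of states. -/
abbrev Strategy (Q : Type u) {C : Type v} (ar : C → ℕ) : Type (max u v) :=
  List (ℕ × Q) → (a : C) → Fin (ar a) → Set Q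

/-- The node of the tree at which a partial play has arrived. -/
def node (h : List (ℕ × Q)) : List ℕ := h.map Prod.fst

/-- The state at which a partial play from `q` has arrived. -/
def state (q : Q) (h : List (ℕ × Q)) : Q := (h.getLast?.map Prod.snd).getD q

/-- The partial plays on the tree `t` in which Eve follows the strategy `σ`. -/
inductive Follows (t : LTree C) (σ : Strategy Q ar) : List (ℕ × Q) → Prop
  | nil : Follows t σ []
  | snoc {h : List (ℕ × Q)} {a : C} (j : Fin (ar a)) {q' : Q} :
      Follows t σ h → t (node h) = some (some a) → q' ∈ σ h a j →
      Follows t σ (h ++ [((j : ℕ), q')])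

/-- The strategy `σ` of Eve is winning from the root of `t` and the state `q`: at a node
labelled by a constant the answer of `σ` is a legal move (at a leaf this says that the transition
set is not empty), at a node labelled `Ω` the rank is even, and on every infinite play the ranks
stabilize at an even value. A play in which Adam cannot move is won by Eve. -/
def Winning (t : LTree C) (q : Q) (σ : Strategy Q ar) : Prop :=
  (∀ h, Follows t σ h → ∀ a, t (node h) = some (some a) → σ h a ∈ 𝒜.δ (state q h) a) ∧
  (∀ h, Follows t σ h → t (node h) = some none → Even (𝒜.rank (state q h))) ∧
  (∀ π : ℕ → ℕ × Q, (∀ n, Follows t σ ((List.range n).map π)) →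
    ∃ r, Even r ∧ ∃ N, ∀ n ≥ N, 𝒜.rank (π n).2 = r)

/-- The automaton accepts the tree `t` from the state `q`. -/
def Accepts (t : LTree C) (q : Q) : Prop := ∃ σ : Strategy Q ar, 𝒜.Winning t q σ

end WeakAutomaton

/-! ### The stratified model -/

/-- The ambient set-theoretic hierarchy over the powerset of `Q`. -/
def Val (Q : Type u) : SType → Type u
  | .o => Set Q
  | .arr A B => Val Q A → Val Q B

/-- The pointwise order. -/
noncomputable instance Val.instCompleteLattice (Q : Type u) :
    (A : SType) → CompleteLattice (Val Q A)
  | .o => inferInstanceAs (CompleteLattice (Set Q))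
  | .arr A B =>
    @Pi.instCompleteLattice (Val Q A) (fun _ => Val Q B) fun _ => Val.instCompleteLattice Q B

/-- An element of the hierarchy at an arrow type, as a function. -/
def Val.fn {Q : Type u} {A B : SType} (f : Val Q (.arr A B)) : Val Q A → Val Q B := f

section Model

variable {Q : Type u} (ρ : Q → ℕ)

/-- The states of rank at most `k`. -/
def Qle (k : ℕ) : Set Q := {q | ρ q ≤ k}

/-- The monotone functions from `X` to `Y`. A function defined on `X` only is represented by its
extension with value `⊥` outside `X`, so that equal functions have equal representatives. -/
def Mon {A B : SType} (X : Set (Val Q A)) (Y : Set (Val Q B)) : Set (Val Q (.arr A B)) :=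
  {f | (∀ x ∈ X, f.fn x ∈ Y) ∧ (∀ x ∈ X, ∀ y ∈ X, x ≤ y → f.fn x ≤ f.fn y) ∧
    ∀ x, x ∉ X → f.fn x = ⊥}

/-- Stratum `0`. -/
def Dzero : (A : SType) → Set (Val Q A)
  | .o => {P : Set Q | P ⊆ Qle ρ 0}
  | .arr A B => Mon (Dzero A) (Dzero B)

/-- Given stratum `k` as `D'`, the pair of stratum `k + 1` and of the logical relation between
the two strata, by induction on the type. -/
def nextStratum (k : ℕ) (D' : (A : SType) → Set (Val Q A)) :
    (A : SType) → Set (Val Q A) × Set (Val Q A × Val Q A)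
  | .o =>
    ({P : Set Q | P ⊆ Qle ρ (k + 1)},
      {p : Set Q × Set Q | p.1 ∈ D' .o ∧ p.2 ⊆ Qle ρ (k + 1) ∧ p.1 = p.2 ∩ Qle ρ k})
  | .arr A B =>
    let L : Set (Val Q (.arr A B) × Val Q (.arr A B)) :=
      {p | p.1 ∈ D' (.arr A B) ∧ p.2 ∈ Mon (nextStratum k D' A).1 (nextStratum k D' B).1 ∧
        ∀ g ∈ (nextStratum k D' A).2, (p.1.fn g.1, p.2.fn g.2) ∈ (nextStratum k D' B).2}
    ({f | ∃ f₁, (f₁, f) ∈ L}, L)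

/-- The stratified applicative structure: `D ρ k A` is stratum `k` at the type `A`. -/
def D : ℕ → (A : SType) → Set (Val Q A)
  | 0 => Dzero ρ
  | k + 1 => fun A => (nextStratum ρ k (D k) A).1

/-- The logical relation between the strata `k` and `k + 1`. -/
def L (k : ℕ) (A : SType) : Set (Val Q A × Val Q A) := (nextStratum ρ k (D ρ k) A).2

/-- The unique element of stratum `k` related to the element `e` of stratum `k + 1`. -/
noncomputable def down (k : ℕ) (A : SType) (e : Val Q A) : Val Q A := sSup {d | (d, e) ∈ L ρ k A}

/-- The least element of stratum `k + 1` related to the element `d` of stratum `k`. -/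
noncomputable def upInf (k : ℕ) (A : SType) (d : Val Q A) : Val Q A := sInf {e | (d, e) ∈ L ρ k A}

/-- The greatest element of stratum `k + 1` related to the element `d` of stratum `k`. -/
noncomputable def upSup (k : ℕ) (A : SType) (d : Val Q A) : Val Q A := sSup {e | (d, e) ∈ L ρ k A}

/-- The fixpoint operator of stratum `k`: on stratum `0` iteration downwards from the greatest
element; then, from the lifted fixpoint of the previous stratum, iteration upwards on odd strata
and downwards on even ones. -/
noncomputable def fixOp : ℕ → (A : SType) → Val Q (.arr A A) → Val Q A
  | 0, A, f => ⨅ n : ℕ, f.fn^[n] (sSup (D ρ 0 A))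
  | k + 1, A, f =>
    if Odd (k + 1) then ⨆ n : ℕ, f.fn^[n] (upInf ρ k A (fixOp k A (down ρ k (.arr A A) f)))
    else ⨅ n : ℕ, f.fn^[n] (upSup ρ k A (fixOp k A (down ρ k (.arr A A) f)))

open Classical in
/-- The element of `D ρ k (A → B)` given by the function `f` on `D ρ k A`. -/
noncomputable def lamVal (k : ℕ) (A B : SType) (f : Val Q A → Val Q B) : Val Q (.arr A B) :=
  fun x : Val Q A => if x ∈ D ρ k A then f x else ⊥

/-- Currying of an `n`-ary operation on sets of states. -/
noncomputable def curry (k : ℕ) :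
    (n : ℕ) → ((Fin n → Set Q) → Set Q) → Val Q (SType.ord1 n)
  | 0, g => g Fin.elim0
  | n + 1, g => lamVal ρ k .o (SType.ord1 n) fun P : Set Q => curry k n fun T => g (Fin.cons P T)

/-- The value of the undefined term: at type `o` it is the set of states of even rank. -/
noncomputable def omegaVal (k : ℕ) : (A : SType) → Val Q A
  | .o => ({q | ρ q ≤ k ∧ Even (ρ q)} : Set Q)
  | .arr A B => lamVal ρ k A B fun _ => omegaVal k B

end Model

/-- Valuations of the variables of a context. -/
abbrev Assign (Q : Type u) (Γ : List SType) : Type u := ∀ A, Var Γ A → Val Q A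

/-- Extension of a valuation. -/
def Assign.cons {Q : Type u} {Γ : List SType} {B : SType} (d : Val Q B) (ν : Assign Q Γ) :
    Assign Q (B :: Γ)
  | _, .zero => d
  | _, .succ x => ν _ x

section Semantics

variable {Q : Type u} {C : Type v} {ar : C → ℕ} (𝒜 : WeakAutomaton Q ar)

/-- The operation on sets of states that interprets the constant `a` on stratum `k`: a state
belongs to the result if some transition from it is contained in the arguments. -/
def constOp (k : ℕ) (a : C) (P : Fin (ar a) → Set Q) : Set Q :=
  {q | 𝒜.rank q ≤ k ∧ ∃ T ∈ 𝒜.δ q a, ∀ j, T j ⊆ P j}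

/-- If the transition function is monotone, then `constOp` just looks up in the transition
function the arguments, cut down to the ranks which a transition may contain. -/
theorem constOp_eq_of_monotone (k : ℕ) (a : C)
    (hmon : ∀ q, ∀ T ∈ 𝒜.δ q a, ∀ T', (∀ j, T j ⊆ T' j) →
      (∀ j, T' j ⊆ Qle 𝒜.rank (𝒜.rank q)) → T' ∈ 𝒜.δ q a) (P : Fin (ar a) → Set Q) :
    constOp 𝒜 k a P =
      {q | 𝒜.rank q ≤ k ∧ (fun j => P j ∩ Qle 𝒜.rank (𝒜.rank q)) ∈ 𝒜.δ q a} := by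
  ext q
  refine and_congr_right fun _ => ⟨?_, fun h => ⟨_, h, fun j => Set.inter_subset_left⟩⟩
  rintro ⟨T, hT, hTP⟩
  exact hmon q T hT _ (fun j x hx => ⟨hTP j hx, 𝒜.weak q a T hT j x hx⟩)
    fun j => Set.inter_subset_right

/-- The interpretation of terms in stratum `k` of the model. -/
noncomputable def sem (k : ℕ) : {Γ : List SType} → {A : SType} → Tm ar Γ A →
    Assign Q Γ → Val Q A
  | _, _, .var x, ν => ν _ x
  | _, _, .const a, _ => curry 𝒜.rank k (ar a) (constOp 𝒜 k a)
  | _, _, .omega A, _ => omegaVal 𝒜.rank k A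
  | _, _, .app M N, ν => (sem k M ν).fn (sem k N ν)
  | _, _, .lam (A := A) (B := B) M, ν =>
      lamVal 𝒜.rank k A B fun d => sem k M (Assign.cons d ν)
  | _, _, .fix (A := A) M, ν =>
      fixOp 𝒜.rank k A (lamVal 𝒜.rank k A A fun d => sem k M (Assign.cons d ν))

/-- The interpretation of a closed term. -/
noncomputable def semClosed (k : ℕ) {A : SType} (M : Tm ar [] A) : Val Q A :=
  sem 𝒜 k M (fun _ x => nomatch x)

end Semantics

/-! ### Intersection types -/

/-- Intersection types over a simple type: states over `o`, and `T → s`, with `T` a set of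
intersection types, over an arrow type. -/
def ITy (Q : Type u) : SType → Type u
  | .o => Q
  | .arr A B => Set (ITy Q A) × ITy Q B

section Types

variable {Q : Type u} (ρ : Q → ℕ)

/-- The (well-formed) intersection types of rank exactly `k`; those of rank at most `k` may occur
to the left of an arrow. -/
def types (k : ℕ) : (A : SType) → Set (ITy Q A)
  | .o => {q : Q | ρ q = k}
  | .arr A B =>
    {p : Set (ITy Q A) × ITy Q B | (∀ t ∈ p.1, ∃ l ≤ k, t ∈ types l A) ∧ p.2 ∈ types k B}

/-- The intersection types of rank at most `k`. -/
def Types (k : ℕ) (A : SType) : Set (ITy Q A) := {t | ∃ l ≤ k, t ∈ types ρ l A}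

/-- The intersection types of rank less than `k` (so none at all for `k = 0`). -/
def TypesLT (k : ℕ) (A : SType) : Set (ITy Q A) := {t | ∃ l < k, t ∈ types ρ l A}

/-- Subsumption of intersection types. -/
def ITy.Sub : (A : SType) → ITy Q A → ITy Q A → Prop
  | .o => fun s t : Q => s = t
  | .arr A B => fun s t : Set (ITy Q A) × ITy Q B =>
    (∀ x ∈ t.1, ∃ y ∈ s.1, ITy.Sub A x y) ∧ ITy.Sub B s.2 t.2

/-- Subsumption `S ⊑ T` of sets of intersection types. The relation `S ⊒ T` of the dual system is
generated by the very same rules, hence is this relation as well. -/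
def SetSub {A : SType} (S T : Set (ITy Q A)) : Prop := ∀ s ∈ S, ∃ t ∈ T, ITy.Sub A s t

/-- `S → T`, the set of the types `S → t` for `t ∈ T`. -/
def arrow {A B : SType} (S : Set (ITy Q A)) (T : Set (ITy Q B)) : Set (ITy Q (.arr A B)) :=
  {p : Set (ITy Q A) × ITy Q B | p.1 = S ∧ p.2 ∈ T}

/-- The application `S(T)` of sets of intersection types. -/
def tyApp {A B : SType} (S : Set (ITy Q (.arr A B))) (T : Set (ITy Q A)) : Set (ITy Q B) :=
  {t | ∃ U : Set (ITy Q A), ((U, t) : Set (ITy Q A) × ITy Q B) ∈ S ∧ SetSub U T}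

/-- The type `S₁ → … → Sₙ → q`. -/
def arrows : (n : ℕ) → (Fin n → Set Q) → Q → ITy Q (SType.ord1 n)
  | 0, _, q => q
  | n + 1, S, q => ((S 0, arrows n (Fin.tail S) q) : Set Q × ITy Q (SType.ord1 n))

open Classical in
/-- The interpretation of an intersection type in stratum `k` of the model; arrows are step
functions. -/
noncomputable def tyVal (k : ℕ) : (A : SType) → ITy Q A → Val Q A
  | .o => fun q : Q => ({q' | q' = q ∧ ρ q ≤ k} : Set Q)
  | .arr A B => fun p : Set (ITy Q A) × ITy Q B =>
    lamVal ρ k A B fun h => if (⨆ t ∈ p.1, tyVal k A t) ≤ h then tyVal k B p.2 else ⊥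

/-- The interpretation of a set of intersection types: the join of the values of its elements. -/
noncomputable def setVal (k : ℕ) {A : SType} (S : Set (ITy Q A)) : Val Q A :=
  ⨆ t ∈ S, tyVal ρ k A t

/-- Typing environments: a set of intersection types for each variable of the context. -/
abbrev Env (Q : Type u) (Γ : List SType) : Type u := ∀ A, Var Γ A → Set (ITy Q A)

/-- The empty environment. -/
def Env.nil : Env Q [] := fun _ x => nomatch x

/-- The environment `E, x ≥ S`. -/
def Env.cons {Γ : List SType} {B : SType} (E : Env Q Γ) (S : Set (ITy Q B)) : Env Q (B :: Γ)
  | _, .zero => S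
  | _, .succ x => E _ x

end Types

/-! ### The two type systems -/

section Systems

variable {Q : Type u} [Fintype Q] {C : Type v} {ar : C → ℕ} (𝒜 : WeakAutomaton Q ar)

/-- The type system: `Derives 𝒜 E M S` is derivability of the judgement `E ⊢ M ≥ S`. The rule for
constants covers constants of type `o` as the case of no arguments. -/
inductive Derives : {Γ : List SType} → Env Q Γ → {A : SType} → Tm ar Γ A → Set (ITy Q A) → Prop
  | var {Γ : List SType} {E : Env Q Γ} {A : SType} (x : Var Γ A) : Derives E (.var x) (E A x)
  | empty {Γ : List SType} {E : Env Q Γ} {A : SType} (M : Tm ar Γ A) : Derives E M ∅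
  | union {Γ : List SType} {E : Env Q Γ} {A : SType} {M : Tm ar Γ A} {S T : Set (ITy Q A)} :
      Derives E M S → Derives E M T → Derives E M (S ∪ T)
  | sub {Γ : List SType} {E : Env Q Γ} {A : SType} {M : Tm ar Γ A} {S T : Set (ITy Q A)} :
      Derives E M S → T ⊆ Types 𝒜.rank 𝒜.maxRank A → SetSub T S → Derives E M T
  | const {Γ : List SType} {E : Env Q Γ} (a : C) (q : Q) (S : Fin (ar a) → Set Q) :
      S ∈ 𝒜.δ q a → Derives E (.const a) {arrows (ar a) S q}
  | omega {Γ : List SType} {E : Env Q Γ} {A : SType} (k : ℕ) {S : Set (ITy Q A)} :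
      S ⊆ types 𝒜.rank (2 * k) A → Derives E (.omega A) S
  | app {Γ : List SType} {E : Env Q Γ} {A B : SType} {M : Tm ar Γ (.arr A B)} {N : Tm ar Γ A}
      {S : Set (ITy Q (.arr A B))} {T : Set (ITy Q A)} :
      Derives E M S → Derives E N T → Derives E (.app M N) (tyApp S T)
  | lam {Γ : List SType} {E : Env Q Γ} {A B : SType} {M : Tm ar (A :: Γ) B} (k : ℕ)
      {S : Set (ITy Q A)} {T : Set (ITy Q B)} :
      S ⊆ Types 𝒜.rank k A → T ⊆ types 𝒜.rank k B → Derives (E.cons S) M T →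
      Derives E (.lam M) (arrow S T)
  | fixOdd {Γ : List SType} {E : Env Q Γ} {A : SType} {M : Tm ar (A :: Γ) A}
      {S : Set (ITy Q (.arr A A))} {T : Set (ITy Q A)} :
      Derives E (.lam M) S → Derives E (.fix M) T → Derives E (.fix M) (tyApp S T)
  | fixEven {Γ : List SType} {E : Env Q Γ} {A : SType} {M : Tm ar (A :: Γ) A} (k : ℕ)
      {S T : Set (ITy Q A)} :
      S ⊆ types 𝒜.rank (2 * k) A → T ⊆ TypesLT 𝒜.rank (2 * k) A →
      Derives E (.lam M) (arrow (S ∪ T) S) → Derives E (.fix M) T →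
      Derives E (.fix M) (S ∪ T)

/-- The dual type system: `DualDerives 𝒜 E M S` is derivability of the judgement `E ⊢ M ≱ S`. -/
inductive DualDerives :
    {Γ : List SType} → Env Q Γ → {A : SType} → Tm ar Γ A → Set (ITy Q A) → Prop
  | var {Γ : List SType} {E : Env Q Γ} {A : SType} (x : Var Γ A) : DualDerives E (.var x) (E A x)
  | empty {Γ : List SType} {E : Env Q Γ} {A : SType} (M : Tm ar Γ A) : DualDerives E M ∅
  | union {Γ : List SType} {E : Env Q Γ} {A : SType} {M : Tm ar Γ A} {S T : Set (ITy Q A)} :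
      DualDerives E M S → DualDerives E M T → DualDerives E M (S ∪ T)
  | sub {Γ : List SType} {E : Env Q Γ} {A : SType} {M : Tm ar Γ A} {S T : Set (ITy Q A)} :
      DualDerives E M S → T ⊆ Types 𝒜.rank 𝒜.maxRank A → SetSub T S → DualDerives E M T
  | const {Γ : List SType} {E : Env Q Γ} (a : C) (q : Q) (T : Fin (ar a) → Set Q) :
      (∀ j, T j ⊆ Qle 𝒜.rank (𝒜.rank q)) → (∀ S ∈ 𝒜.δ q a, ∃ j, (T j ∩ S j).Nonempty) →
      DualDerives E (.const a) {arrows (ar a) T q}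
  | omega {Γ : List SType} {E : Env Q Γ} {A : SType} (k : ℕ) {S : Set (ITy Q A)} :
      S ⊆ types 𝒜.rank (2 * k + 1) A → DualDerives E (.omega A) S
  | app {Γ : List SType} {E : Env Q Γ} {A B : SType} {M : Tm ar Γ (.arr A B)} {N : Tm ar Γ A}
      {S : Set (ITy Q (.arr A B))} {T : Set (ITy Q A)} :
      DualDerives E M S → DualDerives E N T → DualDerives E (.app M N) (tyApp S T)
  | lam {Γ : List SType} {E : Env Q Γ} {A B : SType} {M : Tm ar (A :: Γ) B} (k : ℕ)
      {S : Set (ITy Q A)} {T : Set (ITy Q B)} :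
      S ⊆ Types 𝒜.rank k A → T ⊆ types 𝒜.rank k B → DualDerives (E.cons S) M T →
      DualDerives E (.lam M) (arrow S T)
  | fixOdd {Γ : List SType} {E : Env Q Γ} {A : SType} {M : Tm ar (A :: Γ) A} (k : ℕ)
      {S T : Set (ITy Q A)} :
      S ⊆ types 𝒜.rank (2 * k + 1) A → T ⊆ Types 𝒜.rank (2 * k) A →
      DualDerives E (.lam M) (arrow (S ∪ T) S) → DualDerives E (.fix M) T →
      DualDerives E (.fix M) (S ∪ T)
  | fixEven {Γ : List SType} {E : Env Q Γ} {A : SType} {M : Tm ar (A :: Γ) A}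
      {S : Set (ITy Q (.arr A A))} {T : Set (ITy Q A)} :
      DualDerives E (.lam M) S → DualDerives E (.fix M) T → DualDerives E (.fix M) (tyApp S T)

end Systems

end LambdaY

open LambdaY

/-! Everything is compared with one set: the states `q` that belong to the value of `M` on the
stratum of their own rank. The values of a term on successive strata are related, so a state once
decided at its rank keeps its status above it, and this set is the value of `M` on the top stratum.
It remains to see that it is the set of accepted states, and the set described by the two type
systems.

Reversing the order exchanges odd and even ranks, Eve and Adam, and the two type systems. A sign `b`
records the side (`SLe`, `SMem`), and `sgn k` is the sign for which the fixpoints of stratum `k` are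
least; most arguments are made once for both signs. Elements of a single stratum are replaced by
coherent families over all strata (`Coh`). Since `Q` is finite, a fixpoint of stratum `k` is a
finite iterate of a starting point: an extremal lift of the fixpoint below, or the top element when
`k = 0`. For the sign `sgn k`, the starting point at base type contains no state of rank `k`. The
principle `fixFam_induction` packages this and carries each main argument about recursion.

Game. A player who would lose by staying in rank `k` forever must leave it. A logical relation
between families and closed terms (`Rel`, with fundamental lemma `rel_subst`) shows that every state
of rank `k` which the semantics gives to that player lies in the attractor `WinN`: in boundedly many
moves the player reaches a favourable position of smaller rank, or blocks the opponent. Recursion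
needs no syntactic approximants, since each semantic iteration is matched by one unfolding of the
term. The opponent need only preserve the semantics. Moves that preserve the semantics and, where
necessary, shorten the distance to the exit give Eve a winning strategy; on the complement they let
Adam refute any strategy, as a play stuck in a bad rank would be an infinite descent.

Types. Soundness is an induction on derivations, with types read as properties of coherent families
(`Sat`). For completeness, a set `T` of types of bounded rank has a least value satisfying it
(`leastVal`), the types of that value are subsumed by `T`, and types determine the order
(`sLe_of_forall_sat`). Hence every type satisfied by a term is derivable (`Rules.complete`). For
recursion, one parity of ranks is handled by replaying the semantic iteration with the unfolding
rule; for the other, the types of the fixpoint themselves form the invariant required by the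
coinductive rule. -/

namespace LambdaY

universe u v

/-! ### Substitution and confluence -/

section Substitution

variable {C : Type v} {ar : C → ℕ}

/-! ### Composition laws for renamings and substitutions. -/

theorem liftRen_comp {Γ Δ Θ : List SType} (r : ∀ A, Var Γ A → Var Δ A)
    (r' : ∀ A, Var Δ A → Var Θ A) (B : SType) :
    (fun A x => liftRen r' B A (liftRen r B A x)) = liftRen (fun A x => r' A (r A x)) B := by
  funext A x
  cases x <;> rfl

theorem Tm.rename_rename {Γ : List SType} {A : SType} (M : Tm ar Γ A) :
    ∀ {Δ Θ : List SType} (r : ∀ A, Var Γ A → Var Δ A) (r' : ∀ A, Var Δ A → Var Θ A),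
      (M.rename r).rename r' = M.rename (fun A x => r' A (r A x)) := by
  induction M with
  | var x => intros; rfl
  | const a => intros; rfl
  | omega A => intros; rfl
  | app M N ihM ihN => intro _ _ r r'; simp only [Tm.rename, ihM, ihN]
  | lam M ih => intro _ _ r r'; simp only [Tm.rename, ih, liftRen_comp]
  | fix M ih => intro _ _ r r'; simp only [Tm.rename, ih, liftRen_comp]

theorem liftSub_liftRen {Γ Δ Θ : List SType} (r : ∀ A, Var Γ A → Var Δ A)
    (s : ∀ A, Var Δ A → Tm ar Θ A) (B : SType) :
    (fun A x => liftSub s B A (liftRen r B A x)) = liftSub (fun A x => s A (r A x)) B := by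
  funext A x
  cases x <;> rfl

theorem Tm.subst_rename_left {Γ : List SType} {A : SType} (M : Tm ar Γ A) :
    ∀ {Δ Θ : List SType} (r : ∀ A, Var Γ A → Var Δ A) (s : ∀ A, Var Δ A → Tm ar Θ A),
      (M.rename r).subst s = M.subst (fun A x => s A (r A x)) := by
  induction M with
  | var x => intros; rfl
  | const a => intros; rfl
  | omega A => intros; rfl
  | app M N ihM ihN => intro _ _ r r'; simp only [Tm.rename, Tm.subst, ihM, ihN]
  | lam M ih => intro _ _ r r'; simp only [Tm.rename, Tm.subst, ih, liftSub_liftRen]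
  | fix M ih => intro _ _ r r'; simp only [Tm.rename, Tm.subst, ih, liftSub_liftRen]

theorem rename_liftSub {Γ Δ Θ : List SType} (s : ∀ A, Var Γ A → Tm ar Δ A)
    (r : ∀ A, Var Δ A → Var Θ A) (B : SType) :
    (fun A x => (liftSub s B A x).rename (liftRen r B)) =
      liftSub (fun A x => (s A x).rename r) B := by
  funext A x
  cases x with
  | zero => rfl
  | succ x => simp only [liftSub, Tm.rename_rename]; rfl

theorem Tm.rename_subst {Γ : List SType} {A : SType} (M : Tm ar Γ A) :
    ∀ {Δ Θ : List SType} (s : ∀ A, Var Γ A → Tm ar Δ A) (r : ∀ A, Var Δ A → Var Θ A),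
      (M.subst s).rename r = M.subst (fun A x => (s A x).rename r) := by
  induction M with
  | var x => intros; rfl
  | const a => intros; rfl
  | omega A => intros; rfl
  | app M N ihM ihN => intro _ _ r r'; simp only [Tm.rename, Tm.subst, ihM, ihN]
  | lam M ih => intro _ _ r r'; simp only [Tm.rename, Tm.subst, ih, rename_liftSub]
  | fix M ih => intro _ _ r r'; simp only [Tm.rename, Tm.subst, ih, rename_liftSub]

theorem subst_liftSub {Γ Δ Θ : List SType} (s : ∀ A, Var Γ A → Tm ar Δ A)
    (s' : ∀ A, Var Δ A → Tm ar Θ A) (B : SType) :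
    (fun A x => (liftSub s B A x).subst (liftSub s' B)) =
      liftSub (fun A x => (s A x).subst s') B := by
  funext A x
  cases x with
  | zero => rfl
  | succ x => simp only [liftSub, Tm.subst_rename_left, Tm.rename_subst]

theorem Tm.subst_subst {Γ : List SType} {A : SType} (M : Tm ar Γ A) :
    ∀ {Δ Θ : List SType} (s : ∀ A, Var Γ A → Tm ar Δ A) (s' : ∀ A, Var Δ A → Tm ar Θ A),
      (M.subst s).subst s' = M.subst (fun A x => (s A x).subst s') := by
  induction M with
  | var x => intros; rfl
  | const a => intros; rfl
  | omega A => intros; rfl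
  | app M N ihM ihN => intro _ _ r r'; simp only [Tm.subst, ihM, ihN]
  | lam M ih => intro _ _ r r'; simp only [Tm.subst, ih, subst_liftSub]
  | fix M ih => intro _ _ r r'; simp only [Tm.subst, ih, subst_liftSub]

theorem liftSub_var {Γ : List SType} (B : SType) :
    liftSub (fun A (x : Var Γ A) => (Tm.var x : Tm ar Γ A)) B = fun _ x => .var x := by
  funext A x
  cases x <;> rfl

theorem Tm.subst_var {Γ : List SType} {A : SType} (M : Tm ar Γ A) :
    M.subst (fun _ x => .var x) = M := by
  induction M with
  | var x => rfl
  | const a => rfl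
  | omega A => rfl
  | app M N ihM ihN => simp only [Tm.subst, ihM, ihN]
  | lam M ih => simp only [Tm.subst, liftSub_var, ih]
  | fix M ih => simp only [Tm.subst, liftSub_var, ih]

/-- Extension of a substitution by a term for the last variable. -/
def consSub {Γ Δ : List SType} {B : SType} (N : Tm ar Δ B) (s : ∀ A, Var Γ A → Tm ar Δ A) :
    ∀ A, Var (B :: Γ) A → Tm ar Δ A
  | _, .zero => N
  | _, .succ x => s _ x

theorem Tm.subst_closed {A : SType} (M : Tm ar [] A) (s : ∀ A, Var [] A → Tm ar [] A) :
    M.subst s = M := by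
  have : s = fun _ x => .var x := by funext A x; cases x
  rw [this, M.subst_var]

theorem Tm.inst_subst_lift {Γ Δ : List SType} {A B : SType} (M : Tm ar (B :: Γ) A)
    (s : ∀ A, Var Γ A → Tm ar Δ A) (N : Tm ar Δ B) :
    (M.subst (liftSub s B)).inst N = M.subst (consSub N s) := by
  rw [Tm.inst, Tm.subst_subst]
  congr 1
  funext A x
  cases x with
  | zero => rfl
  | succ x =>
    simp only [liftSub, Tm.subst_rename_left, instSub, consSub]
    exact Tm.subst_var _

theorem Tm.subst_inst {Γ Δ : List SType} {A B : SType} (M : Tm ar (B :: Γ) A) (N : Tm ar Γ B)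
    (s : ∀ A, Var Γ A → Tm ar Δ A) :
    (M.inst N).subst s = (M.subst (liftSub s B)).inst (N.subst s) := by
  rw [Tm.inst_subst_lift, Tm.inst, Tm.subst_subst]
  congr 1
  funext A x
  cases x <;> rfl

/-- Parallel reduction. -/
inductive Par : {Γ : List SType} → {A : SType} → Tm ar Γ A → Tm ar Γ A → Prop
  | refl {Γ : List SType} {A : SType} (M : Tm ar Γ A) : Par M M
  | app {Γ : List SType} {A B : SType} {M M' : Tm ar Γ (.arr A B)} {N N' : Tm ar Γ A} :
      Par M M' → Par N N' → Par (.app M N) (.app M' N')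
  | lam {Γ : List SType} {A B : SType} {M M' : Tm ar (A :: Γ) B} :
      Par M M' → Par (.lam M) (.lam M')
  | fix {Γ : List SType} {A : SType} {M M' : Tm ar (A :: Γ) A} :
      Par M M' → Par (.fix M) (.fix M')
  | beta {Γ : List SType} {A B : SType} {M M' : Tm ar (A :: Γ) B} {N N' : Tm ar Γ A} :
      Par M M' → Par N N' → Par (.app (.lam M) N) (M'.inst N')
  | delta {Γ : List SType} {A : SType} {M M' : Tm ar (A :: Γ) A} :
      Par M M' → Par (.fix M) (.app (.lam M') (.fix M'))

/-! ### Substitutivity and the diamond property of parallel reduction. -/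

theorem Par.rename {Γ : List SType} {A : SType} {M M' : Tm ar Γ A} (h : Par M M') :
    ∀ {Δ : List SType} (r : ∀ A, Var Γ A → Var Δ A), Par (M.rename r) (M'.rename r) := by
  induction h with
  | refl M => intros; exact .refl _
  | app _ _ ihM ihN => intro _ r; exact .app (ihM r) (ihN r)
  | lam _ ih => intro _ r; exact .lam (ih _)
  | fix _ ih => intro _ r; exact .fix (ih _)
  | @beta Γ A B M M' N N' _ _ ihM ihN =>
    intro _ r
    have : (M'.inst N').rename r = (M'.rename (liftRen r A)).inst (N'.rename r) := by
      rw [Tm.inst, Tm.inst, Tm.rename_subst, Tm.subst_rename_left]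
      congr 1
      funext A x
      cases x <;> rfl
    rw [this]
    exact .beta (ihM _) (ihN _)
  | delta _ ih => intro _ r; exact .delta (ih _)

theorem Par.liftSub {Γ Δ : List SType} {s s' : ∀ A, Var Γ A → Tm ar Δ A}
    (h : ∀ A x, Par (s A x) (s' A x)) (B : SType) (A : SType) (x : Var (B :: Γ) A) :
    Par (liftSub s B A x) (LambdaY.liftSub s' B A x) := by
  cases x with
  | zero => exact .refl _
  | succ x => exact (h _ x).rename _

theorem Par.subst_right {Γ : List SType} {A : SType} (M : Tm ar Γ A) :
    ∀ {Δ : List SType} {s s' : ∀ A, Var Γ A → Tm ar Δ A}, (∀ A x, Par (s A x) (s' A x)) →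
      Par (M.subst s) (M.subst s') := by
  induction M with
  | var x => intro _ _ _ h; exact h _ x
  | const a => intros; exact .refl _
  | omega A => intros; exact .refl _
  | app M N ihM ihN => intro _ _ _ h; exact .app (ihM h) (ihN h)
  | lam M ih => intro _ _ _ h; exact .lam (ih (Par.liftSub h _))
  | fix M ih => intro _ _ _ h; exact .fix (ih (Par.liftSub h _))

theorem Par.subst {Γ : List SType} {A : SType} {M M' : Tm ar Γ A} (hM : Par M M') :
    ∀ {Δ : List SType} {s s' : ∀ A, Var Γ A → Tm ar Δ A}, (∀ A x, Par (s A x) (s' A x)) →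
      Par (M.subst s) (M'.subst s') := by
  induction hM with
  | refl M => intro _ _ _ h; exact Par.subst_right M h
  | app _ _ ihM ihN => intro _ _ _ h; exact .app (ihM h) (ihN h)
  | lam _ ih => intro _ _ _ h; exact .lam (ih (Par.liftSub h _))
  | fix _ ih => intro _ _ _ h; exact .fix (ih (Par.liftSub h _))
  | beta _ _ ihM ihN =>
    intro _ _ _ h
    rw [Tm.subst_inst]
    exact .beta (ihM (Par.liftSub h _)) (ihN h)
  | delta _ ih => intro _ _ _ h; exact .delta (ih (Par.liftSub h _))

theorem Par.inst {Γ : List SType} {A B : SType} {M M' : Tm ar (B :: Γ) A} {N N' : Tm ar Γ B}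
    (hM : Par M M') (hN : Par N N') : Par (M.inst N) (M'.inst N') := by
  refine hM.subst fun A x => ?_
  cases x with
  | zero => exact hN
  | succ x => exact .refl _

theorem Par.lam_inv {Γ : List SType} {A B : SType} {M : Tm ar (A :: Γ) B}
    {X : Tm ar Γ (.arr A B)} (h : Par (.lam M) X) : ∃ M', X = .lam M' ∧ Par M M' := by
  cases h with
  | refl => exact ⟨M, rfl, .refl _⟩
  | lam h => exact ⟨_, rfl, h⟩

theorem Par.app_inv {Γ : List SType} {A B : SType} {M : Tm ar Γ (.arr A B)} {N : Tm ar Γ A}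
    {X : Tm ar Γ B} (h : Par (.app M N) X) :
    (∃ M' N', X = .app M' N' ∧ Par M M' ∧ Par N N') ∨
      ∃ M₀ M' N', M = .lam M₀ ∧ X = M'.inst N' ∧ Par M₀ M' ∧ Par N N' := by
  cases h with
  | refl => exact .inl ⟨M, N, rfl, .refl _, .refl _⟩
  | app h h' => exact .inl ⟨_, _, rfl, h, h'⟩
  | beta h h' => exact .inr ⟨_, _, _, rfl, rfl, h, h'⟩

theorem Par.fix_inv {Γ : List SType} {A : SType} {M : Tm ar (A :: Γ) A} {X : Tm ar Γ A}
    (h : Par (.fix M) X) :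
    ∃ M', Par M M' ∧ (X = .fix M' ∨ X = .app (.lam M') (.fix M')) := by
  cases h with
  | refl => exact ⟨M, .refl _, .inl rfl⟩
  | fix h => exact ⟨_, h, .inl rfl⟩
  | delta h => exact ⟨_, h, .inr rfl⟩

/-- The critical peaks contract a redex on one side only. A parallel reduct of an abstraction is
again an abstraction, so the redex survives on the other side and can still be contracted there;
`Par.inst` closes the diagram. -/
theorem Par.diamond {Γ : List SType} {A : SType} {M N : Tm ar Γ A} (h : Par M N) :
    ∀ {N' : Tm ar Γ A}, Par M N' → ∃ P, Par N P ∧ Par N' P := by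
  induction h with
  | refl M => intro N' h; exact ⟨N', h, .refl _⟩
  | @app Γ A B M M' N N' hM hN ihM ihN =>
    intro X hX
    obtain ⟨M₂, N₂, rfl, hM₂, hN₂⟩ | ⟨M₀, M₂, N₂, rfl, rfl, hM₂, hN₂⟩ := hX.app_inv
    · obtain ⟨P, hP, hP'⟩ := ihM hM₂
      obtain ⟨R, hR, hR'⟩ := ihN hN₂
      exact ⟨_, .app hP hR, .app hP' hR'⟩
    · obtain ⟨P, hP, hP'⟩ := ihM (.lam hM₂)
      obtain ⟨R, hR, hR'⟩ := ihN hN₂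
      obtain ⟨M₁, rfl, -⟩ := hM.lam_inv
      obtain ⟨P₀, rfl, h₁⟩ := hP.lam_inv
      obtain ⟨P₁, h₂, h₃⟩ := hP'.lam_inv
      cases h₂
      exact ⟨_, .beta h₁ hR, .inst h₃ hR'⟩
  | lam _ ih =>
    intro X hX
    obtain ⟨M₂, rfl, hM₂⟩ := hX.lam_inv
    obtain ⟨P, hP, hP'⟩ := ih hM₂
    exact ⟨_, .lam hP, .lam hP'⟩
  | fix _ ih =>
    intro X hX
    obtain ⟨M₂, hM₂, rfl | rfl⟩ := hX.fix_inv <;> obtain ⟨P, hP, hP'⟩ := ih hM₂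
    · exact ⟨_, .fix hP, .fix hP'⟩
    · exact ⟨_, .delta hP, .app (.lam hP') (.fix hP')⟩
  | @beta Γ A B M M' N N' hM hN ihM ihN =>
    intro X hX
    obtain ⟨M₂, N₂, rfl, hM₂, hN₂⟩ | ⟨M₀, M₂, N₂, h₀, rfl, hM₂, hN₂⟩ := hX.app_inv
    · obtain ⟨M₃, rfl, hM₃⟩ := hM₂.lam_inv
      obtain ⟨P, hP, hP'⟩ := ihM hM₃
      obtain ⟨R, hR, hR'⟩ := ihN hN₂
      exact ⟨_, .inst hP hR, .beta hP' hR'⟩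
    · cases h₀
      obtain ⟨P, hP, hP'⟩ := ihM hM₂
      obtain ⟨R, hR, hR'⟩ := ihN hN₂
      exact ⟨_, .inst hP hR, .inst hP' hR'⟩
  | delta _ ih =>
    intro X hX
    obtain ⟨M₂, hM₂, rfl | rfl⟩ := hX.fix_inv <;> obtain ⟨P, hP, hP'⟩ := ih hM₂
    · exact ⟨_, .app (.lam hP) (.fix hP), .delta hP'⟩
    · exact ⟨_, .app (.lam hP) (.fix hP), .app (.lam hP') (.fix hP')⟩

/-! ### From parallel reduction to confluence. -/

theorem Step.par {Γ : List SType} {A : SType} {M N : Tm ar Γ A} (h : Step M N) : Par M N := by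
  induction h with
  | beta M N => exact .beta (.refl _) (.refl _)
  | delta M => exact .delta (.refl _)
  | appL N _ ih => exact .app ih (.refl _)
  | appR M _ ih => exact .app (.refl _) ih
  | lam _ ih => exact .lam ih
  | fix _ ih => exact .fix ih

theorem Red.app {Γ : List SType} {A B : SType} {M M' : Tm ar Γ (.arr A B)} {N N' : Tm ar Γ A}
    (hM : Red M M') (hN : Red N N') : Red (.app M N) (.app M' N') :=
  (Relation.ReflTransGen.lift (fun M => Tm.app M N) (fun _ _ => Step.appL N) _ _ hM).trans
    (Relation.ReflTransGen.lift (fun N => Tm.app M' N) (fun _ _ => Step.appR M') _ _ hN)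

theorem Red.lam {Γ : List SType} {A B : SType} {M M' : Tm ar (A :: Γ) B} (h : Red M M') :
    Red (.lam M) (.lam M') :=
  Relation.ReflTransGen.lift Tm.lam (fun _ _ => Step.lam) _ _ h

theorem Red.fix {Γ : List SType} {A : SType} {M M' : Tm ar (A :: Γ) A} (h : Red M M') :
    Red (.fix M) (.fix M') :=
  Relation.ReflTransGen.lift Tm.fix (fun _ _ => Step.fix) _ _ h

theorem Par.red {Γ : List SType} {A : SType} {M N : Tm ar Γ A} (h : Par M N) : Red M N := by
  induction h with
  | refl M => exact .refl
  | app _ _ ihM ihN => exact .app ihM ihN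
  | lam _ ih => exact .lam ih
  | fix _ ih => exact .fix ih
  | beta _ _ ihM ihN => exact (Red.app ihM.lam ihN).tail (.beta _ _)
  | delta _ ih => exact ih.fix.tail (.delta _)

theorem red_iff_par {Γ : List SType} {A : SType} {M N : Tm ar Γ A} :
    Red M N ↔ Relation.ReflTransGen Par M N := by
  refine ⟨fun h => Relation.ReflTransGen.mono (fun _ _ => Step.par) _ _ h, fun h => ?_⟩
  induction h with
  | refl => exact .refl
  | tail _ h ih => exact ih.trans h.red

/-- Two terms have a common reduct. -/
def Joins {Γ : List SType} {A : SType} (M N : Tm ar Γ A) : Prop := ∃ P, Red M P ∧ Red N P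

theorem Red.confluent {Γ : List SType} {A : SType} {M N N' : Tm ar Γ A}
    (h : Red M N) (h' : Red M N') : Joins N N' := by
  rw [red_iff_par] at h h'
  obtain ⟨P, hP, hP'⟩ := Relation.church_rosser (fun a b c hb hc => by
    obtain ⟨d, hd, hd'⟩ := Par.diamond hb hc
    exact ⟨d, .single hd, .single hd'⟩) h h'
  exact ⟨P, red_iff_par.2 hP, red_iff_par.2 hP'⟩

/-- The term is an abstraction. -/
def Tm.IsLam : {Γ : List SType} → {A : SType} → Tm ar Γ A → Prop
  | _, _, .lam _ => True
  | _, _, _ => False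

/-- The constant at the head of a chain of applications. -/
def Tm.head : {Γ : List SType} → {A : SType} → Tm ar Γ A → Option C
  | _, _, .const a => some a
  | _, _, .app M _ => M.head
  | _, _, _ => none

/-- The term is a constant. -/
def Tm.IsConst : {Γ : List SType} → {A : SType} → Tm ar Γ A → Prop
  | _, _, .const _ => True
  | _, _, _ => False

/-- Stated for a general term: the type `SType.ord1 (ar a)` of a constant is not a constructor
pattern, which obstructs a direct case analysis. -/
theorem Par.eq_of_isConst {Γ : List SType} {A : SType} {M N : Tm ar Γ A} (h : Par M N)
    (hM : M.IsConst) : N = M := by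
  cases h with
  | refl => rfl
  | _ => exact hM.elim

theorem Tm.IsConst.not_isLam {Γ : List SType} {A : SType} {M : Tm ar Γ A} (hM : M.IsConst) :
    ¬ M.IsLam := by
  cases M <;> simp_all [Tm.IsConst, Tm.IsLam]

theorem par_apps {Γ : List SType} : ∀ (n : ℕ) {M : Tm ar Γ (SType.ord1 n)}
    {N : Fin n → Tm ar Γ .o} {X : Tm ar Γ .o}, ¬ M.IsLam → Par (apps n M N) X →
    ∃ M' N', Par M M' ∧ X = apps n M' N' ∧ ∀ j, Par (N j) (N' j)
  | 0, M, N, X, _, h => ⟨X, N, h, rfl, fun j => j.elim0⟩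
  | n + 1, M, N, X, hM, h => by
    obtain ⟨M₁, N₁, h₁, rfl, h₂⟩ := par_apps n (M := .app M (N 0)) (fun h => h) h
    obtain ⟨M', N', rfl, hM', hN'⟩ | ⟨M₀, M', N', rfl, -⟩ := h₁.app_inv
    · exact ⟨M', Fin.cons N' N₁, hM', rfl, fun j => Fin.cases hN' h₂ j⟩
    · exact absurd trivial hM

/-- No rule contracts a constant, so reduction below a constant head takes place inside the
arguments. -/
theorem red_const_apps {Γ : List SType} {a : C} {N : Fin (ar a) → Tm ar Γ .o} {X : Tm ar Γ .o}
    (h : Red (apps (ar a) (.const a) N) X) :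
    ∃ N', X = apps (ar a) (.const a) N' ∧ ∀ j, Red (N j) (N' j) := by
  rw [red_iff_par] at h
  induction h with
  | refl => exact ⟨N, rfl, fun _ => .refl⟩
  | tail _ h ih =>
    obtain ⟨N', rfl, hN'⟩ := ih
    have hc : (Tm.const a : Tm ar Γ _).IsConst := trivial
    obtain ⟨M'', N'', hM, rfl, hN''⟩ := par_apps (ar a) hc.not_isLam h
    cases hM.eq_of_isConst hc
    exact ⟨N'', rfl, fun j => (hN' j).trans (hN'' j).red⟩

theorem head_apps {Γ : List SType} : ∀ (n : ℕ) (M : Tm ar Γ (SType.ord1 n))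
    (N : Fin n → Tm ar Γ .o), (apps n M N).head = M.head
  | 0, _, _ => rfl
  | n + 1, M, N => head_apps n (.app M (N 0)) (Fin.tail N)

theorem apps_injective {Γ : List SType} : ∀ (n : ℕ) {M M' : Tm ar Γ (SType.ord1 n)}
    {N N' : Fin n → Tm ar Γ .o}, apps n M N = apps n M' N' → M = M' ∧ N = N'
  | 0, _, _, _, _, h => ⟨h, funext fun j => j.elim0⟩
  | n + 1, M, M', N, N', h => by
    obtain ⟨h₁, h₂⟩ := apps_injective n h
    obtain ⟨-, h₃, h₄⟩ := Tm.app.inj h₁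
    refine ⟨eq_of_heq h₃, funext fun j => Fin.cases (eq_of_heq h₄) (fun i => congrFun h₂ i) j⟩

/-- By confluence the two forms have a common reduct, in which the heads are intact. This makes the
choice in `BT` harmless: arguments are determined up to a common reduct. -/
theorem HasHnf.unique {M : Tm ar [] .o} {a a' : C} {N : Fin (ar a) → Tm ar [] .o}
    {N' : Fin (ar a') → Tm ar [] .o} (h : HasHnf M ⟨a, N⟩) (h' : HasHnf M ⟨a', N'⟩) :
    ∃ e : a = a', ∀ j, Joins (N j) (N' (Fin.cast (congrArg ar e) j)) := by
  obtain ⟨P, hP, hP'⟩ := Red.confluent h h'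
  obtain ⟨N₁, rfl, h₁⟩ := red_const_apps hP
  obtain ⟨N₂, h₃, h₂⟩ := red_const_apps hP'
  have e : a = a' := by
    have := congrArg Tm.head h₃
    rw [head_apps, head_apps] at this
    exact Option.some.inj this
  subst e
  obtain ⟨-, rfl⟩ := apps_injective _ h₃
  exact ⟨rfl, fun j => ⟨_, h₁ j, h₂ j⟩⟩

end Substitution

/-! ### The stratified model up to duality -/

section Order

variable {Q : Type u}

/-- The order of the model, reversed if the sign is `false`. -/
def SLe (b : Bool) {A : SType} (x y : Val Q A) : Prop :=
  match b with
  | true => x ≤ y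
  | false => y ≤ x

/-- Membership in a set of states, negated if the sign is `false`. -/
def SMem (b : Bool) (q : Q) (P : Val Q .o) : Prop :=
  match b with
  | true => q ∈ (show Set Q from P)
  | false => q ∉ (show Set Q from P)

variable {A B : SType} {b : Bool}

theorem SLe.refl (b : Bool) (x : Val Q A) : SLe b x x := by cases b <;> exact le_refl x

theorem SLe.of_eq (b : Bool) {x y : Val Q A} (h : x = y) : SLe b x y := h ▸ SLe.refl b x

theorem SLe.trans {x y z : Val Q A} (h : SLe b x y) (h' : SLe b y z) : SLe b x z := by
  cases b
  · exact le_trans (α := Val Q A) h' h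
  · exact le_trans (α := Val Q A) h h'

theorem SLe.antisymm {x y : Val Q A} (h : SLe b x y) (h' : SLe b y x) : x = y := by
  cases b
  · exact le_antisymm (α := Val Q A) h' h
  · exact le_antisymm (α := Val Q A) h h'

theorem sLe_arr {f g : Val Q (.arr A B)} : SLe b f g ↔ ∀ x, SLe b (f.fn x) (g.fn x) := by
  cases b <;> exact Iff.rfl

theorem sLe_o {P P' : Val Q .o} : SLe b P P' ↔ ∀ q, SMem b q P → SMem b q P' := by
  cases b
  · exact ⟨fun h q hq hq' => hq (h hq'), fun h q hq => by_contra fun h' => h q h' hq⟩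
  · exact Iff.rfl

theorem sMem_not {q : Q} {P : Val Q .o} : SMem (!b) q P ↔ ¬ SMem b q P := by
  cases b
  · exact not_not.symm
  · exact Iff.rfl

instance Val.instFinite [Finite Q] : (A : SType) → Finite (Val Q A)
  | .o => inferInstanceAs (Finite (Set Q))
  | .arr A B =>
    have := Val.instFinite A
    have := Val.instFinite B
    inferInstanceAs (Finite (Val Q A → Val Q B))

end Order

section Model

variable {Q : Type u} {ρ : Q → ℕ} {k : ℕ} {A B : SType} {b : Bool}

theorem lamVal_of_mem {f : Val Q A → Val Q B} {x : Val Q A} (h : x ∈ D ρ k A) :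
    (lamVal ρ k A B f).fn x = f x := if_pos h

theorem lamVal_of_notMem {f : Val Q A → Val Q B} {x : Val Q A} (h : x ∉ D ρ k A) :
    (lamVal ρ k A B f).fn x = ⊥ := if_neg h

theorem mem_D_o {P : Val Q .o} : P ∈ D ρ k .o ↔ (show Set Q from P) ⊆ Qle ρ k := by
  cases k <;> exact Iff.rfl

theorem mem_L_o {p : Val Q .o × Val Q .o} :
    p ∈ L ρ k .o ↔ p.1 ∈ D ρ k .o ∧ p.2 ∈ D ρ (k + 1) .o ∧
      ∀ q, q ∈ (show Set Q from p.1) ↔ q ∈ (show Set Q from p.2) ∧ ρ q ≤ k :=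
  and_congr_right fun _ => and_congr_right fun _ => Set.ext_iff

theorem mem_L_arr {p : Val Q (.arr A B) × Val Q (.arr A B)} :
    p ∈ L ρ k (.arr A B) ↔ p.1 ∈ D ρ k (.arr A B) ∧ p.2 ∈ Mon (D ρ (k + 1) A) (D ρ (k + 1) B) ∧
      ∀ g ∈ L ρ k A, (p.1.fn g.1, p.2.fn g.2) ∈ L ρ k B := Iff.rfl

theorem D_arr_mon {f : Val Q (.arr A B)} (h : f ∈ D ρ k (.arr A B)) :
    f ∈ Mon (D ρ k A) (D ρ k B) := by
  cases k with
  | zero => exact h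
  | succ k => obtain ⟨f₁, hf⟩ := h; exact hf.2.1

theorem L_left {d e : Val Q A} (h : (d, e) ∈ L ρ k A) : d ∈ D ρ k A := by
  cases A <;> exact h.1

theorem L_right {d e : Val Q A} (h : (d, e) ∈ L ρ k A) : e ∈ D ρ (k + 1) A := by
  cases A with
  | o => exact h.2.1
  | arr A B => exact ⟨d, h⟩

theorem exists_L {e : Val Q A} (h : e ∈ D ρ (k + 1) A) : ∃ d, (d, e) ∈ L ρ k A := by
  cases A with
  | o => exact ⟨((show Set Q from e) ∩ Qle ρ k : Set Q), mem_L_o.2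
      ⟨mem_D_o.2 Set.inter_subset_right, h, fun _ => Iff.rfl⟩⟩
  | arr A B => exact h

theorem D_mono {f : Val Q (.arr A B)} (hf : f ∈ D ρ k (.arr A B)) {x y : Val Q A}
    (hx : x ∈ D ρ k A) (hy : y ∈ D ρ k A) (h : SLe b x y) : SLe b (f.fn x) (f.fn y) := by
  cases b
  · exact (D_arr_mon hf).2.1 y hy x hx h
  · exact (D_arr_mon hf).2.1 x hx y hy h

theorem D_app {f : Val Q (.arr A B)} (hf : f ∈ D ρ k (.arr A B)) {x : Val Q A}
    (hx : x ∈ D ρ k A) : f.fn x ∈ D ρ k B := (D_arr_mon hf).1 x hx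

theorem D_bot {f : Val Q (.arr A B)} (hf : f ∈ D ρ k (.arr A B)) {x : Val Q A}
    (hx : x ∉ D ρ k A) : f.fn x = ⊥ := (D_arr_mon hf).2.2 x hx

variable (ρ) in
/-- The least lift of an element of stratum `k` to the next stratum, and the greatest one for the
sign `false`. -/
noncomputable def lo (b : Bool) (k : ℕ) : (A : SType) → Val Q A → Val Q A
  | .o, d => match b with
    | true => d
    | false => ((show Set Q from d) ∪ {q | ρ q = k + 1} : Set Q)
  | .arr A B, d => lamVal ρ (k + 1) A B fun g => lo b k B (d.fn (down ρ k A g))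

theorem down_eq_of {d e : Val Q A} (h : (d, e) ∈ L ρ k A)
    (huniq : ∀ d', (d', e) ∈ L ρ k A → d' = d) : down ρ k A e = d := by
  have : {d' | (d', e) ∈ L ρ k A} = {d} := by
    ext d'
    exact ⟨huniq d', fun h' => by rw [Set.mem_singleton_iff] at h'; exact h' ▸ h⟩
  rw [down, this, sSup_singleton]

/-- The four facts (existence of extremal lifts, the relation descends the order, monotonicity of
lifts, extremality) need one simultaneous induction. At an arrow type a lift evaluates `down` on its
argument, which is well defined by the second fact there; conversely, two lower functions are
compared by lifting their arguments, by the first fact. -/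
theorem L_and_lo (ρ : Q → ℕ) (k : ℕ) (A : SType) :
    (∀ b, ∀ d ∈ D ρ k A, (d, lo ρ b k A d) ∈ L ρ k A) ∧
    (∀ d e d' e', (d, e) ∈ L ρ k A → (d', e') ∈ L ρ k A → e ≤ e' → d ≤ d') ∧
    (∀ b, ∀ d ∈ D ρ k A, ∀ d' ∈ D ρ k A, d ≤ d' → lo ρ b k A d ≤ lo ρ b k A d') ∧
    (∀ b d e, (d, e) ∈ L ρ k A → SLe b (lo ρ b k A d) e) := by
  induction A with
  | o =>
    refine ⟨fun b d hd => mem_L_o.2 ⟨hd, ?_⟩, ?_, ?_, ?_⟩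
    · have hd' := mem_D_o.1 hd
      cases b
      · refine ⟨mem_D_o.2 ?_, fun q => ⟨fun h => ⟨.inl h, hd' h⟩, ?_⟩⟩
        · rintro q (hq | hq)
          · exact Nat.le_succ_of_le (hd' hq)
          · exact le_of_eq hq
        · rintro ⟨hq | hq, h⟩
          · exact hq
          · have : ρ q = k + 1 := hq
            omega
      · exact ⟨mem_D_o.2 fun q hq => Nat.le_succ_of_le (hd' hq),
          fun q => ⟨fun h => ⟨h, hd' h⟩, fun h => h.1⟩⟩
    · intro d e d' e' h h' hle q hq
      exact ((mem_L_o.1 h').2.2 q).2 ⟨hle (((mem_L_o.1 h).2.2 q).1 hq).1,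
        (((mem_L_o.1 h).2.2 q).1 hq).2⟩
    · intro b d _ d' _ h
      cases b
      · exact Set.union_subset_union_left _ h
      · exact h
    · intro b d e h
      have h := mem_L_o.1 h
      cases b
      · intro q hq
        by_cases hk : ρ q ≤ k
        · exact .inl ((h.2.2 q).2 ⟨hq, hk⟩)
        · have := mem_D_o.1 h.2.1 hq
          simp only [Qle, Set.mem_ofPred_eq] at this
          exact .inr (show ρ q = k + 1 by omega)
      · exact fun q hq => ((h.2.2 q).1 hq).1
  | arr A B ihA ihB =>
    obtain ⟨a1, a2, a3, a4⟩ := ihA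
    obtain ⟨b1, b2, b3, b4⟩ := ihB
    have hdown : ∀ d e, (d, e) ∈ L ρ k A → down ρ k A e = d := fun d e h =>
      down_eq_of h fun d' h' => le_antisymm (a2 _ _ _ _ h' h le_rfl) (a2 _ _ _ _ h h' le_rfl)
    refine ⟨fun b d hd => mem_L_arr.2 ⟨hd, ⟨?_, ?_, ?_⟩, ?_⟩, ?_, ?_, ?_⟩
    · intro g hg
      obtain ⟨g₁, hg₁⟩ := exists_L hg
      show (lamVal ρ (k + 1) A B _).fn g ∈ _
      rw [lamVal_of_mem hg, hdown _ _ hg₁]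
      exact L_right (b1 b _ (D_app hd (L_left hg₁)))
    · intro x hx y hy hxy
      obtain ⟨x₁, hx₁⟩ := exists_L hx
      obtain ⟨y₁, hy₁⟩ := exists_L hy
      show (lamVal ρ (k + 1) A B _).fn x ≤ (lamVal ρ (k + 1) A B _).fn y
      rw [lamVal_of_mem hx, lamVal_of_mem hy, hdown _ _ hx₁, hdown _ _ hy₁]
      exact b3 b _ (D_app hd (L_left hx₁)) _ (D_app hd (L_left hy₁))
        (D_mono (b := true) hd (L_left hx₁) (L_left hy₁) (a2 _ _ _ _ hx₁ hy₁ hxy))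
    · exact fun x hx => lamVal_of_notMem hx
    · rintro ⟨g₁, g₂⟩ hg
      show (_, (lamVal ρ (k + 1) A B _).fn g₂) ∈ _
      rw [lamVal_of_mem (L_right hg), hdown _ _ hg]
      exact b1 b _ (D_app hd (L_left hg))
    · intro d e d' e' h h' hle g
      -- An argument inside the stratum is tested through its lift; outside it both functions are
      -- `⊥`.
      by_cases hg : g ∈ D ρ k A
      · exact b2 _ _ _ _ (h.2.2 _ (a1 true g hg)) (h'.2.2 _ (a1 true g hg)) (hle _)
      · exact le_of_eq ((D_bot h.1 hg).trans (D_bot h'.1 hg).symm)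
    · intro b d hd d' hd' h g
      show (lamVal ρ (k + 1) A B _).fn g ≤ (lamVal ρ (k + 1) A B _).fn g
      by_cases hg : g ∈ D ρ (k + 1) A
      · obtain ⟨g₁, hg₁⟩ := exists_L hg
        rw [lamVal_of_mem hg, lamVal_of_mem hg, hdown _ _ hg₁]
        exact b3 b _ (D_app hd (L_left hg₁)) _ (D_app hd' (L_left hg₁)) (h _)
      · rw [lamVal_of_notMem hg, lamVal_of_notMem hg]
    · intro b d e h
      refine sLe_arr.2 fun g => ?_
      show SLe b ((lamVal ρ (k + 1) A B _).fn g) _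
      by_cases hg : g ∈ D ρ (k + 1) A
      · obtain ⟨g₁, hg₁⟩ := exists_L hg
        rw [lamVal_of_mem hg, hdown _ _ hg₁]
        exact b4 b _ _ (h.2.2 _ hg₁)
      · rw [lamVal_of_notMem hg, h.2.1.2.2 g hg]
        exact SLe.refl b _

theorem lo_mem {d : Val Q A} (b : Bool) (h : d ∈ D ρ k A) : (d, lo ρ b k A d) ∈ L ρ k A :=
  (L_and_lo ρ k A).1 b d h

theorem L_mono {d e d' e' : Val Q A} (h : (d, e) ∈ L ρ k A) (h' : (d', e') ∈ L ρ k A)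
    (hle : SLe b e e') : SLe b d d' := by
  cases b
  · exact (L_and_lo ρ k A).2.1 _ _ _ _ h' h hle
  · exact (L_and_lo ρ k A).2.1 _ _ _ _ h h' hle

theorem L_unique {d d' e : Val Q A} (h : (d, e) ∈ L ρ k A) (h' : (d', e) ∈ L ρ k A) : d = d' :=
  (L_mono h h' (SLe.refl true e)).antisymm (L_mono h' h (SLe.refl true e))

theorem lo_sLe {d e : Val Q A} (h : (d, e) ∈ L ρ k A) : SLe b (lo ρ b k A d) e :=
  (L_and_lo ρ k A).2.2.2 b d e h

theorem lo_mono {d d' : Val Q A} (c : Bool) (hd : d ∈ D ρ k A) (hd' : d' ∈ D ρ k A)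
    (h : d ≤ d') : lo ρ c k A d ≤ lo ρ c k A d' :=
  (L_and_lo ρ k A).2.2.1 c d hd d' hd' h

theorem down_eq {d e : Val Q A} (h : (d, e) ∈ L ρ k A) : down ρ k A e = d :=
  down_eq_of h fun _ h' => L_unique h' h

theorem upInf_eq {d : Val Q A} (h : d ∈ D ρ k A) : upInf ρ k A d = lo ρ true k A d :=
  IsLeast.csInf_eq ⟨lo_mem true h, fun _ he => lo_sLe (b := true) he⟩

theorem upSup_eq {d : Val Q A} (h : d ∈ D ρ k A) : upSup ρ k A d = lo ρ false k A d :=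
  IsGreatest.csSup_eq ⟨lo_mem false h, fun _ he => lo_sLe (b := false) he⟩

/-- Extremal lifts commute with application. Properties of starting points thereby reduce to the
base type. -/
theorem lo_app {d : Val Q (.arr A B)} {g₁ g₂ : Val Q A} (hg : (g₁, g₂) ∈ L ρ k A) :
    (lo ρ b k (.arr A B) d).fn g₂ = lo ρ b k B (d.fn g₁) := by
  show (lamVal ρ (k + 1) A B _).fn g₂ = _
  rw [lamVal_of_mem (L_right hg), down_eq hg]

variable (ρ) in
/-- The greatest element of stratum `0`. -/
noncomputable def topVal : (A : SType) → Val Q A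
  | .o => Qle ρ 0
  | .arr A B => lamVal ρ 0 A B fun _ => topVal B

theorem isGreatest_topVal (ρ : Q → ℕ) (A : SType) : IsGreatest (D ρ 0 A) (topVal ρ A) := by
  induction A with
  | o => exact ⟨mem_D_o.2 subset_rfl, fun P hP => mem_D_o.1 hP⟩
  | arr A B _ ihB =>
    refine ⟨⟨fun x hx => ?_, fun x hx y hy _ => ?_, fun x hx => lamVal_of_notMem hx⟩,
      fun f hf x => ?_⟩
    · exact (lamVal_of_mem (k := 0) (f := fun _ => topVal ρ B) hx).symm ▸ ihB.1
    · exact le_of_eq ((lamVal_of_mem (k := 0) (f := fun _ => topVal ρ B) hx).trans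
        (lamVal_of_mem (k := 0) (f := fun _ => topVal ρ B) hy).symm)
    · show f.fn x ≤ (lamVal ρ 0 A B fun _ => topVal ρ B).fn x
      by_cases hx : x ∈ D ρ 0 A
      · rw [lamVal_of_mem hx]
        exact ihB.2 (D_app hf hx)
      · rw [D_bot hf hx]
        exact bot_le

theorem topVal_app {g : Val Q A} (hg : g ∈ D ρ 0 A) :
    (topVal ρ (.arr A B)).fn g = topVal ρ B := lamVal_of_mem (k := 0) hg

/-! ### Coherent families -/

variable (ρ) in
/-- A family of elements of all the strata, each related to the next. -/
def Coh {A : SType} (d : ℕ → Val Q A) : Prop := ∀ k, (d k, d (k + 1)) ∈ L ρ k A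

/-- Application of families. -/
def famApp (F : ℕ → Val Q (.arr A B)) (g : ℕ → Val Q A) : ℕ → Val Q B :=
  fun k => (F k).fn (g k)

theorem Coh.mem {d : ℕ → Val Q A} (h : Coh ρ d) (k : ℕ) : d k ∈ D ρ k A := L_left (h k)

theorem Coh.app {F : ℕ → Val Q (.arr A B)} {g : ℕ → Val Q A} (hF : Coh ρ F) (hg : Coh ρ g) :
    Coh ρ (famApp F g) := fun k => (hF k).2.2 _ (hg k)

theorem Coh.sLe_of_le {d d' : ℕ → Val Q A} (h : Coh ρ d) (h' : Coh ρ d') {j : ℕ} (hjk : j ≤ k)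
    (hk : SLe b (d k) (d' k)) : SLe b (d j) (d' j) := by
  induction k, hjk using Nat.le_induction with
  | base => exact hk
  | succ k _ ih => exact ih (L_mono (h k) (h' k) hk)

theorem Coh.eq_of_le {d d' : ℕ → Val Q A} (h : Coh ρ d) (h' : Coh ρ d') {j : ℕ} (hjk : j ≤ k)
    (hk : d k = d' k) : d j = d' j :=
  (h.sLe_of_le h' hjk (SLe.of_eq true hk)).antisymm (h'.sLe_of_le h hjk (SLe.of_eq true hk.symm))

/-- Downwards the partners exist by `exists_L`, upwards one takes least lifts. Statements about one
stratum can thus be tested on coherent families. -/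
theorem exists_coh {d : Val Q A} (hd : d ∈ D ρ k A) : ∃ g : ℕ → Val Q A, Coh ρ g ∧ g k = d := by
  obtain ⟨f, hf, hfd⟩ : ∃ f : ℕ → Val Q A, f k = d ∧ ∀ j < k, (f j, f (j + 1)) ∈ L ρ j A := by
    induction k generalizing d with
    | zero => exact ⟨fun _ => d, rfl, fun j hj => absurd hj (Nat.not_lt_zero j)⟩
    | succ k ih =>
      obtain ⟨d', hd'⟩ := exists_L hd
      obtain ⟨f, hf, hfd⟩ := ih (L_left hd')
      refine ⟨Function.update f (k + 1) d, Function.update_self .., fun j hj => ?_⟩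
      rw [Function.update_of_ne (by omega)]
      rcases Nat.lt_succ_iff_lt_or_eq.1 hj with h | rfl
      · rw [Function.update_of_ne (by omega)]
        exact hfd j h
      · rw [Function.update_self, hf]
        exact hd'
  -- The chain `f` is followed up to stratum `k`, then iterated least lifts.
  let g : ℕ → Val Q A := fun n => Nat.rec (f 0)
    (fun j x => if j + 1 ≤ k then f (j + 1) else lo ρ true j A x) n
  have hg : ∀ j, g (j + 1) = if j + 1 ≤ k then f (j + 1) else lo ρ true j A (g j) := fun _ => rfl
  have hgf : ∀ j ≤ k, g j = f j := by
    intro j hj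
    cases j with
    | zero => rfl
    | succ j => rw [hg, if_pos hj]
  have hgD : ∀ j, k ≤ j → g j ∈ D ρ j A := by
    intro j hj
    induction j, hj using Nat.le_induction with
    | base => rw [hgf k le_rfl, hf]; exact hd
    | succ j hj ih =>
      rw [hg, if_neg (by omega)]
      exact L_right (lo_mem true ih)
  refine ⟨g, fun j => ?_, (hgf k le_rfl).trans hf⟩
  rcases lt_or_ge j k with h | h
  · rw [hgf j h.le, hgf (j + 1) h]
    exact hfd j h
  · rw [hg, if_neg (by omega)]
    exact lo_mem true (hgD j h)

theorem exists_coh_pair {d e : Val Q A} (h : (d, e) ∈ L ρ k A) :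
    ∃ g : ℕ → Val Q A, Coh ρ g ∧ g k = d ∧ g (k + 1) = e := by
  obtain ⟨g, hg, rfl⟩ := exists_coh (L_right h)
  exact ⟨g, hg, L_unique (hg k) h, rfl⟩

/-- Every related pair of arguments occurs in a coherent family, so the logical relation need only
be tested on such families. Membership in a stratum then follows upwards, since above stratum `0` it
means having a partner one stratum below. -/
theorem Coh.arr {F : ℕ → Val Q (.arr A B)} (h₁ : ∀ g, Coh ρ g → Coh ρ (famApp F g))
    (h₂ : ∀ k, ∀ x ∈ D ρ k A, ∀ y ∈ D ρ k A, x ≤ y → (F k).fn x ≤ (F k).fn y)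
    (h₃ : ∀ k, ∀ x, x ∉ D ρ k A → (F k).fn x = ⊥) : Coh ρ F := by
  have hmon : ∀ k, F k ∈ Mon (D ρ k A) (D ρ k B) := fun k => ⟨fun x hx => by
    obtain ⟨g, hg, rfl⟩ := exists_coh hx
    exact (h₁ g hg).mem k, h₂ k, h₃ k⟩
  have hL : ∀ k, F k ∈ D ρ k (.arr A B) → (F k, F (k + 1)) ∈ L ρ k (.arr A B) := fun k hk =>
    mem_L_arr.2 ⟨hk, hmon _, fun p hp => by
      obtain ⟨g, hg, h, h'⟩ := exists_coh_pair (d := p.1) (e := p.2) hp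
      have := h₁ g hg k
      simpa only [famApp, h, h'] using this⟩
  have hD : ∀ k, F k ∈ D ρ k (.arr A B) := by
    intro k
    induction k with
    | zero => exact hmon 0
    | succ k ih => exact ⟨_, hL k ih⟩
  exact fun k => hL k (hD k)

/-- Related sets agree on the ranks of the lower stratum. A coherent family at base type is
therefore a single set of states, each read at its own rank. -/
theorem Coh.mem_iff {P : ℕ → Val Q .o} (h : Coh ρ P) {q : Q} (hq : ρ q ≤ k) :
    q ∈ (show Set Q from P k) ↔ q ∈ (show Set Q from P (ρ q)) := by
  induction k, hq using Nat.le_induction with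
  | base => exact Iff.rfl
  | succ k hk ih =>
    rw [← ih]
    exact ⟨fun hq => ((mem_L_o.1 (h k)).2.2 q).2 ⟨hq, hk⟩,
      fun hq => (((mem_L_o.1 (h k)).2.2 q).1 hq).1⟩

theorem Coh.sMem_iff {P : ℕ → Val Q .o} (h : Coh ρ P) {q : Q} (hq : ρ q ≤ k) :
    SMem b q (P k) ↔ SMem b q (P (ρ q)) := by
  cases b
  · exact not_congr (h.mem_iff hq)
  · exact h.mem_iff hq

theorem coh_o {P : ℕ → Val Q .o} (h : ∀ k q, q ∈ (show Set Q from P k) →  ρ q ≤ k)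
    (h' : ∀ k q, ρ q ≤ k → (q ∈ (show Set Q from P k) ↔ q ∈ (show Set Q from P (k + 1)))) :
    Coh ρ P := fun k =>
  mem_L_o.2 ⟨mem_D_o.2 fun q hq => h k q hq, mem_D_o.2 fun q hq => h _ q hq,
    fun q => ⟨fun hq => ⟨(h' k q (h k q hq)).1 hq, h k q hq⟩, fun hq => (h' k q hq.2).2 hq.1⟩⟩

/-! ### Fixpoints -/

/-- The sign of the order in which the fixpoints of stratum `k` are least. -/
def sgn (k : ℕ) : Bool := decide (Odd k)

variable (ρ) in
/-- The element of stratum `k` from which the iteration towards the fixpoint starts, given the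
fixpoints of the lower strata. -/
noncomputable def start {A : SType} (φ : ℕ → Val Q A) : ℕ → Val Q A
  | 0 => topVal ρ A
  | k + 1 => lo ρ (sgn (k + 1)) k A (φ k)

theorem start_app {F : ℕ → Val Q (.arr A B)} {g : ℕ → Val Q A} (hg : Coh ρ g) (k : ℕ) :
    (start ρ F k).fn (g k) = start ρ (famApp F g) k := by
  cases k with
  | zero => exact topVal_app (hg.mem 0)
  | succ k => exact lo_app (hg k)

/-- On odd strata the least lift adds no state of rank `k`; on even ones the greatest lift adds all
of them, and stratum `0` starts from the top. Read with the sign `sgn k`, no state of rank `k` is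
present before the iteration begins. -/
theorem not_sMem_start {P : ℕ → Val Q .o} (hP : Coh ρ P) {q : Q} :
    ¬ SMem (sgn (ρ q)) q (start ρ P (ρ q)) := by
  rcases hk : ρ q with _ | k
  · exact fun h => h (show ρ q ≤ 0 from hk.le)
  · show ¬ SMem (sgn (k + 1)) q (lo ρ (sgn (k + 1)) k .o (P k))
    cases sgn (k + 1)
    · exact fun h => h (.inr hk)
    · intro h
      have : ρ q ≤ k := mem_D_o.1 (hP.mem k) h
      omega

theorem start_mem {φ : ℕ → Val Q A} (h : Coh ρ φ) (k : ℕ) : start ρ φ k ∈ D ρ k A := by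
  cases k with
  | zero => exact (isGreatest_topVal ρ A).1
  | succ k => exact L_right (lo_mem _ (h.mem k))

theorem iterate_mem {f : Val Q (.arr A A)} (hf : f ∈ D ρ k (.arr A A)) {x : Val Q A}
    (hx : x ∈ D ρ k A) (n : ℕ) : f.fn^[n] x ∈ D ρ k A := by
  induction n with
  | zero => exact hx
  | succ n ih => rw [Function.iterate_succ_apply']; exact D_app hf ih

theorem iterate_sLe {f : Val Q (.arr A A)} (hf : f ∈ D ρ k (.arr A A)) {x : Val Q A}
    (hx : x ∈ D ρ k A) (h : SLe b x (f.fn x)) (n : ℕ) :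
    SLe b (f.fn^[n] x) (f.fn^[n + 1] x) := by
  induction n with
  | zero => exact h
  | succ n ih =>
    rw [Function.iterate_succ_apply', Function.iterate_succ_apply' _ (n + 1)]
    exact D_mono hf (iterate_mem hf hx n) (iterate_mem hf hx (n + 1)) ih

variable (ρ) in
/-- The family of the fixpoints of a family of functions. -/
noncomputable def fixFam (F : ℕ → Val Q (.arr A A)) : ℕ → Val Q A := fun k => fixOp ρ k A (F k)

theorem fixOp_succ_eq {F : ℕ → Val Q (.arr A A)} (hF : Coh ρ F) {k : ℕ}
    (hk : fixFam ρ F k ∈ D ρ k A) :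
    fixFam ρ F (k + 1) =
      if Odd (k + 1) then ⨆ n : ℕ, (F (k + 1)).fn^[n] (start ρ (fixFam ρ F) (k + 1))
      else ⨅ n : ℕ, (F (k + 1)).fn^[n] (start ρ (fixFam ρ F) (k + 1)) := by
  rw [fixFam, fixOp, down_eq (hF k)]
  have h : fixOp ρ k A (F k) ∈ D ρ k A := hk
  rw [upInf_eq h, upSup_eq h]
  by_cases ho : Odd (k + 1)
  · rw [if_pos ho, if_pos ho]
    have : sgn (k + 1) = true := decide_eq_true ho
    rw [start, this]
    rfl
  · rw [if_neg ho, if_neg ho]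
    have : sgn (k + 1) = false := decide_eq_false ho
    rw [start, this]
    rfl

variable [Finite Q]

theorem exists_iSup_eq {f : ℕ → Val Q A} (hf : Monotone f) :
    ∃ n, ⨆ i, f i = f n ∧ f n = f (n + 1) := by
  obtain ⟨n, hn⟩ := WellFoundedGT.monotone_chain_condition (α := Val Q A) ⟨f, hf⟩
  refine ⟨n, le_antisymm (iSup_le fun i => ?_) (le_iSup f n), hn (n + 1) n.le_succ⟩
  rcases le_total i n with h | h
  · exact hf h
  · exact (hn i h).ge

theorem exists_iInf_eq {f : ℕ → Val Q A} (hf : Antitone f) :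
    ∃ n, ⨅ i, f i = f n ∧ f n = f (n + 1) := by
  obtain ⟨n, hn⟩ := WellFoundedLT.antitone_chain_condition (α := Val Q A) hf
  refine ⟨n, le_antisymm (iInf_le f n) (le_iInf fun i => ?_), hn (n + 1) n.le_succ⟩
  rcases le_total i n with h | h
  · exact hf h
  · exact (hn i h).le

/-- Induction on the stratum. The starting point is a lift of the lower fixpoint, which the lower
function fixes, so all iterates are lifts of it. The iteration is monotone in the direction of the
sign and becomes stationary by finiteness: the supremum or infimum is a finite iterate, is fixed,
and is related to the lower fixpoint. -/
theorem fixFam_aux {F : ℕ → Val Q (.arr A A)} (hF : Coh ρ F) (k : ℕ) :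
    (fixFam ρ F k ∈ D ρ k A ∧ (F k).fn (fixFam ρ F k) = fixFam ρ F k ∧
      ∃ n, fixFam ρ F k = (F k).fn^[n] (start ρ (fixFam ρ F) k)) ∧
      ∀ j, k = j + 1 → (fixFam ρ F j, fixFam ρ F k) ∈ L ρ j A := by
  induction k with
  | zero =>
    have h0 : fixFam ρ F 0 = ⨅ n : ℕ, (F 0).fn^[n] (topVal ρ A) := by
      rw [fixFam, fixOp, (isGreatest_topVal ρ A).isLUB.sSup_eq]
    have hm := (isGreatest_topVal ρ A).1
    obtain ⟨n, hn, hn'⟩ := exists_iInf_eq (antitone_nat_of_succ_le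
      (f := fun n => (F 0).fn^[n] (topVal ρ A))
      (iterate_sLe (b := false) (hF.mem 0) hm ((isGreatest_topVal ρ A).2 (D_app (hF.mem 0) hm))))
    rw [hn] at h0
    refine ⟨⟨h0 ▸ iterate_mem (hF.mem 0) hm n, ?_, n, h0⟩, fun j hj => by omega⟩
    rw [h0, ← Function.iterate_succ_apply' (F 0).fn]
    exact hn'.symm
  | succ k ih =>
    obtain ⟨⟨hD, hfix, -⟩, -⟩ := ih
    have hst : (fixFam ρ F k, start ρ (fixFam ρ F) (k + 1)) ∈ L ρ k A := lo_mem _ hD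
    have hit : ∀ n,
        (fixFam ρ F k, (F (k + 1)).fn^[n] (start ρ (fixFam ρ F) (k + 1))) ∈ L ρ k A := by
      intro n
      induction n with
      | zero => exact hst
      | succ n ih =>
        rw [Function.iterate_succ_apply']
        have := (hF k).2.2 _ ih
        rwa [show ((F k, F (k + 1)).1.fn (fixFam ρ F k)) = fixFam ρ F k from hfix] at this
    -- The first iterate lifts the same element as the starting point, which is the extremal such
    -- lift.
    have hle : SLe (sgn (k + 1)) (start ρ (fixFam ρ F) (k + 1))
        ((F (k + 1)).fn (start ρ (fixFam ρ F) (k + 1))) := lo_sLe (hit 1)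
    obtain ⟨n, hn, hn'⟩ : ∃ n,
        fixFam ρ F (k + 1) = (F (k + 1)).fn^[n] (start ρ (fixFam ρ F) (k + 1)) ∧
        (F (k + 1)).fn^[n] (start ρ (fixFam ρ F) (k + 1)) =
          (F (k + 1)).fn^[n + 1] (start ρ (fixFam ρ F) (k + 1)) := by
      rw [fixOp_succ_eq hF hD]
      have hmono := iterate_sLe (hF.mem (k + 1)) (L_right hst) hle
      split_ifs with ho
      · rw [show sgn (k + 1) = true from decide_eq_true ho] at hmono
        exact exists_iSup_eq (monotone_nat_of_le_succ hmono)
      · rw [show sgn (k + 1) = false from decide_eq_false ho] at hmono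
        exact exists_iInf_eq (antitone_nat_of_succ_le hmono)
    have hL : (fixFam ρ F k, fixFam ρ F (k + 1)) ∈ L ρ k A := hn ▸ hit n
    refine ⟨⟨L_right hL, ?_, n, hn⟩, fun j hj => ?_⟩
    · rw [hn, ← Function.iterate_succ_apply' (F (k + 1)).fn]
      exact hn'.symm
    · cases hj
      exact hL

theorem coh_fixFam {F : ℕ → Val Q (.arr A A)} (hF : Coh ρ F) : Coh ρ (fixFam ρ F) :=
  fun k => (fixFam_aux hF (k + 1)).2 k rfl

theorem famApp_fixFam {F : ℕ → Val Q (.arr A A)} (hF : Coh ρ F) :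
    famApp F (fixFam ρ F) = fixFam ρ F := funext fun k => (fixFam_aux hF k).1.2.1

/-- The fixpoint of stratum `k` is a finite iterate of its starting point, and all iterates agree
with the fixpoints of the lower strata. By `hp` the property depends on stratum `k` alone, so how
the iterates are completed to coherent families is immaterial. -/
theorem fixFam_induction {F : ℕ → Val Q (.arr A A)} (hF : Coh ρ F) (k : ℕ)
    {p : (ℕ → Val Q A) → Prop} (hp : ∀ d d', Coh ρ d → Coh ρ d' → d k = d' k → p d → p d')
    (h0 : ∀ e, Coh ρ e → (∀ j < k, e j = fixFam ρ F j) → e k = start ρ e k → p e)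
    (hs : ∀ e, Coh ρ e → (∀ j < k, e j = fixFam ρ F j) → p e → p (famApp F e)) :
    p (fixFam ρ F) := by
  have hφ := coh_fixFam hF
  obtain ⟨n, hn⟩ := (fixFam_aux hF k).1.2.2
  suffices h : ∀ n, ∃ e, Coh ρ e ∧ (∀ j < k, e j = fixFam ρ F j) ∧
      e k = (F k).fn^[n] (start ρ (fixFam ρ F) k) ∧ p e by
    obtain ⟨e, he, -, hek, hpe⟩ := h n
    exact hp e _ he hφ (hek.trans hn.symm) hpe
  intro n
  induction n with
  | zero =>
    obtain ⟨e, he, hek⟩ := exists_coh (start_mem hφ k)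
    have hlow : ∀ j < k, e j = fixFam ρ F j := by
      intro j hj
      cases k with
      | zero => omega
      | succ k =>
        refine he.eq_of_le hφ (Nat.lt_succ_iff.1 hj) (L_unique (he k) ?_)
        rw [hek]
        exact lo_mem _ (hφ.mem k)
    refine ⟨e, he, hlow, hek, h0 e he hlow ?_⟩
    rw [hek]
    cases k with
    | zero => rfl
    | succ k => rw [start, start, hlow k k.lt_succ_self]
  | succ n ih =>
    obtain ⟨e, he, hlow, hek, hpe⟩ := ih
    refine ⟨famApp F e, hF.app he, fun j hj => ?_, ?_, hs e he hlow hpe⟩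
    · rw [famApp, hlow j hj]
      exact congrFun (famApp_fixFam hF) j
    · rw [famApp, hek, Function.iterate_succ_apply']

/-- Whether the stratum iterates upwards or downwards, the starting points compare by the case of
the lower stratum, and then so do all iterates, term by term. -/
theorem fixOp_mono {f g : Val Q (.arr A A)} (hf : f ∈ D ρ k (.arr A A))
    (hg : g ∈ D ρ k (.arr A A)) (h : f ≤ g) : fixOp ρ k A f ≤ fixOp ρ k A g := by
  have key : ∀ x ∈ D ρ k A, ∀ y ∈ D ρ k A, x ≤ y → ∀ n, f.fn^[n] x ≤ g.fn^[n] y := by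
    intro x hx y hy hxy n
    induction n with
    | zero => exact hxy
    | succ n ih =>
      rw [Function.iterate_succ_apply', Function.iterate_succ_apply']
      exact le_trans (h _) (D_mono (b := true) hg (iterate_mem hf hx n) (iterate_mem hg hy n) ih)
  obtain ⟨F, hF, rfl⟩ := exists_coh hf
  obtain ⟨G, hG, rfl⟩ := exists_coh hg
  induction k with
  | zero =>
    rw [fixOp, fixOp, (isGreatest_topVal ρ A).isLUB.sSup_eq]
    exact iInf_mono (key _ (isGreatest_topVal ρ A).1 _ (isGreatest_topVal ρ A).1 le_rfl)
  | succ k ih =>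
    have hle : fixFam ρ F k ≤ fixFam ρ G k := by
      have hFG : F k ≤ G k := hF.sLe_of_le hG (b := true) k.le_succ h
      refine ih (hF.mem k) (hG.mem k) hFG fun x hx y hy hxy n => ?_
      induction n with
      | zero => exact hxy
      | succ n ih =>
        rw [Function.iterate_succ_apply', Function.iterate_succ_apply']
        exact le_trans (hFG _)
          (D_mono (b := true) (hG.mem k) (iterate_mem (hF.mem k) hx n)
            (iterate_mem (hG.mem k) hy n) ih)
    have hFm := (coh_fixFam hF).mem k
    have hGm := (coh_fixFam hG).mem k
    have hs : start ρ (fixFam ρ F) (k + 1) ≤ start ρ (fixFam ρ G) (k + 1) :=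
      lo_mono _ hFm hGm hle
    have key := key _ (start_mem (coh_fixFam hF) _) _ (start_mem (coh_fixFam hG) _) hs
    have h₁ := fixOp_succ_eq hF hFm
    have h₂ := fixOp_succ_eq hG hGm
    rw [fixFam] at h₁ h₂
    rw [h₁, h₂]
    split_ifs
    · exact iSup_mono key
    · exact iInf_mono key

end Model

/-! ### Semantics of terms -/

section SemanticsLemmas

variable {Q : Type u} {C : Type v} {ar : C → ℕ} (𝒜 : WeakAutomaton Q ar)

/-- All the values of the assignment lie in stratum `k`. -/
def AssignMem (ρ : Q → ℕ) (k : ℕ) {Γ : List SType} (ν : Assign Q Γ) : Prop :=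
  ∀ A x, ν A x ∈ D ρ k A

/-- A coherent family of assignments. -/
def AssignCoh (ρ : Q → ℕ) {Γ : List SType} (ν : ℕ → Assign Q Γ) : Prop :=
  ∀ A x, Coh ρ fun k => ν k A x

/-- The family of the values of a term. -/
noncomputable def semFam {Γ : List SType} {A : SType} (M : Tm ar Γ A) (ν : ℕ → Assign Q Γ) :
    ℕ → Val Q A := fun k => sem 𝒜 k M (ν k)

/-- Extension of a family of assignments. -/
def consFam {Γ : List SType} {B : SType} (d : ℕ → Val Q B) (ν : ℕ → Assign Q Γ) :
    ℕ → Assign Q (B :: Γ) := fun k => Assign.cons (d k) (ν k)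

variable {𝒜} {ρ : Q → ℕ} {k : ℕ}

theorem AssignMem.cons {Γ : List SType} {B : SType} {d : Val Q B} {ν : Assign Q Γ}
    (hd : d ∈ D ρ k B) (h : AssignMem ρ k ν) : AssignMem ρ k (Assign.cons d ν) := by
  intro A x
  cases x with
  | zero => exact hd
  | succ x => exact h _ x

theorem AssignCoh.cons {Γ : List SType} {B : SType} {d : ℕ → Val Q B} {ν : ℕ → Assign Q Γ}
    (hd : Coh ρ d) (h : AssignCoh ρ ν) : AssignCoh ρ (consFam d ν) := by
  intro A x
  cases x with
  | zero => exact hd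
  | succ x => exact h _ x

theorem AssignCoh.mem {Γ : List SType} {ν : ℕ → Assign Q Γ} (h : AssignCoh ρ ν) (k : ℕ) :
    AssignMem ρ k (ν k) := fun A x => (h A x).mem k

theorem exists_assignCoh {Γ : List SType} {ν : Assign Q Γ} (h : AssignMem ρ k ν) :
    ∃ ν' : ℕ → Assign Q Γ, AssignCoh ρ ν' ∧ ν' k = ν := by
  choose g hg hg' using fun A x => exists_coh (h A x)
  exact ⟨fun j A x => g A x j, hg, funext fun A => funext fun x => hg' A x⟩

theorem lamVal_mono {A B : SType} {f g : Val Q A → Val Q B} (h : ∀ x ∈ D ρ k A, f x ≤ g x) :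
    lamVal ρ k A B f ≤ lamVal ρ k A B g := by
  intro x
  show (lamVal ρ k A B f).fn x ≤ (lamVal ρ k A B g).fn x
  by_cases hx : x ∈ D ρ k A
  · rw [lamVal_of_mem hx, lamVal_of_mem hx]
    exact h x hx
  · rw [lamVal_of_notMem hx, lamVal_of_notMem hx]

theorem lamVal_congr {A B : SType} {f g : Val Q A → Val Q B} (h : ∀ x ∈ D ρ k A, f x = g x) :
    lamVal ρ k A B f = lamVal ρ k A B g :=
  le_antisymm (α := Val Q (.arr A B)) (lamVal_mono fun x hx => (h x hx).le)
    (lamVal_mono fun x hx => (h x hx).ge)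

theorem coh_lamVal {A B : SType} {f : ℕ → Val Q A → Val Q B}
    (h₁ : ∀ g, Coh ρ g → Coh ρ fun k => f k (g k))
    (h₂ : ∀ k, ∀ x ∈ D ρ k A, ∀ y ∈ D ρ k A, x ≤ y → f k x ≤ f k y) :
    Coh ρ fun k => lamVal ρ k A B (f k) := by
  refine Coh.arr (fun g hg => ?_) (fun k x hx y hy hxy => ?_) fun k x hx => lamVal_of_notMem hx
  · have : famApp (fun k => lamVal ρ k A B (f k)) g = fun k => f k (g k) :=
      funext fun k => lamVal_of_mem (hg.mem k)
    rw [this]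
    exact h₁ g hg
  · rw [lamVal_of_mem hx, lamVal_of_mem hy]
    exact h₂ k x hx y hy hxy

theorem curry_mono : ∀ (n : ℕ) {g g' : (Fin n → Set Q) → Set Q}, (∀ P, g P ⊆ g' P) →
    curry ρ k n g ≤ curry ρ k n g'
  | 0, _, _, h => h _
  | n + 1, _, _, h => lamVal_mono fun _ _ => curry_mono n fun _ => h _

theorem coh_curry : ∀ (n : ℕ) {g : ℕ → (Fin n → Set Q) → Set Q},
    (∀ P : Fin n → ℕ → Set Q, (∀ j, Coh (A := .o) ρ (P j)) →
      Coh (A := .o) ρ fun k => g k fun j => P j k) →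
    (∀ k P P', (∀ j, P j ⊆ P' j) → g k P ⊆ g k P') →
    Coh ρ fun k => curry ρ k n (g k)
  | 0, g, h, _ => by
    have e : (fun k => curry ρ k 0 (g k)) = fun k => g k fun j => (j.elim0 : ℕ → Set Q) k :=
      funext fun k => congrArg (g k) (funext fun j => j.elim0)
    rw [e]
    exact h (fun j => j.elim0) fun j => j.elim0
  | n + 1, g, h, h' => by
    let f : ℕ → Val Q .o → Val Q (SType.ord1 n) := fun k P =>
      curry ρ k n fun T => g k (Fin.cons (show Set Q from P) T)
    refine coh_lamVal (f := f) (fun x hx => coh_curry n (fun P hP => ?_) fun k P P' hPP' =>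
      h' _ _ _ fun j => ?_) fun k x _ y _ hxy => curry_mono n fun P => h' _ _ _ fun j => ?_
    · have e : (fun k => g k (Fin.cons (show Set Q from x k) fun j => P j k)) =
          fun k => g k fun j => Fin.cons (α := fun _ => ℕ → Set Q) x P j k :=
        funext fun k => congrArg (g k) (funext fun j => Fin.cases rfl (fun _ => rfl) j)
      exact e ▸ h (Fin.cons x P) fun j => Fin.cases hx hP j
    · exact Fin.cases subset_rfl hPP' j
    · exact Fin.cases hxy (fun _ => subset_rfl) j

theorem constOp_mono (a : C) {P P' : Fin (ar a) → Set Q} (h : ∀ j, P j ⊆ P' j) :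
    constOp 𝒜 k a P ⊆ constOp 𝒜 k a P' := by
  rintro q ⟨hq, T, hT, hTP⟩
  exact ⟨hq, T, hT, fun j => (hTP j).trans (h j)⟩

theorem coh_constOp (a : C) (P : Fin (ar a) → ℕ → Set Q)
    (h : ∀ j, Coh (A := .o) 𝒜.rank (P j)) :
    Coh (A := .o) 𝒜.rank fun k => constOp 𝒜 k a fun j => P j k := by
  refine coh_o (fun k q hq => hq.1) fun k q hq => ?_
  show (_ ∧ _) ↔ (_ ∧ _)
  refine and_congr (by simp [hq, Nat.le_succ_of_le hq]) ?_
  refine exists_congr fun T => and_congr_right fun hT => forall_congr' fun j => ?_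
  refine forall_congr' fun q' => imp_congr_right fun hq' => ?_
  -- Weakness enters here: a transition from a state of rank at most `k` mentions only such states,
  -- on which the arguments do not change with the stratum.
  have hr := (𝒜.weak q a T hT j q' hq').trans hq
  exact ((h j).mem_iff hr).trans ((h j).mem_iff (Nat.le_succ_of_le hr)).symm

theorem coh_omegaVal (ρ : Q → ℕ) (A : SType) : Coh ρ fun k => omegaVal ρ k A := by
  induction A with
  | o =>
    refine coh_o (fun k q hq => hq.1) fun k q hq => ?_
    show (_ ∧ _) ↔ (_ ∧ _)
    simp [hq, Nat.le_succ_of_le hq]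
  | arr A B _ ihB => exact coh_lamVal (fun _ _ => ihB) fun _ _ _ _ _ _ => le_rfl

variable [Finite Q]

/-- Coherence and monotonicity depend on each other: an abstraction lies in the model only if its
body is monotone, while monotonicity of applications and fixpoints uses that the values lie in the
model. -/
theorem coh_semFam_and_mono {Γ : List SType} {A : SType} (M : Tm ar Γ A) :
    (∀ ν : ℕ → Assign Q Γ, AssignCoh 𝒜.rank ν → Coh 𝒜.rank (semFam 𝒜 M ν)) ∧
    ∀ k (ν ν' : Assign Q Γ), AssignMem 𝒜.rank k ν → AssignMem 𝒜.rank k ν' →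
      (∀ A x, ν A x ≤ ν' A x) → sem 𝒜 k M ν ≤ sem 𝒜 k M ν' := by
  have mem {Γ : List SType} {A : SType} {M : Tm ar Γ A} (h : ∀ ν : ℕ → Assign Q Γ,
      AssignCoh 𝒜.rank ν → Coh 𝒜.rank (semFam 𝒜 M ν)) {k : ℕ} {ν : Assign Q Γ}
      (hν : AssignMem 𝒜.rank k ν) : sem 𝒜 k M ν ∈ D 𝒜.rank k A := by
    obtain ⟨ν', hν', rfl⟩ := exists_assignCoh hν
    exact (h ν' hν').mem k
  have lam {Γ : List SType} {A B : SType} {M : Tm ar (A :: Γ) B}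
      (h : ∀ ν : ℕ → Assign Q (A :: Γ), AssignCoh 𝒜.rank ν → Coh 𝒜.rank (semFam 𝒜 M ν))
      (h' : ∀ k (ν ν' : Assign Q (A :: Γ)), AssignMem 𝒜.rank k ν → AssignMem 𝒜.rank k ν' →
        (∀ A x, ν A x ≤ ν' A x) → sem 𝒜 k M ν ≤ sem 𝒜 k M ν') :
      (∀ ν : ℕ → Assign Q Γ, AssignCoh 𝒜.rank ν → Coh 𝒜.rank (semFam 𝒜 (.lam M) ν)) ∧
      ∀ k (ν ν' : Assign Q Γ), AssignMem 𝒜.rank k ν → AssignMem 𝒜.rank k ν' →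
        (∀ A x, ν A x ≤ ν' A x) → sem 𝒜 k (.lam M) ν ≤ sem 𝒜 k (.lam M) ν' := by
    refine ⟨fun ν hν => coh_lamVal (fun g hg => h _ (AssignCoh.cons hg hν)) ?_,
      fun k ν ν' hν hν' hle => lamVal_mono fun x hx => h' k _ _ (.cons hx hν) (.cons hx hν') ?_⟩
    · intro k x hx y hy hxy
      refine h' k _ _ (.cons hx (hν.mem k)) (.cons hy (hν.mem k)) fun A z => ?_
      cases z with
      | zero => exact hxy
      | succ z => exact le_rfl
    · intro A z
      cases z with
      | zero => exact le_rfl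
      | succ z => exact hle _ z
  induction M with
  | var x => exact ⟨fun ν hν => hν _ x, fun k ν ν' _ _ h => h _ x⟩
  | const a => exact ⟨fun ν _ => coh_curry _ (coh_constOp a) fun k P P' => constOp_mono a,
      fun _ _ _ _ _ _ => le_rfl⟩
  | omega A => exact ⟨fun ν _ => coh_omegaVal _ A, fun _ _ _ _ _ _ => le_rfl⟩
  | app M N ihM ihN =>
    refine ⟨fun ν hν => (ihM.1 ν hν).app (ihN.1 ν hν), fun k ν ν' hν hν' h => ?_⟩
    exact le_trans (ihM.2 k ν ν' hν hν' h _)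
      (D_mono (b := true) (mem ihM.1 hν') (mem ihN.1 hν) (mem ihN.1 hν') (ihN.2 k ν ν' hν hν' h))
  | lam M ih => exact lam ih.1 ih.2
  | fix M ih =>
    obtain ⟨h₁, h₂⟩ := lam ih.1 ih.2
    exact ⟨fun ν hν => coh_fixFam (h₁ ν hν),
      fun k ν ν' hν hν' h => fixOp_mono (mem h₁ hν) (mem h₁ hν') (h₂ k ν ν' hν hν' h)⟩

theorem coh_semFam {Γ : List SType} {A : SType} (M : Tm ar Γ A) {ν : ℕ → Assign Q Γ}
    (hν : AssignCoh 𝒜.rank ν) : Coh 𝒜.rank (semFam 𝒜 M ν) :=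
  (coh_semFam_and_mono M).1 ν hν

theorem sem_mem {Γ : List SType} {A : SType} (M : Tm ar Γ A) {ν : Assign Q Γ}
    (hν : AssignMem 𝒜.rank k ν) : sem 𝒜 k M ν ∈ D 𝒜.rank k A := by
  obtain ⟨ν', hν', rfl⟩ := exists_assignCoh hν
  exact (coh_semFam M hν').mem k

theorem sem_mono {b : Bool} {Γ : List SType} {A : SType} (M : Tm ar Γ A) {ν ν' : Assign Q Γ}
    (hν : AssignMem 𝒜.rank k ν) (hν' : AssignMem 𝒜.rank k ν')
    (h : ∀ A x, SLe b (ν A x) (ν' A x)) : SLe b (sem 𝒜 k M ν) (sem 𝒜 k M ν') := by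
  cases b
  · exact (coh_semFam_and_mono M).2 k _ _ hν' hν h
  · exact (coh_semFam_and_mono M).2 k _ _ hν hν' h

omit [Finite Q] in
theorem famApp_semFam_lam {Γ : List SType} {A B : SType} (M : Tm ar (A :: Γ) B)
    (ν : ℕ → Assign Q Γ) {g : ℕ → Val Q A} (hg : Coh 𝒜.rank g) :
    famApp (semFam 𝒜 (.lam M) ν) g = semFam 𝒜 M (consFam g ν) :=
  funext fun k => lamVal_of_mem (hg.mem k)

omit [Finite Q] in
theorem semFam_fix {Γ : List SType} {A : SType} (M : Tm ar (A :: Γ) A) (ν : ℕ → Assign Q Γ) :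
    semFam 𝒜 (.fix M) ν = fixFam 𝒜.rank (semFam 𝒜 (.lam M) ν) := rfl

/-! ### Invariance under reduction -/

omit [Finite Q] in
theorem sem_rename {Γ : List SType} {A : SType} (M : Tm ar Γ A) :
    ∀ {Δ : List SType} (r : ∀ A, Var Γ A → Var Δ A) (ν : Assign Q Δ),
      sem 𝒜 k (M.rename r) ν = sem 𝒜 k M fun A x => ν A (r A x) := by
  have hc {Γ Δ : List SType} {B : SType} (d : Val Q B) (ν : Assign Q Δ)
      (r : ∀ A, Var Γ A → Var Δ A) : (fun A x => Assign.cons d ν A (liftRen r B A x)) =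
        Assign.cons d fun A x => ν A (r A x) := by
    funext A x
    cases x <;> rfl
  induction M with
  | var x => intros; rfl
  | const a => intros; rfl
  | omega A => intros; rfl
  | app M N ihM ihN => intro _ r ν; simp only [Tm.rename, sem, ihM, ihN]
  | lam M ih => intro _ r ν; simp only [Tm.rename, sem, ih, hc]
  | fix M ih => intro _ r ν; simp only [Tm.rename, sem, ih, hc]

omit [Finite Q] in
theorem sem_subst {Γ : List SType} {A : SType} (M : Tm ar Γ A) :
    ∀ {Δ : List SType} (s : ∀ A, Var Γ A → Tm ar Δ A) (ν : Assign Q Δ),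
      sem 𝒜 k (M.subst s) ν = sem 𝒜 k M fun A x => sem 𝒜 k (s A x) ν := by
  have hc {Γ Δ : List SType} {B : SType} (d : Val Q B) (ν : Assign Q Δ)
      (s : ∀ A, Var Γ A → Tm ar Δ A) :
      (fun A x => sem 𝒜 k (liftSub s B A x) (Assign.cons d ν)) =
        Assign.cons d fun A x => sem 𝒜 k (s A x) ν := by
    funext A x
    cases x with
    | zero => rfl
    | succ x => exact sem_rename _ _ _
  induction M with
  | var x => intros; rfl
  | const a => intros; rfl
  | omega A => intros; rfl
  | app M N ihM ihN => intro _ r ν; simp only [Tm.subst, sem, ihM, ihN]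
  | lam M ih => intro _ r ν; simp only [Tm.subst, sem, ih, hc]
  | fix M ih => intro _ r ν; simp only [Tm.subst, sem, ih, hc]

omit [Finite Q] in
theorem sem_inst {Γ : List SType} {A B : SType} (M : Tm ar (B :: Γ) A) (N : Tm ar Γ B)
    (ν : Assign Q Γ) :
    sem 𝒜 k (M.inst N) ν = sem 𝒜 k M (Assign.cons (sem 𝒜 k N ν) ν) := by
  rw [Tm.inst, sem_subst]
  congr 1
  funext A x
  cases x <;> rfl

theorem Step.sem_eq {Γ : List SType} {A : SType} {M N : Tm ar Γ A} (h : Step M N) :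
    ∀ {ν : Assign Q Γ}, AssignMem 𝒜.rank k ν → sem 𝒜 k M ν = sem 𝒜 k N ν := by
  induction h with
  | beta M N =>
    intro ν hν
    rw [sem_inst]
    exact lamVal_of_mem (sem_mem N hν)
  | delta M =>
    intro ν hν
    obtain ⟨ν', hν', rfl⟩ := exists_assignCoh hν
    exact (congrFun (famApp_fixFam (coh_semFam (.lam M) hν')) k).symm
  | appL N _ ih => intro ν hν; simp only [sem, ih hν]
  | appR M _ ih => intro ν hν; simp only [sem, ih hν]
  | lam _ ih => intro ν hν; exact lamVal_congr fun x hx => ih (.cons hx hν)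
  | fix _ ih =>
    intro ν hν
    exact congrArg _ (lamVal_congr fun x hx => ih (AssignMem.cons hx hν))

theorem Red.sem_eq {Γ : List SType} {A : SType} {M N : Tm ar Γ A} (h : Red M N)
    {ν : Assign Q Γ} (hν : AssignMem 𝒜.rank k ν) : sem 𝒜 k M ν = sem 𝒜 k N ν := by
  induction h with
  | refl => rfl
  | tail _ h ih => exact ih.trans (h.sem_eq hν)

theorem sem_apps {Γ : List SType} {ν : Assign Q Γ} (hν : AssignMem 𝒜.rank k ν) :
    ∀ (n : ℕ) (M : Tm ar Γ (SType.ord1 n)) (N : Fin n → Tm ar Γ .o)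
      (g : (Fin n → Set Q) → Set Q), sem 𝒜 k M ν = curry 𝒜.rank k n g →
      sem 𝒜 k (apps n M N) ν = g fun j => sem 𝒜 k (N j) ν
  | 0, M, N, g, h => by
    refine h.trans ?_
    show g _ = g _
    congr 1
    funext j
    exact j.elim0
  | n + 1, M, N, g, h => by
    refine (sem_apps hν n (.app M (N 0)) (Fin.tail N)
      (fun T => g (Fin.cons (sem 𝒜 k (N 0) ν) T)) ?_).trans ?_
    · show (sem 𝒜 k M ν).fn _ = _
      rw [h]
      exact lamVal_of_mem (sem_mem (N 0) hν)
    · show g _ = g _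
      congr 1
      funext j
      refine Fin.cases rfl (fun _ => rfl) j

theorem sem_const_apps {Γ : List SType} {ν : Assign Q Γ} (hν : AssignMem 𝒜.rank k ν) (a : C)
    (N : Fin (ar a) → Tm ar Γ .o) :
    sem 𝒜 k (apps (ar a) (.const a) N) ν = constOp 𝒜 k a fun j => sem 𝒜 k (N j) ν :=
  sem_apps hν _ _ _ _ rfl

omit [Finite Q] in
theorem assignMem_nil (ν : Assign Q []) : AssignMem ρ k ν := fun _ x => nomatch x

theorem Red.semClosed_eq {A : SType} {M N : Tm ar [] A} (h : Red M N) (k : ℕ) :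
    semClosed 𝒜 k M = semClosed 𝒜 k N := h.sem_eq (assignMem_nil _)

theorem HasHnf.semClosed_eq {M : Tm ar [] .o} {a : C} {N : Fin (ar a) → Tm ar [] .o}
    (h : HasHnf M ⟨a, N⟩) (k : ℕ) :
    semClosed 𝒜 k M = constOp 𝒜 k a fun j => semClosed 𝒜 k (N j) :=
  (Red.semClosed_eq h k).trans (sem_const_apps (assignMem_nil _) a N)

theorem coh_semClosed {A : SType} (M : Tm ar [] A) : Coh 𝒜.rank fun k => semClosed 𝒜 k M :=
  coh_semFam M (ν := fun _ _ x => nomatch x) fun _ x => nomatch x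

end SemanticsLemmas

/-! ### Attractors in the acceptance game -/

section Attractor

variable {Q : Type u} {C : Type v} {ar : C → ℕ} (𝒜 : WeakAutomaton Q ar)

/-- From the state `q` at a node labelled `a`, Eve (Adam, for the sign `false`) can force the
next position to lie in `X`, or else the other player to be stuck. -/
def Forces (b : Bool) (q : Q) (a : C) (X : Fin (ar a) → Q → Prop) : Prop :=
  match b with
  | true => ∃ T ∈ 𝒜.δ q a, ∀ j, ∀ q' ∈ T j, X j q'
  | false => ∀ T ∈ 𝒜.δ q a, ∃ j, ∃ q' ∈ T j, X j q'

/-- From the state `q` and the root of the Böhm tree of `M`, the player who wants to leave the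
rank `k` can force, within `n` moves, a position of smaller rank that the semantics of that rank
declares to be winning, or else the other player to be stuck. -/
def WinN (k : ℕ) : ℕ → Tm ar [] .o → Q → Prop
  | 0, M, q => 𝒜.rank q < k ∧ SMem (sgn k) q (semClosed 𝒜 (𝒜.rank q) M)
  | n + 1, M, q => (𝒜.rank q < k ∧ SMem (sgn k) q (semClosed 𝒜 (𝒜.rank q) M)) ∨
      ∃ p, HasHnf M p ∧ Forces 𝒜 (sgn k) q p.1 fun j q' => WinN k n (p.2 j) q'

variable {𝒜} {k : ℕ} {b : Bool}

theorem Forces.mono {q : Q} {a : C} {X Y : Fin (ar a) → Q → Prop} (h : Forces 𝒜 b q a X)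
    (hXY : ∀ j q', 𝒜.rank q' ≤ 𝒜.rank q → X j q' → Y j q') : Forces 𝒜 b q a Y := by
  cases b
  · intro T hT
    obtain ⟨j, q', hq', hX⟩ := h T hT
    exact ⟨j, q', hq', hXY j q' (𝒜.weak q a T hT j q' hq') hX⟩
  · obtain ⟨T, hT, h⟩ := h
    exact ⟨T, hT, fun j q' hq' => hXY j q' (𝒜.weak q a T hT j q' hq') (h j q' hq')⟩

/-- The interpretation of a constant is exactly one round of the game, for either player. -/
theorem sMem_constOp {q : Q} (hq : 𝒜.rank q ≤ k) (a : C) (P : Fin (ar a) → Val Q .o) :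
    SMem b q (constOp 𝒜 k a P) ↔ Forces 𝒜 b q a fun j q' => SMem b q' (P j) := by
  cases b
  · show ¬ (_ ∧ _) ↔ ∀ T ∈ 𝒜.δ q a, ∃ j, ∃ q' ∈ T j, ¬ _
    rw [not_and]
    simp only [hq, true_imp_iff, not_exists, not_and, not_forall]
    exact forall₂_congr fun T _ => exists_congr fun j => Set.not_subset
  · exact and_iff_right hq

/-- There are finitely many pairs of a son and a state, so the individual bounds have a maximum. -/
theorem Forces.exists_of_monotone [Finite Q] {q : Q} {a : C} {X : ℕ → Fin (ar a) → Q → Prop}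
    (hX : ∀ j q', Monotone fun n => X n j q') (h : Forces 𝒜 b q a fun j q' => ∃ n, X n j q') :
    ∃ n, Forces 𝒜 b q a (X n) := by
  classical
  have (p : Fin (ar a) × Q) : ∃ n, (∃ m, X m p.1 p.2) → X n p.1 p.2 := by
    by_cases hp : ∃ m, X m p.1 p.2
    · exact ⟨hp.choose, fun _ => hp.choose_spec⟩
    · exact ⟨0, fun h => absurd h hp⟩
  choose f hf using this
  obtain ⟨N, hN⟩ := (Set.finite_range f).bddAbove
  exact ⟨N, h.mono fun j q' _ hX' => hX j q' (hN ⟨(j, q'), rfl⟩) (hf (j, q') hX')⟩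

theorem WinN.of_lt {M : Tm ar [] .o} {q : Q} (hq : 𝒜.rank q < k)
    (h : SMem (sgn k) q (semClosed 𝒜 (𝒜.rank q) M)) (n : ℕ) : WinN 𝒜 k n M q := by
  cases n with
  | zero => exact ⟨hq, h⟩
  | succ n => exact .inl ⟨hq, h⟩

theorem winN_monotone (k : ℕ) (M : Tm ar [] .o) (q : Q) : Monotone fun n => WinN 𝒜 k n M q := by
  refine monotone_nat_of_le_succ fun n => ?_
  induction n generalizing M q with
  | zero => exact fun h => .inl h
  | succ n ih =>
    rintro (h | ⟨p, hp, h⟩)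
    · exact .inl h
    · exact .inr ⟨p, hp, h.mono fun j q' _ => ih _ _⟩

variable [Finite Q]

theorem WinN.of_red {M M' : Tm ar [] .o} (h : Red M M') {n : ℕ} {q : Q}
    (hw : WinN 𝒜 k n M' q) : WinN 𝒜 k n M q := by
  cases n with
  | zero => exact ⟨hw.1, (h.semClosed_eq (𝒜 := 𝒜) _).symm ▸ hw.2⟩
  | succ n =>
    obtain hw | ⟨p, hp, hw⟩ := hw
    · exact .inl ⟨hw.1, (h.semClosed_eq (𝒜 := 𝒜) _).symm ▸ hw.2⟩
    · exact .inr ⟨p, h.trans hp, hw⟩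

theorem WinN.red {n : ℕ} : ∀ {M M' : Tm ar [] .o} (_ : Red M M') {q : Q}
    (_ : WinN 𝒜 k n M q), WinN 𝒜 k n M' q := by
  induction n with
  | zero => exact fun h _ hw => ⟨hw.1, h.semClosed_eq (𝒜 := 𝒜) _ ▸ hw.2⟩
  | succ n ih =>
    rintro M M' h q (hw | ⟨⟨a, N⟩, hp, hw⟩)
    · exact .inl ⟨hw.1, h.semClosed_eq (𝒜 := 𝒜) _ ▸ hw.2⟩
    · obtain ⟨P, hP, hP'⟩ := Red.confluent hp h
      obtain ⟨N', rfl, hN⟩ := red_const_apps hP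
      exact .inr ⟨⟨a, N'⟩, hP', hw.mono fun j q' _ => ih (hN j)⟩

/-- The attractor is defined with an arbitrary head normal form at each step; invariance under
reduction in both directions makes it independent of that choice. -/
theorem WinN.joins {n : ℕ} {M M' : Tm ar [] .o} (h : Joins M M') {q : Q}
    (hw : WinN 𝒜 k n M q) : WinN 𝒜 k n M' q := by
  obtain ⟨P, hP, hP'⟩ := h
  exact (hw.red hP).of_red hP'

theorem WinN.forces {n : ℕ} {M : Tm ar [] .o} {q : Q} (hw : WinN 𝒜 (𝒜.rank q) n M q) {a : C}
    {N : Fin (ar a) → Tm ar [] .o} (hM : HasHnf M ⟨a, N⟩) :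
    ∃ n', n = n' + 1 ∧
      Forces 𝒜 (sgn (𝒜.rank q)) q a fun j q' => WinN 𝒜 (𝒜.rank q) n' (N j) q' := by
  cases n with
  | zero => exact absurd hw.1 (lt_irrefl _)
  | succ n =>
    obtain hw | ⟨⟨a', N'⟩, hp, hw⟩ := hw
    · exact absurd hw.1 (lt_irrefl _)
    · obtain ⟨rfl, h⟩ := HasHnf.unique hp hM
      exact ⟨n, rfl, hw.mono fun j q' _ hj => hj.joins (h j)⟩

omit [Finite Q] in
theorem WinN.hasHnf {n : ℕ} {M : Tm ar [] .o} {q : Q} (hw : WinN 𝒜 (𝒜.rank q) n M q) :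
    ∃ p, HasHnf M p := by
  cases n with
  | zero => exact absurd hw.1 (lt_irrefl _)
  | succ n =>
    obtain hw | ⟨p, hp, -⟩ := hw
    · exact absurd hw.1 (lt_irrefl _)
    · exact ⟨p, hp⟩

theorem HasHnf.sMem_iff {M : Tm ar [] .o} {a : C} {N : Fin (ar a) → Tm ar [] .o}
    (h : HasHnf M ⟨a, N⟩) {q : Q} :
    SMem b q (semClosed 𝒜 (𝒜.rank q) M) ↔
      Forces 𝒜 b q a fun j q' => SMem b q' (semClosed 𝒜 (𝒜.rank q') (N j)) := by
  rw [h.semClosed_eq, sMem_constOp le_rfl]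
  exact ⟨fun h => h.mono fun j q' hq' => ((coh_semClosed (N j)).sMem_iff hq').1,
    fun h => h.mono fun j q' hq' => ((coh_semClosed (N j)).sMem_iff hq').2⟩

/-- The attractor lies within the semantics, by induction backwards from the exit positions;
`exists_winN` is the converse at rank `k`. -/
theorem WinN.sMem {n : ℕ} : ∀ {M : Tm ar [] .o} {q : Q}, WinN 𝒜 k n M q →
    SMem (sgn k) q (semClosed 𝒜 (𝒜.rank q) M) := by
  induction n with
  | zero => exact fun h => h.2
  | succ n ih =>
    rintro M q (h | ⟨⟨a, N⟩, hp, h⟩)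
    · exact h.2
    · exact hp.sMem_iff.2 (h.mono fun j q' _ => ih)

/-! ### The logical relation between values and closed terms -/

variable (𝒜 k) in
/-- On the strata below `k`, the family `d` approximates the value of `M`. -/
def Below {A : SType} (d : ℕ → Val Q A) (M : Tm ar [] A) : Prop :=
  ∀ j < k, SLe (sgn k) (d j) (semClosed 𝒜 j M)

variable (𝒜 k) in
/-- The logical relation: at the base type, the states of rank `k` in the family are in the
attractor. -/
def Rel : (A : SType) → (ℕ → Val Q A) → Tm ar [] A → Prop
  | .o, d, M => Below 𝒜 k d M ∧
      ∀ q, 𝒜.rank q = k → SMem (sgn k) q (d k) → ∃ n, WinN 𝒜 k n M q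
  | .arr A B, d, M => Below 𝒜 k d M ∧
      ∀ g N, Coh 𝒜.rank g → Rel A g N → Rel B (famApp d g) (.app M N)

variable {A B : SType}

omit [Finite Q] in
theorem Rel.below {d : ℕ → Val Q A} {M : Tm ar [] A} (h : Rel 𝒜 k A d M) : Below 𝒜 k d M := by
  cases A <;> exact h.1

theorem Below.app {d : ℕ → Val Q (.arr A B)} {M : Tm ar [] (.arr A B)} {g : ℕ → Val Q A}
    {N : Tm ar [] A} (hd : Below 𝒜 k d M) (hg : Below 𝒜 k g N) (hgc : Coh 𝒜.rank g) :
    Below 𝒜 k (famApp d g) (.app M N) := fun j hj =>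
  (sLe_arr.1 (hd j hj) _).trans
    (D_mono ((coh_semClosed M).mem j) (hgc.mem j) ((coh_semClosed N).mem j) (hg j hj))

theorem Below.of_red {d : ℕ → Val Q A} {M M' : Tm ar [] A} (h : Red M M')
    (hd : Below 𝒜 k d M') : Below 𝒜 k d M := fun j hj =>
  (hd j hj).trans (SLe.of_eq _ (h.semClosed_eq j).symm)

theorem Rel.of_red {d : ℕ → Val Q A} {M M' : Tm ar [] A} (h : Red M M')
    (hd : Rel 𝒜 k A d M') : Rel 𝒜 k A d M := by
  induction A with
  | o =>
    refine ⟨hd.1.of_red h, fun q hq hm => ?_⟩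
    obtain ⟨n, hn⟩ := hd.2 q hq hm
    exact ⟨n, hn.of_red h⟩
  | arr A B _ ihB =>
    exact ⟨hd.1.of_red h, fun g N hg hgN => ihB (Red.app h .refl) (hd.2 g N hg hgN)⟩

omit [Finite Q] in
theorem Rel.congr {d d' : ℕ → Val Q A} (h : ∀ j ≤ k, d j = d' j) {M : Tm ar [] A}
    (hd : Rel 𝒜 k A d M) : Rel 𝒜 k A d' M := by
  have hb : Below 𝒜 k d' M := fun j hj => h j hj.le ▸ hd.below j hj
  induction A with
  | o => exact ⟨hb, fun q hq hm => hd.2 q hq (h k le_rfl ▸ hm)⟩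
  | arr A B _ ihB =>
    refine ⟨hb, fun g N hg hgN => ?_⟩
    have h' : ∀ j ≤ k, famApp d g j = famApp d' g j := fun j hj => by rw [famApp, famApp, h j hj]
    have hr := hd.2 g N hg hgN
    exact ihB h' hr fun j hj => h' j hj.le ▸ hr.below j hj

/-- At base type the condition on the attractor is vacuous by `not_sMem_start`; application
preserves starting points. -/
theorem rel_start {d : ℕ → Val Q A} (hd : Coh 𝒜.rank d) {M : Tm ar [] A}
    (hb : Below 𝒜 k d M) (h : d k = start 𝒜.rank d k) : Rel 𝒜 k A d M := by
  induction A with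
  | o =>
    refine ⟨hb, fun q hq hm => ?_⟩
    subst hq
    exact absurd (h ▸ hm) (not_sMem_start hd)
  | arr A B _ ihB =>
    refine ⟨hb, fun g N hg hgN => ihB (hd.app hg) (hb.app hgN.below hg) ?_⟩
    rw [← start_app hg, famApp, h]

/-- Vacuous at base type as well: `Ω` is a loss for the player who has to leave the rank. -/
theorem rel_omegaVal {M : Tm ar [] A} (hb : Below 𝒜 k (fun j => omegaVal 𝒜.rank j A) M) :
    Rel 𝒜 k A (fun j => omegaVal 𝒜.rank j A) M := by
  induction A with
  | o =>
    refine ⟨hb, fun q hq hm => ?_⟩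
    subst hq
    by_cases h : Odd (𝒜.rank q)
    · rw [show sgn (𝒜.rank q) = true from decide_eq_true h] at hm
      exact absurd hm.2 (Nat.not_even_iff_odd.2 h)
    · rw [show sgn (𝒜.rank q) = false from decide_eq_false h] at hm
      exact absurd ⟨le_rfl, Nat.not_odd_iff_even.1 h⟩ hm
  | arr A B _ ihB =>
    refine ⟨hb, fun g N hg hgN => ?_⟩
    have e : famApp (fun j => omegaVal 𝒜.rank j (.arr A B)) g = fun j => omegaVal 𝒜.rank j B :=
      funext fun j => lamVal_of_mem (hg.mem j)
    have hb' := hb.app hgN.below hg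
    rw [e] at hb' ⊢
    exact ihB hb'

theorem rel_curry : ∀ (n : ℕ) {f : ℕ → (Fin n → Set Q) → Set Q} {M : Tm ar [] (SType.ord1 n)},
    Below 𝒜 k (fun j => curry 𝒜.rank j n (f j)) M →
    (∀ (P : Fin n → ℕ → Set Q) (N : Fin n → Tm ar [] .o), (∀ i, Coh (A := .o) 𝒜.rank (P i)) →
      (∀ i, Rel 𝒜 k .o (P i) (N i)) →
      ∀ q, 𝒜.rank q = k → SMem (sgn k) q (f k fun i => P i k) →
        ∃ m, WinN 𝒜 k m (apps n M N) q) →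
    Rel 𝒜 k (SType.ord1 n) (fun j => curry 𝒜.rank j n (f j)) M
  | 0, f, M, hb, h => ⟨hb, fun q hq hm => h (fun i => i.elim0) (fun i => i.elim0)
      (fun i => i.elim0) (fun i => i.elim0) q hq (by
        have e : (fun i : Fin 0 => (i.elim0 : ℕ → Set Q) k) = Fin.elim0 :=
          funext fun i => i.elim0
        rw [e]
        exact hm)⟩
  | n + 1, f, M, hb, h => by
    refine ⟨hb, fun g N hg hgN => ?_⟩
    have e : famApp (fun j => curry 𝒜.rank j (n + 1) (f j)) g =
        fun j => curry 𝒜.rank j n fun T => f j (Fin.cons (show Set Q from g j) T) :=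
      funext fun j => lamVal_of_mem (hg.mem j)
    have hb' := hb.app hgN.below hg
    show Rel 𝒜 k (SType.ord1 n) _ _
    rw [e] at hb' ⊢
    refine rel_curry n hb' fun P N' hP hPN q hq hm => ?_
    have e' : (Fin.cons (show Set Q from g k) fun i => P i k) =
        fun i => Fin.cons (α := fun _ => ℕ → Set Q) g P i k :=
      funext fun i => Fin.cases rfl (fun _ => rfl) i
    rw [e'] at hm
    exact h (Fin.cons g P) (Fin.cons N N') (fun i => Fin.cases hg hP i)
      (fun i => Fin.cases hgN hPN i) q hq hm

theorem below_subst {Γ : List SType} (M : Tm ar Γ A) {ν : ℕ → Assign Q Γ}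
    (hν : AssignCoh 𝒜.rank ν) {s : ∀ A, Var Γ A → Tm ar [] A}
    (h : ∀ A x, Below 𝒜 k (fun j => ν j A x) (s A x)) :
    Below 𝒜 k (semFam 𝒜 M ν) (M.subst s) := fun j hj => by
  rw [semClosed, sem_subst]
  exact sem_mono M (hν.mem j) (fun A x => (coh_semClosed (s A x)).mem j) fun A x => h A x j hj

/-- Fundamental lemma of the logical relation. A constant contributes one move to the attractor, and
abstraction and recursion use closure under expansion. The lower strata are handled by monotonicity
of the semantics alone, through `Below`. -/
theorem rel_subst {Γ : List SType} (M : Tm ar Γ A) {ν : ℕ → Assign Q Γ}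
    (hν : AssignCoh 𝒜.rank ν) {s : ∀ A, Var Γ A → Tm ar [] A}
    (h : ∀ A x, Rel 𝒜 k A (fun j => ν j A x) (s A x)) :
    Rel 𝒜 k A (semFam 𝒜 M ν) (M.subst s) := by
  have hb {Γ : List SType} {A : SType} (M : Tm ar Γ A) {ν : ℕ → Assign Q Γ}
    (hν : AssignCoh 𝒜.rank ν) {s : ∀ A, Var Γ A → Tm ar [] A}
    (h : ∀ A x, Rel 𝒜 k A (fun j => ν j A x) (s A x)) :
      Below 𝒜 k (semFam 𝒜 M ν) (M.subst s) := below_subst M hν fun A x => (h A x).below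
  have hlam {Γ : List SType} {A B : SType} {M : Tm ar (A :: Γ) B}
      (ih : ∀ {ν : ℕ → Assign Q (A :: Γ)}, AssignCoh 𝒜.rank ν →
        ∀ {s : ∀ A', Var (A :: Γ) A' → Tm ar [] A'},
        (∀ A x, Rel 𝒜 k A (fun j => ν j A x) (s A x)) → Rel 𝒜 k B (semFam 𝒜 M ν) (M.subst s))
      {ν : ℕ → Assign Q Γ} (hν : AssignCoh 𝒜.rank ν) {s : ∀ A, Var Γ A → Tm ar [] A}
      (h : ∀ A x, Rel 𝒜 k A (fun j => ν j A x) (s A x)) :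
      Rel 𝒜 k (.arr A B) (semFam 𝒜 (.lam M) ν) (Tm.lam M |>.subst s) := by
    refine ⟨hb (.lam M) hν h, fun g N hg hgN => ?_⟩
    refine Rel.of_red (.single (.beta _ _)) ?_
    rw [famApp_semFam_lam M ν hg, Tm.inst_subst_lift]
    refine ih (.cons hg hν) fun A x => ?_
    cases x with
    | zero => exact hgN
    | succ x => exact h _ x
  induction M with
  | var x => exact h _ x
  | const a =>
    refine rel_curry (ar a) (f := fun j => constOp 𝒜 j a) (hb (.const a) hν h)
      fun P N hP hPN q hq hm => ?_
    have hm := (sMem_constOp hq.le a fun i => P i k).1 hm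
    obtain ⟨n, hn⟩ := Forces.exists_of_monotone (X := fun n i q' => WinN 𝒜 k n (N i) q')
      (fun i q' => winN_monotone k (N i) q') (hm.mono fun i q' hq' hm' => by
        -- A successor of smaller rank is already an exit, by `Below`; one of rank `k` is in the
        -- attractor of the argument.
        rcases hq'.lt_or_eq with hlt | heq
        · refine ⟨0, .of_lt (hq ▸ hlt) ?_ 0⟩
          exact sLe_o.1 ((hPN i).below _ (hq ▸ hlt)) q' (((hP i).sMem_iff (hq ▸ hq')).1 hm')
        · exact (hPN i).2 q' (heq.trans hq) hm')
    exact ⟨n + 1, .inr ⟨⟨a, N⟩, .refl, hn⟩⟩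
  | omega A => exact rel_omegaVal (hb (.omega A) hν h)
  | app M N ihM ihN => exact (ihM hν h).2 _ _ (coh_semFam N hν) (ihN hν h)
  | lam M ih => exact hlam ih hν h
  | fix M ih =>
    have hF := coh_semFam (.lam M) hν
    have hbf := hb (.fix M) hν h
    rw [semFam_fix]
    -- The term stays fixed while the semantic approximation grows: one more iteration is matched by
    -- unfolding the recursion once.
    refine fixFam_induction hF k (p := fun e => Rel 𝒜 k _ e ((Tm.fix M).subst s))
      (fun d d' hd hd' hdd' => ?_) (fun e he hlow hek => ?_)
      fun e he _ hr => ?_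
    · exact Rel.congr fun j hj => hd.eq_of_le hd' hj hdd'
    · refine rel_start he (fun j hj => ?_) hek
      rw [hlow j hj]
      exact hbf j hj
    · exact Rel.of_red (.single (.delta _)) ((hlam ih hν h).2 e _ he hr)

/-- Adequacy for the player who must leave the rank. For the empty context the hypotheses of the
fundamental lemma are void. -/
theorem exists_winN {M : Tm ar [] .o} {q : Q}
    (h : SMem (sgn (𝒜.rank q)) q (semClosed 𝒜 (𝒜.rank q) M)) :
    ∃ n, WinN 𝒜 (𝒜.rank q) n M q := by
  have := rel_subst (𝒜 := 𝒜) (k := 𝒜.rank q) M (ν := fun _ _ x => nomatch x)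
    (fun _ x => nomatch x) (s := fun _ x => nomatch x) (fun _ x => nomatch x)
  rw [M.subst_closed] at this
  exact this.2 q rfl h

end Attractor

/-! ### Acceptance of Böhm trees -/

section Game

variable {Q : Type u} {C : Type v} {ar : C → ℕ} {𝒜 : WeakAutomaton Q ar} {b : Bool}

open Classical in
/-- The head normal form chosen in the definition of the Böhm tree. -/
noncomputable def hnf (M : Tm ar [] .o) : Option ((a : C) × (Fin (ar a) → Tm ar [] .o)) :=
  if h : ∃ p, HasHnf M p then some h.choose else none

theorem hasHnf_of_hnf {M : Tm ar [] .o} {p} (h : hnf M = some p) : HasHnf M p := by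
  unfold hnf at h
  split_ifs at h with h'
  exact Option.some.inj h ▸ h'.choose_spec

theorem not_hasHnf_of_hnf {M : Tm ar [] .o} (h : hnf M = none) : ¬ ∃ p, HasHnf M p := by
  unfold hnf at h
  split_ifs at h with h'
  exact h'

/-- The term whose Böhm tree is the `j`-th immediate subtree of the Böhm tree of `M`. -/
noncomputable def child (M : Tm ar [] .o) (j : ℕ) : Option (Tm ar [] .o) :=
  (hnf M).bind fun p => if hj : j < ar p.1 then some (p.2 ⟨j, hj⟩) else none

/-- The term whose Böhm tree is the subtree of the Böhm tree of `M` at a node. -/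
noncomputable def termAt : Tm ar [] .o → List ℕ → Option (Tm ar [] .o)
  | M, [] => some M
  | M, j :: w => (child M j).bind fun N => termAt N w

theorem termAt_append (M : Tm ar [] .o) (w : List ℕ) (j : ℕ) :
    termAt M (w ++ [j]) = (termAt M w).bind fun N => child N j := by
  induction w generalizing M with
  | nil => simp [termAt]
  | cons i w ih =>
    simp only [List.cons_append, termAt, ih]
    cases child M i <;> rfl

theorem hnf_of_exists {M : Tm ar [] .o} (h : ∃ p, HasHnf M p) : hnf M = some h.choose := dif_pos h

theorem hnf_of_not_exists {M : Tm ar [] .o} (h : ¬ ∃ p, HasHnf M p) : hnf M = none := dif_neg h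

/-- Separates the term reached at a node from the label read off it, so that plays on the tree can
be followed by terms. -/
theorem BT_eq (M : Tm ar [] .o) (w : List ℕ) :
    BT M w = (termAt M w).map fun N => (hnf N).map Sigma.fst := by
  induction w generalizing M with
  | nil =>
    rw [BT, termAt, Option.map_some]
    split_ifs with h
    · rw [hnf_of_exists h, Option.map_some]
    · rw [hnf_of_not_exists h, Option.map_none]
  | cons j w ih =>
    rw [BT, termAt, child]
    split_ifs with h hj
    · rw [hnf_of_exists h, Option.bind_some, dif_pos hj, Option.bind_some]
      exact ih _
    · rw [hnf_of_exists h, Option.bind_some, dif_neg hj]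
      rfl
    · rw [hnf_of_not_exists h]
      rfl

theorem child_of_hnf {M : Tm ar [] .o} {a : C} {N : Fin (ar a) → Tm ar [] .o}
    (h : hnf M = some ⟨a, N⟩) (j : Fin (ar a)) : child M j = some (N j) := by
  simp [child, h]

theorem exists_hnf_of_BT {M N : Tm ar [] .o} {w : List ℕ} (h : termAt M w = some N) {a : C}
    (h' : BT M w = some (some a)) : ∃ args, hnf N = some ⟨a, args⟩ := by
  rw [BT_eq, h] at h'
  simp only [Option.map_some, Option.some.injEq, Option.map_eq_some_iff] at h'
  obtain ⟨⟨a', args⟩, h', rfl⟩ := h'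
  exact ⟨args, h'⟩

theorem hnf_eq_none_of_BT {M N : Tm ar [] .o} {w : List ℕ} (h : termAt M w = some N)
    (h' : BT M w = some none) : hnf N = none := by
  rw [BT_eq, h] at h'
  simpa using h'

theorem BT_of_hnf {M N : Tm ar [] .o} {w : List ℕ} (h : termAt M w = some N) {p}
    (h' : hnf N = some p) : BT M w = some (some p.1) := by
  rw [BT_eq, h, Option.map_some, h', Option.map_some]

variable (𝒜) in
/-- The number of moves needed to leave the current rank. -/
noncomputable def dist (M : Tm ar [] .o) (q : Q) : ℕ :=
  sInf {n | WinN 𝒜 (𝒜.rank q) n M q}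

variable (𝒜) in
/-- The result of a good move: the semantics is still favourable, and, in the ranks which the
player has to leave, the distance decreases. -/
def GoodMove (b : Bool) (M : Tm ar [] .o) (q : Q) (N : Tm ar [] .o) (q' : Q) : Prop :=
  SMem b q' (semClosed 𝒜 (𝒜.rank q') N) ∧ 𝒜.rank q' ≤ 𝒜.rank q ∧
    (sgn (𝒜.rank q) = b → 𝒜.rank q' = 𝒜.rank q → dist 𝒜 N q' < dist 𝒜 M q)

/-- If the player must leave the current rank, a move along the attractor is made, which shortens
the distance; otherwise any move that preserves the semantics will do. -/
theorem forces_goodMove [Finite Q] {M : Tm ar [] .o} {q : Q} {a : C}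
    {N : Fin (ar a) → Tm ar [] .o} (hM : HasHnf M ⟨a, N⟩)
    (h : SMem b q (semClosed 𝒜 (𝒜.rank q) M)) :
    Forces 𝒜 b q a fun j q' => GoodMove 𝒜 b M q (N j) q' := by
  by_cases hb : sgn (𝒜.rank q) = b
  · subst hb
    -- The set of possible lengths is nonempty by `exists_winN`, so the infimum `dist` is attained
    -- and not a default value.
    obtain ⟨n, hn, hf⟩ := (show WinN 𝒜 (𝒜.rank q) (dist 𝒜 M q) M q from
      Nat.sInf_mem (exists_winN h)).forces hM
    refine hf.mono fun j q' hq' hj => ⟨hj.sMem, hq', fun _ hr => ?_⟩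
    rw [hn, Nat.lt_succ_iff]
    refine Nat.sInf_le ?_
    show WinN 𝒜 (𝒜.rank q') n (N j) q'
    rwa [hr]
  · exact (hM.sMem_iff.1 h).mono fun j q' hq' hj => ⟨hj, hq', fun h => absurd h hb⟩

/-- From rank `k` itself the attractor begins with a move, which is impossible at `Ω`. -/
theorem sgn_ne_of_hnf_eq_none [Finite Q] {M : Tm ar [] .o} {q : Q} (hM : hnf M = none)
    (h : SMem b q (semClosed 𝒜 (𝒜.rank q) M)) : sgn (𝒜.rank q) ≠ b := by
  rintro rfl
  obtain ⟨n, hn⟩ := exists_winN h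
  exact not_hasHnf_of_hnf hM hn.hasHnf

theorem not_forall_decreasing {f : ℕ → ℕ} {N : ℕ} (h : ∀ n ≥ N, f (n + 1) < f n) : False := by
  have : ∀ n, f (N + n) + n ≤ f N := by
    intro n
    induction n with
    | zero => exact le_rfl
    | succ n ih =>
      have := h (N + n) (Nat.le_add_right _ _)
      show f (N + n + 1) + (n + 1) ≤ f N
      omega
  have := this (f N + 1)
  omega

open WeakAutomaton

/-! ### From the semantics to strategies. -/

theorem node_append (h : List (ℕ × Q)) (j : ℕ) (q : Q) :
    node (h ++ [(j, q)]) = node h ++ [j] := by simp [node]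

theorem state_append (q : Q) (h : List (ℕ × Q)) (p : ℕ × Q) : state q (h ++ [p]) = p.2 := by
  simp [state]

theorem Follows.last {t : LTree C} {σ : Strategy Q ar} {h : List (ℕ × Q)} {p : ℕ × Q}
    (hf : Follows t σ (h ++ [p])) : ∃ (a : C) (j : Fin (ar a)) (q' : Q), p = ((j : ℕ), q') ∧
      Follows t σ h ∧ t (node h) = some (some a) ∧ q' ∈ σ h a j := by
  generalize hl : h ++ [p] = l at hf
  cases hf with
  | nil => simp at hl
  | snoc j hf ht hq =>
    obtain ⟨rfl, h₂⟩ := List.append_inj' hl rfl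
    exact ⟨_, j, _, List.singleton_inj.1 h₂, hf, ht, hq⟩

/-- Eve plays good moves, and the semantics stays favourable as an invariant. Ranks never increase,
hence stabilize; at an odd value the distance would decrease forever. -/
theorem accepts_of_mem_sem [Finite Q] {M : Tm ar [] .o} {q : Q}
    (hq : SMem true q (semClosed 𝒜 (𝒜.rank q) M)) : 𝒜.Accepts (BT M) q := by
  classical
  -- The history determines the current term and state. Where the invariant fails the answer is an
  -- arbitrary default, never met on a play that follows the strategy.
  have hT : ∀ (h : List (ℕ × Q)) (a : C), ∃ T : Fin (ar a) → Set Q, ∀ N args,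
      termAt M (node h) = some N → hnf N = some ⟨a, args⟩ →
      SMem true (state q h) (semClosed 𝒜 (𝒜.rank (state q h)) N) →
      T ∈ 𝒜.δ (state q h) a ∧ ∀ j, ∀ q' ∈ T j, GoodMove 𝒜 true N (state q h) (args j) q' := by
    intro h a
    by_cases hN : ∃ N args, termAt M (node h) = some N ∧ hnf N = some ⟨a, args⟩ ∧
        SMem true (state q h) (semClosed 𝒜 (𝒜.rank (state q h)) N)
    · obtain ⟨N, args, h₁, h₂, h₃⟩ := hN
      obtain ⟨T, hT, hg⟩ := forces_goodMove (hasHnf_of_hnf h₂) h₃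
      refine ⟨T, fun N' args' h₁' h₂' _ => ?_⟩
      cases h₁.symm.trans h₁'
      cases h₂.symm.trans h₂'
      exact ⟨hT, hg⟩
    · exact ⟨fun _ => ∅, fun N args h₁ h₂ h₃ => absurd ⟨N, args, h₁, h₂, h₃⟩ hN⟩
  choose σ hσ using hT
  have hinv : ∀ h, Follows (BT M) σ h → ∃ N, termAt M (node h) = some N ∧
      SMem true (state q h) (semClosed 𝒜 (𝒜.rank (state q h)) N) := by
    intro h hf
    induction hf with
    | nil => exact ⟨M, rfl, hq⟩
    | @snoc h a j q' hf ht hq' ih =>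
      obtain ⟨N, hN, hs⟩ := ih
      obtain ⟨args, ha⟩ := exists_hnf_of_BT hN ht
      refine ⟨args j, ?_, ?_⟩
      · rw [node_append, termAt_append, hN]
        exact child_of_hnf ha j
      · rw [state_append]
        exact ((hσ h a N args hN ha hs).2 j q' hq').1
  refine ⟨σ, fun h hf a ht => ?_, fun h hf ht => ?_, fun π hπ => ?_⟩
  · obtain ⟨N, hN, hs⟩ := hinv h hf
    obtain ⟨args, ha⟩ := exists_hnf_of_BT hN ht
    exact (hσ h a N args hN ha hs).1
  · obtain ⟨N, hN, hs⟩ := hinv h hf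
    have := sgn_ne_of_hnf_eq_none (hnf_eq_none_of_BT hN ht) hs
    exact Nat.not_odd_iff_even.1 fun ho => this (decide_eq_true ho)
  · let H : ℕ → List (ℕ × Q) := fun n => (List.range n).map π
    have hH : ∀ n, H (n + 1) = H n ++ [π n] := fun n => by
      simp [H, List.range_succ]
    choose N hN hs using fun n => hinv (H n) (hπ n)
    have hgood : ∀ n, GoodMove 𝒜 true (N n) (state q (H n)) (N (n + 1)) (state q (H (n + 1))) := by
      intro n
      obtain ⟨a, j, q', hp, hf, ht, hq'⟩ := Follows.last
        (show Follows (BT M) σ (H n ++ [π n]) from hH n ▸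
          (show Follows (BT M) σ (H (n + 1)) from hπ (n + 1)))
      obtain ⟨args, ha⟩ := exists_hnf_of_BT (hN n) ht
      have h₁ : state q (H (n + 1)) = q' := by rw [hH, state_append, hp]
      have h₂ : N (n + 1) = args j := by
        have := hN (n + 1)
        rw [hH, hp, node_append, termAt_append, hN n] at this
        exact Option.some.inj (this.symm.trans (child_of_hnf ha j))
      rw [h₁, h₂]
      exact (hσ _ a _ args (hN n) ha (hs n)).2 j q' hq'
    obtain ⟨n₀, hn₀⟩ := WellFoundedLT.antitone_chain_condition
      (f := fun n => 𝒜.rank (state q (H n))) (antitone_nat_of_succ_le fun n => (hgood n).2.1)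
    refine ⟨𝒜.rank (state q (H n₀)), ?_, n₀, fun n hn => ?_⟩
    · refine Nat.not_odd_iff_even.1 fun ho => ?_
      refine not_forall_decreasing (f := fun n => dist 𝒜 (N n) (state q (H n))) (N := n₀)
        fun n hn => (hgood n).2.2 ?_ ?_
      · rw [← hn₀ n hn]
        exact decide_eq_true ho
      · exact (hn₀ (n + 1) (Nat.le_succ_of_le hn)).symm.trans (hn₀ n hn)
    · rw [hn₀ (n + 1) (Nat.le_succ_of_le hn), hH, state_append]

/-- If the state is outside the semantics, Adam answers Eve's winning strategy by good moves of the
opposite sign. He is never stuck, as `Forces` supplies a successor in every transition, so an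
infinite play arises; its ranks settle at an even value and the distance descends forever. -/
theorem mem_sem_of_accepts [Finite Q] {M : Tm ar [] .o} {q : Q} (h : 𝒜.Accepts (BT M) q) :
    SMem true q (semClosed 𝒜 (𝒜.rank q) M) := by
  by_contra hq
  obtain ⟨σ, h₁, h₂, h₃⟩ := h
  -- Partial plays against `σ` whose current position the semantics denies to Eve; the infinite play
  -- is an orbit in this set.
  let X := {p : List (ℕ × Q) × Tm ar [] .o // Follows (BT M) σ p.1 ∧
    termAt M (node p.1) = some p.2 ∧
    SMem false (state q p.1) (semClosed 𝒜 (𝒜.rank (state q p.1)) p.2)}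
  have hstep : ∀ x : X, ∃ (y : X) (m : ℕ × Q), y.1.1 = x.1.1 ++ [m] ∧
      GoodMove 𝒜 false x.1.2 (state q x.1.1) y.1.2 (state q y.1.1) := by
    rintro ⟨⟨h, N⟩, hf, hN, hs⟩
    rcases hN' : hnf N with _ | ⟨a, args⟩
    · have he := h₂ h hf (by rw [BT_eq, hN, Option.map_some, hN']; rfl)
      exact absurd (decide_eq_false (Nat.not_odd_iff_even.2 he)) (sgn_ne_of_hnf_eq_none hN' hs)
    · have ht : BT M (node h) = some (some a) := BT_of_hnf hN hN'
      obtain ⟨j, q', hq', hg⟩ := forces_goodMove (hasHnf_of_hnf hN') hs _ (h₁ h hf a ht)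
      have hst : state q (h ++ [((j : ℕ), q')]) = q' := state_append ..
      refine ⟨⟨(h ++ [((j : ℕ), q')], args j), .snoc j hf ht hq', ?_, ?_⟩, ((j : ℕ), q'), rfl, ?_⟩
      · rw [node_append, termAt_append, hN]
        exact child_of_hnf hN' j
      · rw [hst]
        exact hg.1
      · show GoodMove 𝒜 false N (state q h) (args j) (state q (h ++ [((j : ℕ), q')]))
        rw [hst]
        exact hg
  choose next mv hmv hgood using hstep
  let x : ℕ → X := fun n => next^[n] ⟨([], M), .nil, rfl, hq⟩
  have hx : ∀ n, x (n + 1) = next (x n) := fun n => Function.iterate_succ_apply' ..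
  have hπ : ∀ n, (x n).1.1 = (List.range n).map fun n => mv (x n) := by
    intro n
    induction n with
    | zero => rfl
    | succ n ih => rw [hx, hmv, List.range_succ, List.map_append, ← ih]; rfl
  obtain ⟨r, hr, n₀, hn₀⟩ := h₃ (fun n => mv (x n)) fun n => hπ n ▸ (x n).2.1
  have hst : ∀ n ≥ n₀, 𝒜.rank (state q (x (n + 1)).1.1) = r := fun n hn => by
    rw [hx, hmv, state_append]
    exact hn₀ n hn
  -- The state at position `n + 1` is given by move `n`, so the ranks of the positions are constant
  -- one step later than those of the moves.
  refine not_forall_decreasing (f := fun n => dist 𝒜 (x n).1.2 (state q (x n).1.1))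
    (N := n₀ + 1) fun n hn => ?_
  obtain ⟨n, rfl⟩ := Nat.exists_eq_add_of_le' (Nat.le_of_succ_le hn)
  have hg := hgood (x (n + n₀))
  rw [← hx] at hg
  obtain ⟨n, rfl⟩ : ∃ i, n = i + 1 := ⟨n - 1, by omega⟩
  have e₁ := hst (n + n₀) (Nat.le_add_left _ _)
  have e₂ := hst (n + n₀ + 1) (by omega)
  have e : n + 1 + n₀ = n + n₀ + 1 := by omega
  rw [e] at hg ⊢
  refine hg.2.2 ?_ (e₂.trans e₁.symm)
  rw [e₁]
  exact decide_eq_false (Nat.not_odd_iff_even.2 hr)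

end Game

/-! ### Satisfaction of intersection types -/

section Satisfaction

variable {Q : Type u} {ρ : Q → ℕ} {k l : ℕ} {A B : SType} {b : Bool}

instance ITy.instFinite [Finite Q] : (A : SType) → Finite (ITy Q A)
  | .o => inferInstanceAs (Finite Q)
  | .arr A B =>
    have := ITy.instFinite A
    have := ITy.instFinite B
    inferInstanceAs (Finite (Set (ITy Q A) × ITy Q B))

variable (ρ) in
/-- A coherent family of values satisfies an intersection type: it contains the state (for the
sign `false`: it does not contain the state), and maps families that satisfy the premises of an
arrow to families that satisfy the conclusion. -/
def Sat (b : Bool) : (A : SType) → ITy Q A → (ℕ → Val Q A) → Prop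
  | .o, q, d => SMem b (show Q from q) (d (ρ q))
  | .arr A B, p, d => ∀ g, Coh ρ g →
      (∀ t ∈ (show Set (ITy Q A) × ITy Q B from p).1, Sat b A t g) →
      Sat b B (show Set (ITy Q A) × ITy Q B from p).2 (famApp d g)

theorem types_unique {t : ITy Q A} (h : t ∈ types ρ k A) (h' : t ∈ types ρ l A) : k = l := by
  induction A with
  | o => exact Eq.trans (Eq.symm h) h'
  | arr A B _ ihB => exact ihB h.2 h'.2

theorem mem_Types_arr {U : Set (ITy Q A)} {s : ITy Q B}
    (h : ((U, s) : Set (ITy Q A) × ITy Q B) ∈ Types ρ k (.arr A B)) :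
    U ⊆ Types ρ k A ∧ s ∈ Types ρ k B := by
  obtain ⟨l, hl, h⟩ := h
  refine ⟨fun t ht => ?_, l, hl, h.2⟩
  obtain ⟨l', hl', ht'⟩ := h.1 t ht
  exact ⟨l', hl'.trans hl, ht'⟩

/-- A type of rank `k` ends in a state of rank `k`, and application is pointwise; so it constrains
only stratum `k`, monotonically in the order of the sign. -/
theorem Sat.mono {t : ITy Q A} (ht : t ∈ types ρ k A) {d d' : ℕ → Val Q A}
    (h : SLe b (d k) (d' k)) (hd : Sat ρ b A t d) : Sat ρ b A t d' := by
  induction A with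
  | o =>
    have ht : ρ t = k := ht
    subst ht
    exact sLe_o.1 h _ hd
  | arr A B _ ihB => exact fun g hg hs => ihB ht.2 (sLe_arr.1 h (g k)) (hd g hg hs)

theorem Sat.congr {t : ITy Q A} (ht : t ∈ types ρ k A) {d d' : ℕ → Val Q A}
    (h : d k = d' k) (hd : Sat ρ b A t d) : Sat ρ b A t d' := hd.mono ht (SLe.of_eq b h)

theorem ITy.Sub.refl (t : ITy Q A) : ITy.Sub A t t := by
  induction A with
  | o => rfl
  | arr A B ihA ihB => exact ⟨fun x hx => ⟨x, hx, ihA x⟩, ihB _⟩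

theorem SetSub.of_subset {S T : Set (ITy Q A)} (h : S ⊆ T) : SetSub S T :=
  fun s hs => ⟨s, h hs, .refl s⟩

theorem Sat.sub {s t : ITy Q A} (h : ITy.Sub A s t) {d : ℕ → Val Q A} (hd : Sat ρ b A t d) :
    Sat ρ b A s d := by
  induction A with
  | o => exact (show s = t from h) ▸ hd
  | arr A B ihA ihB =>
    refine fun g hg hs => ihB h.2 (hd g hg fun x hx => ?_)
    obtain ⟨y, hy, hxy⟩ := h.1 x hx
    exact ihA hxy (hs y hy)

theorem Sat.setSub {S T : Set (ITy Q A)} (h : SetSub S T) {d : ℕ → Val Q A}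
    (hd : ∀ t ∈ T, Sat ρ b A t d) : ∀ s ∈ S, Sat ρ b A s d := fun s hs => by
  obtain ⟨t, ht, hst⟩ := h s hs
  exact (hd t ht).sub hst

variable (ρ) in
/-- The least value, in the order of the given sign, that satisfies a set of types. -/
noncomputable def leastVal (b : Bool) (k : ℕ) : (A : SType) → Set (ITy Q A) → Val Q A
  | .o, T => ({q : Q | ρ q ≤ k ∧ match b with
    | true => q ∈ (show Set Q from T)
    | false => q ∉ (show Set Q from T)} : Set Q)
  | .arr A B, T => lamVal ρ k A B fun h => leastVal b k B
      {s | ∃ U : Set (ITy Q A), ((U, s) : Set (ITy Q A) × ITy Q B) ∈ T ∧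
        ((U, s) : Set (ITy Q A) × ITy Q B) ∈ Types ρ k (.arr A B) ∧ SLe b (leastVal b k A U) h}

theorem sMem_leastVal {q : Q} (hq : ρ q ≤ k) {T : Set Q} :
    SMem b q (leastVal ρ b k .o T) ↔ q ∈ T := by
  cases b
  · show ¬ (_ ∧ q ∉ T) ↔ _
    simp [hq]
  · exact and_iff_right hq

/-- States of rank above `k` lie in neither set, so they are harmless for both signs. -/
theorem sLe_of_forall_rank_le {P P' : Val Q .o} (hP : P ∈ D ρ k .o) (hP' : P' ∈ D ρ k .o)
    (h : ∀ q, ρ q ≤ k → SMem b q P → SMem b q P') : SLe b P P' := by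
  refine sLe_o.2 fun q hq => ?_
  by_cases hk : ρ q ≤ k
  · exact h q hk hq
  · cases b
    · exact fun h' => hk (mem_D_o.1 hP' h')
    · exact absurd (mem_D_o.1 hP hq) hk

theorem leastVal_inter (T : Set (ITy Q A)) :
    leastVal ρ b k A T = leastVal ρ b k A (T ∩ Types ρ k A) := by
  cases A with
  | o =>
    refine Set.ext fun q => and_congr_right fun hq => ?_
    have : (show Q from q) ∈ (show Set Q from Types ρ k .o) := ⟨ρ q, hq, rfl⟩
    cases b
    · exact not_congr ⟨fun h => ⟨h, this⟩, fun h => h.1⟩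
    · exact ⟨fun h => ⟨h, this⟩, fun h => h.1⟩
  | arr A B =>
    refine lamVal_congr fun x _ => congrArg _ (Set.ext fun s => ?_)
    exact ⟨fun ⟨U, h, h', h''⟩ => ⟨U, ⟨h, h'⟩, h', h''⟩,
      fun ⟨U, h, h', h''⟩ => ⟨U, h.1, h', h''⟩⟩

theorem leastVal_mono {T T' : Set (ITy Q A)} (h : T ⊆ T') :
    SLe b (leastVal ρ b k A T) (leastVal ρ b k A T') := by
  induction A with
  | o =>
    cases b
    · exact fun q hq => ⟨hq.1, fun hT => hq.2 (h hT)⟩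
    · exact fun q hq => ⟨hq.1, h hq.2⟩
  | arr A B _ ihB =>
    refine sLe_arr.2 fun x => ?_
    show SLe b ((lamVal ρ k A B _).fn x) ((lamVal ρ k A B _).fn x)
    by_cases hx : x ∈ D ρ k A
    · rw [lamVal_of_mem hx, lamVal_of_mem hx]
      exact ihB fun s ⟨U, h₁, h₂⟩ => ⟨U, h h₁, h₂⟩
    · rw [lamVal_of_notMem hx, lamVal_of_notMem hx]
      exact SLe.refl b _

variable (ρ) in
/-- The conclusions of the arrow types in `T` whose premises hold of `x`. -/
def conclusions (b : Bool) (k : ℕ) (T : Set (ITy Q (.arr A B))) (x : Val Q A) : Set (ITy Q B) :=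
  {s | ∃ U : Set (ITy Q A), ((U, s) : Set (ITy Q A) × ITy Q B) ∈ T ∧
    ((U, s) : Set (ITy Q A) × ITy Q B) ∈ Types ρ k (.arr A B) ∧ SLe b (leastVal ρ b k A U) x}

theorem conclusions_subset {T : Set (ITy Q (.arr A B))} {x : Val Q A} :
    conclusions ρ b k T x ⊆ Types ρ k B := fun _ ⟨_, _, h, _⟩ => (mem_Types_arr h).2

theorem leastVal_app {T : Set (ITy Q (.arr A B))} {x : Val Q A} (hx : x ∈ D ρ k A) :
    (leastVal ρ b k (.arr A B) T).fn x = leastVal ρ b k B (conclusions ρ b k T x) :=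
  lamVal_of_mem hx

/-- Three facts by one induction on the type: coherence, the adjunction between satisfying `T` and
lying above its least value, and reflection: what the least value of `T` satisfies is subsumed by an
element of `T`. Reflection at an arrow tests the function on the least value of the premises and
uses adjunction and reflection at the argument type. -/
theorem leastVal_aux (ρ : Q → ℕ) (b : Bool) (A : SType) :
    (∀ T, Coh ρ fun k => leastVal ρ b k A T) ∧
    (∀ k, ∀ T ⊆ Types ρ k A, ∀ g, Coh ρ g →
      ((∀ t ∈ T, Sat ρ b A t g) ↔ SLe b (leastVal ρ b k A T) (g k))) ∧
    ∀ k, ∀ t ∈ types ρ k A, ∀ T, Sat ρ b A t (fun k => leastVal ρ b k A T) →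
      ∃ t' ∈ T, ITy.Sub A t t' := by
  induction A with
  | o =>
    have hc (T : Set (ITy Q .o)) : Coh ρ fun k => leastVal ρ b k .o T :=
      coh_o (fun k q hq => hq.1) fun k q hq => by
        show (_ ∧ _) ↔ (_ ∧ _)
        simp only [hq, Nat.le_succ_of_le hq]
    refine ⟨hc, fun k T hT g hg => ⟨fun h => ?_, fun h q hq => ?_⟩, fun k q hq T h => ?_⟩
    · refine sLe_of_forall_rank_le ((hc T).mem k) (hg.mem k) fun q hk hq => ?_
      exact (hg.sMem_iff hk).2 (h q ((sMem_leastVal hk).1 hq))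
    · have hk : ρ q ≤ k := by
        obtain ⟨l, hl, h⟩ := hT hq
        exact le_of_eq_of_le h hl
      exact (hg.sMem_iff hk).1 (sLe_o.1 h q ((sMem_leastVal hk).2 hq))
    · exact ⟨q, (sMem_leastVal le_rfl).1 h, rfl⟩
  | arr A B ihA ihB =>
    obtain ⟨a1, a2, a3⟩ := ihA
    obtain ⟨b1, b2, b3⟩ := ihB
    have c1 : ∀ T, Coh ρ fun k => leastVal ρ b k (.arr A B) T := by
      intro T
      have hm : ∀ k (x y : Val Q A), SLe b x y → SLe b
          (leastVal ρ b k B (conclusions ρ b k T x)) (leastVal ρ b k B (conclusions ρ b k T y)) :=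
        fun k x y hxy =>
        leastVal_mono fun s ⟨U, h₁, h₂, h₃⟩ => ⟨U, h₁, h₂, h₃.trans hxy⟩
      refine coh_lamVal (fun g hg => ?_) fun k x _ y _ hxy => ?_
      -- The applicable conclusions are described by satisfaction, hence by one set for all strata.
      -- Below the rank bound this agrees with the description by order, and types of larger rank do
      -- not affect `leastVal`.
      · have h := b1 {s | ∃ (U : Set (ITy Q A)) (l : ℕ),
          ((U, s) : Set (ITy Q A) × ITy Q B) ∈ T ∧
          ((U, s) : Set (ITy Q A) × ITy Q B) ∈ types ρ l (.arr A B) ∧ ∀ t ∈ U, Sat ρ b A t g}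
        convert h using 2 with k
        rw [leastVal_inter, leastVal_inter {s | ∃ (U : Set (ITy Q A)) (l : ℕ), _}]
        congr 1
        ext s
        constructor
        · rintro ⟨⟨U, h₁, ⟨l, hl, h₂⟩, h₃⟩, hs⟩
          exact ⟨⟨U, l, h₁, h₂, (a2 k U (mem_Types_arr ⟨l, hl, h₂⟩).1 g hg).2 h₃⟩, hs⟩
        · rintro ⟨⟨U, l, h₁, h₂, h₃⟩, l', hl', hs⟩
          have hU : ((U, s) : Set (ITy Q A) × ITy Q B) ∈ Types ρ k (.arr A B) :=
            ⟨l, types_unique hs h₂.2 ▸ hl', h₂⟩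
          exact ⟨⟨U, h₁, hU, (a2 k U (mem_Types_arr hU).1 g hg).1 h₃⟩, l', hl', hs⟩
      · cases b
        · exact hm k y x hxy
        · exact hm k x y hxy
    have c2 : ∀ k, ∀ T ⊆ Types ρ k (.arr A B), ∀ g, Coh ρ g → ((∀ t ∈ T, Sat ρ b (.arr A B) t g) ↔
        SLe b (leastVal ρ b k (.arr A B) T) (g k)) := by
      intro k T hT g hg
      refine ⟨fun h => sLe_arr.2 fun x => ?_, ?_⟩
      · by_cases hx : x ∈ D ρ k A
        · rw [leastVal_app hx]
          obtain ⟨y, hy, rfl⟩ := exists_coh hx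
          refine (b2 k _ conclusions_subset (famApp g y) (hg.app hy)).1 ?_
          rintro s ⟨U, h₁, h₂, h₃⟩
          exact h _ h₁ y hy ((a2 k U (mem_Types_arr h₂).1 y hy).2 h₃)
        · rw [D_bot (hg.mem k) hx, D_bot ((c1 T).mem k) hx]
          exact SLe.refl b _
      · rintro h ⟨U, s⟩ hUs x hx hU
        have hk := hT hUs
        refine (b2 k (conclusions ρ b k T (x k)) conclusions_subset (famApp g x) (hg.app hx)).2 ?_ s
          ⟨U, hUs, hk, (a2 k U (mem_Types_arr hk).1 x hx).1 hU⟩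
        rw [← leastVal_app (hx.mem k)]
        exact sLe_arr.1 h _
    refine ⟨c1, c2, ?_⟩
    rintro k ⟨U, s⟩ ht T h
    have hU := (mem_Types_arr ⟨k, le_rfl, ht⟩).1
    -- The least argument satisfying the premises `U` detects which arrows in `T` account for the
    -- conclusion.
    have h₁ := (h _ (a1 U) ((a2 k U hU _ (a1 U)).2 (SLe.refl b _))).congr ht.2
      (d' := fun j => leastVal ρ b j B (conclusions ρ b k T (leastVal ρ b k A U)))
      (leastVal_app ((a1 U).mem k))
    obtain ⟨s', ⟨U', hT, hk, hle⟩, hs⟩ := b3 k s ht.2 _ h₁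
    refine ⟨(U', s'), hT, fun t ht' => ?_, hs⟩
    obtain ⟨l, hl, htl⟩ := (mem_Types_arr hk).1 ht'
    exact a3 l t htl U ((a2 k U' (mem_Types_arr hk).1 _ (a1 U)).2 hle t ht')

theorem coh_leastVal (T : Set (ITy Q A)) : Coh ρ fun k => leastVal ρ b k A T :=
  (leastVal_aux ρ b A).1 T

theorem sat_leastVal {T : Set (ITy Q A)} (hT : T ⊆ Types ρ k A) :
    ∀ t ∈ T, Sat ρ b A t fun k => leastVal ρ b k A T :=
  ((leastVal_aux ρ b A).2.1 k T hT _ (coh_leastVal T)).2 (SLe.refl b _)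

theorem exists_sub_of_sat_leastVal {t : ITy Q A} (ht : t ∈ Types ρ k A) {T : Set (ITy Q A)}
    (h : Sat ρ b A t fun k => leastVal ρ b k A T) : ∃ t' ∈ T, ITy.Sub A t t' := by
  obtain ⟨l, -, ht⟩ := ht
  exact (leastVal_aux ρ b A).2.2 l t ht T h

theorem Types_subset (A : SType) (h : k ≤ l) : Types ρ k A ⊆ Types ρ l A :=
  fun _ ⟨j, hj, ht⟩ => ⟨j, hj.trans h, ht⟩

/-- A type of the result of an application is the conclusion of an arrow type of the function,
provided that types determine the order at the argument type. -/
theorem sat_arrow_of_app_aux (hord : ∀ g g' : ℕ → Val Q A, Coh ρ g → Coh ρ g' →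
      (∀ t ∈ Types ρ k A, Sat ρ b A t g → Sat ρ b A t g') → SLe b (g k) (g' k))
    {f : ℕ → Val Q (.arr A B)} {g : ℕ → Val Q A} (hf : Coh ρ f) (hg : Coh ρ g) {t : ITy Q B}
    (ht : t ∈ types ρ k B) (h : Sat ρ b B t (famApp f g)) :
    Sat ρ b (.arr A B) (({s ∈ Types ρ k A | Sat ρ b A s g}, t) : Set (ITy Q A) × ITy Q B) f :=
  fun g' hg' hs => h.mono ht (D_mono (hf.mem k) (hg.mem k) (hg'.mem k)
    (hord g g' hg hg' fun s hs' h' => hs s ⟨hs', h'⟩))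

/-- Types of rank at most `k` determine the order of stratum `k`. If the functions were not ordered,
some argument would show it by a type of the results; the arrow from all types of that argument to
this type then separates the functions. -/
theorem sLe_of_forall_sat {g g' : ℕ → Val Q A} (hg : Coh ρ g) (hg' : Coh ρ g')
    (h : ∀ t ∈ Types ρ k A, Sat ρ b A t g → Sat ρ b A t g') : SLe b (g k) (g' k) := by
  induction A generalizing k with
  | o =>
    exact sLe_of_forall_rank_le (hg.mem k) (hg'.mem k) fun q hq hs =>
      (hg'.sMem_iff hq).2 (h q ⟨ρ q, hq, rfl⟩ ((hg.sMem_iff hq).1 hs))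
  | arr A B ihA ihB =>
    refine sLe_arr.2 fun x => ?_
    by_cases hx : x ∈ D ρ k A
    · obtain ⟨y, hy, rfl⟩ := exists_coh hx
      refine ihB (hg.app hy) (hg'.app hy) ?_
      rintro t ⟨l, hl, ht⟩ hs
      refine h (({s ∈ Types ρ l A | Sat ρ b A s y}, t) : Set (ITy Q A) × ITy Q B)
        ⟨l, hl, fun s hs => hs.1, ht⟩
        (sat_arrow_of_app_aux (fun _ _ => ihA) hg hy ht hs) y hy fun s hs => hs.2
    · rw [D_bot (hg.mem k) hx, D_bot (hg'.mem k) hx]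
      exact SLe.refl b _

theorem sat_arrow_of_app {f : ℕ → Val Q (.arr A B)} {g : ℕ → Val Q A} (hf : Coh ρ f)
    (hg : Coh ρ g) {t : ITy Q B} (ht : t ∈ types ρ k B) (h : Sat ρ b B t (famApp f g)) :
    Sat ρ b (.arr A B) (({s ∈ Types ρ k A | Sat ρ b A s g}, t) : Set (ITy Q A) × ITy Q B) f :=
  sat_arrow_of_app_aux (fun _ _ => sLe_of_forall_sat) hf hg ht h

/-- The starting point satisfies all types of rank `k` or none, according to the sign: this is what
distinguishes the two recursion rules. The arrow case needs some argument satisfying the premises,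
else satisfaction could be vacuous; `leastVal` provides one. -/
theorem sat_start {e : ℕ → Val Q A} (he : Coh ρ e) (h : e k = start ρ e k) {t : ITy Q A}
    (ht : t ∈ types ρ k A) : Sat ρ b A t e ↔ sgn k ≠ b := by
  induction A with
  | o =>
    have ht : ρ t = k := ht
    subst ht
    have := not_sMem_start (q := t) he
    rw [← h] at this
    refine ⟨?_, fun hb => ?_⟩
    · rintro hs rfl
      exact this hs
    · rw [Bool.eq_not_of_ne hb] at this
      exact not_not.1 fun hn => this (sMem_not.2 hn)
  | arr A B _ ihB =>
    have hap : ∀ g, Coh ρ g → (Sat ρ b B t.2 (famApp e g) ↔ sgn k ≠ b) := fun g hg =>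
      ihB (he.app hg) (by rw [← start_app hg, famApp, h]) ht.2
    refine ⟨fun hs => ?_, fun hb g hg _ => (hap g hg).2 hb⟩
    exact (hap _ (coh_leastVal t.1)).1
      (hs _ (coh_leastVal t.1) (sat_leastVal fun s hs => ht.1 s hs))

/-- The same all-or-nothing alternative as for starting points; hence the parity condition in the
rules for `Ω`. -/
theorem sat_omegaVal {t : ITy Q A} (ht : t ∈ types ρ k A) :
    Sat ρ b A t (fun j => omegaVal ρ j A) ↔ sgn k ≠ b := by
  induction A with
  | o =>
    have ht : ρ t = k := ht
    subst ht
    have h : t ∈ (show Set Q from omegaVal ρ (ρ t) .o) ↔ ¬ Odd (ρ t) :=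
      (and_iff_right le_rfl).trans Nat.not_odd_iff_even.symm
    cases b
    · refine (not_congr h).trans ?_
      simp [sgn]
    · refine h.trans ?_
      simp [sgn]
  | arr A B _ ihB =>
    have hap : ∀ g, Coh ρ g → (Sat ρ b B t.2 (famApp (fun j => omegaVal ρ j (.arr A B)) g) ↔
        sgn k ≠ b) := fun g hg => by
      rw [show famApp (fun j => omegaVal ρ j (.arr A B)) g = fun j => omegaVal ρ j B from
        funext fun j => lamVal_of_mem (hg.mem j)]
      exact ihB ht.2
    refine ⟨fun hs => ?_, fun hb g hg _ => (hap g hg).2 hb⟩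
    exact (hap _ (coh_leastVal t.1)).1
      (hs _ (coh_leastVal t.1) (sat_leastVal fun s hs => ht.1 s hs))

/-- Unfolds the nested arrows of a constant into a condition on all tuples of arguments at once, so
that `Forces` can be applied. -/
theorem sat_curry : ∀ (n : ℕ) {f : ℕ → (Fin n → Set Q) → Set Q} {T : Fin n → Set Q} {q : Q},
    Sat ρ b (SType.ord1 n) (arrows n T q) (fun k => curry ρ k n (f k)) ↔
      ∀ P : Fin n → ℕ → Set Q, (∀ j, Coh (A := .o) ρ (P j)) →
        (∀ j, ∀ q' ∈ T j, SMem b q' (P j (ρ q'))) → SMem b q (f (ρ q) fun j => P j (ρ q))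
  | 0, f, T, q => by
    have e : ∀ P : Fin 0 → ℕ → Set Q, (fun j => P j (ρ q)) = Fin.elim0 :=
      fun P => funext fun j => j.elim0
    refine ⟨fun h P _ _ => ?_, fun h => ?_⟩
    · rw [e]
      exact h
    · have := h (fun j => j.elim0) (fun j => j.elim0) fun j => j.elim0
      rwa [e] at this
  | n + 1, f, T, q => by
    have e : ∀ g : ℕ → Val Q .o, Coh ρ g → famApp (fun k => curry ρ k (n + 1) (f k)) g =
        fun k => curry ρ k n fun P => f k (Fin.cons (show Set Q from g k) P) :=
      fun g hg => funext fun k => lamVal_of_mem (hg.mem k)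
    have e' : ∀ (g : ℕ → Set Q) (P : Fin n → ℕ → Set Q), (Fin.cons (g (ρ q)) fun j => P j (ρ q)) =
        fun j => Fin.cons (α := fun _ => ℕ → Set Q) g P j (ρ q) := fun g P =>
      funext fun j => Fin.cases rfl (fun _ => rfl) j
    constructor
    · intro h P hP hT
      have := h (P 0) (hP 0) (hT 0)
      rw [e _ (hP 0)] at this
      have := (sat_curry n).1 this (Fin.tail P) (fun j => hP j.succ) fun j => hT j.succ
      have e₀ := e' (P 0) (Fin.tail P)
      rw [Fin.cons_self_tail] at e₀
      exact (congrArg (fun X => SMem b q (f (ρ q) X)) e₀).mp this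
    · intro h g hg hT
      rw [e g hg]
      refine (sat_curry n).2 fun P hP hT' => ?_
      have := h (Fin.cons g P) (fun j => Fin.cases hg hP j) fun j => Fin.cases hT hT' j
      exact (congrArg (fun X => SMem b q (f (ρ q) X)) (e' g P)).mpr this

theorem exists_arrows : ∀ (n : ℕ) (t : ITy Q (SType.ord1 n)), ∃ T q, t = arrows n T q
  | 0, q => ⟨Fin.elim0, q, rfl⟩
  | n + 1, t => by
    obtain ⟨T, q, h⟩ := exists_arrows n (show Set Q × ITy Q (SType.ord1 n) from t).2
    exact ⟨Fin.cons (show Set Q × ITy Q (SType.ord1 n) from t).1 T, q, Prod.ext rfl h⟩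

theorem arrows_mem_types : ∀ (n : ℕ) {T : Fin n → Set Q} {q : Q},
    arrows n T q ∈ types ρ k (SType.ord1 n) ↔ ρ q = k ∧ ∀ j, T j ⊆ Qle ρ k
  | 0, _, _ => ⟨fun h => ⟨h, fun j => j.elim0⟩, fun h => h.1⟩
  | n + 1, T, q => by
    refine Iff.trans (and_congr Iff.rfl (arrows_mem_types n)) ?_
    rw [Fin.forall_fin_succ, and_left_comm]
    refine and_congr_right fun _ => and_congr_left fun _ => ?_
    exact ⟨fun h q' hq' => by
      obtain ⟨l, hl, e⟩ := h q' hq'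
      exact le_of_eq_of_le e hl, fun h q' hq' => ⟨ρ q', h hq', rfl⟩⟩

theorem arrows_sub : ∀ (n : ℕ) {T T' : Fin n → Set Q} {q : Q}, (∀ j, T' j ⊆ T j) →
    ITy.Sub (SType.ord1 n) (arrows n T q) (arrows n T' q)
  | 0, _, _, _, _ => rfl
  | n + 1, _, _, _, h => ⟨fun x hx => ⟨x, h 0 hx, rfl⟩, arrows_sub n fun j => h j.succ⟩

end Satisfaction

/-! ### Soundness and completeness of the type systems -/

section Systems

variable {Q : Type u} {C : Type v} {ar : C → ℕ} (𝒜 : WeakAutomaton Q ar)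

/-- The judgement `E ⊢ M ≥ S` (`E ⊢ M ≱ S`, for the sign `false`) holds in the model. -/
def Sound (b : Bool) {Γ : List SType} (E : Env Q Γ) {A : SType} (M : Tm ar Γ A)
    (S : Set (ITy Q A)) : Prop :=
  ∀ ν : ℕ → Assign Q Γ, AssignCoh 𝒜.rank ν →
    (∀ A x, ∀ t ∈ E A x, Sat 𝒜.rank b A t fun k => ν k A x) →
    ∀ s ∈ S, Sat 𝒜.rank b A s (semFam 𝒜 M ν)

variable {𝒜} {b : Bool} {Γ : List SType} {E : Env Q Γ} {A B : SType}

theorem tyApp_sat {S : Set (ITy Q (.arr A B))} {T : Set (ITy Q A)}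
    {f : ℕ → Val Q (.arr A B)} {g : ℕ → Val Q A} (hg : Coh 𝒜.rank g)
    (hS : ∀ s ∈ S, Sat 𝒜.rank b (.arr A B) s f) (hT : ∀ t ∈ T, Sat 𝒜.rank b A t g) :
    ∀ t ∈ tyApp S T, Sat 𝒜.rank b B t (famApp f g) := by
  rintro t ⟨U, hU, hUT⟩
  exact hS _ hU g hg (Sat.setSub hUT hT)

theorem Sound.union {M : Tm ar Γ A} {S T : Set (ITy Q A)} (hS : Sound 𝒜 b E M S)
    (hT : Sound 𝒜 b E M T) : Sound 𝒜 b E M (S ∪ T) := fun ν hν hE s hs =>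
  hs.elim (hS ν hν hE s) (hT ν hν hE s)

theorem Sound.sub {M : Tm ar Γ A} {S T : Set (ITy Q A)} (hS : Sound 𝒜 b E M S)
    (h : SetSub T S) : Sound 𝒜 b E M T := fun ν hν hE => Sat.setSub h (hS ν hν hE)

theorem Sound.const (a : C) (q : Q) (T : Fin (ar a) → Set Q)
    (h : Forces 𝒜 b q a fun j q' => q' ∈ T j) : Sound 𝒜 b E (.const a) {arrows (ar a) T q} := by
  rintro ν - - _ rfl
  refine (sat_curry (ar a)).2 fun P hP hT => ?_
  refine (sMem_constOp le_rfl a _).2 (h.mono fun j q' hq' hj => ?_)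
  exact ((hP j).sMem_iff hq').2 (hT j q' hj)

theorem Sound.omega {k : ℕ} (hk : sgn k ≠ b) {S : Set (ITy Q A)} (hS : S ⊆ types 𝒜.rank k A) :
    Sound 𝒜 b E (.omega A) S := fun _ _ _ _ hs => (sat_omegaVal (hS hs)).2 hk

variable [Finite Q]

theorem Sound.app {M : Tm ar Γ (.arr A B)} {N : Tm ar Γ A} {S : Set (ITy Q (.arr A B))}
    {T : Set (ITy Q A)} (hM : Sound 𝒜 b E M S) (hN : Sound 𝒜 b E N T) :
    Sound 𝒜 b E (.app M N) (tyApp S T) := fun ν hν hE =>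
  tyApp_sat (coh_semFam N hν) (hM ν hν hE) (hN ν hν hE)

omit [Finite Q] in
theorem Sound.lam {M : Tm ar (A :: Γ) B} {S : Set (ITy Q A)} {T : Set (ITy Q B)}
    (hM : Sound 𝒜 b (E.cons S) M T) : Sound 𝒜 b E (.lam M) (arrow S T) := by
  rintro ν hν hE ⟨U, t⟩ ⟨hU, ht⟩ g hg hs
  have hU : U = S := hU
  subst hU
  rw [famApp_semFam_lam M ν hg]
  refine hM _ (.cons hg hν) (fun A x => ?_) t ht
  cases x with
  | zero => exact hs
  | succ x => exact hE _ x

/-- Uses nothing but the fixpoint equation, so no condition on ranks is needed. -/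
theorem Sound.fixApp {M : Tm ar (A :: Γ) A} {S : Set (ITy Q (.arr A A))} {T : Set (ITy Q A)}
    (hM : Sound 𝒜 b E (.lam M) S) (hN : Sound 𝒜 b E (.fix M) T) :
    Sound 𝒜 b E (.fix M) (tyApp S T) := fun ν hν hE => by
  have := tyApp_sat (coh_semFam (.fix M) hν) (hM ν hν hE) (hN ν hν hE)
  rwa [semFam_fix, famApp_fixFam (coh_semFam (.lam M) hν)] at this

/-- The starting point satisfies every type of rank `k`, and the premise on `.lam M` preserves `S`
along the iteration. The types in `T` have smaller rank, where all iterates agree with the fixpoint.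
-/
theorem Sound.fixInv {k : ℕ} (hk : sgn k ≠ b) {M : Tm ar (A :: Γ) A} {S T : Set (ITy Q A)}
    (hS : S ⊆ types 𝒜.rank k A) (hT : T ⊆ TypesLT 𝒜.rank k A)
    (hM : Sound 𝒜 b E (.lam M) (arrow (S ∪ T) S)) (hN : Sound 𝒜 b E (.fix M) T) :
    Sound 𝒜 b E (.fix M) (S ∪ T) := fun ν hν hE => by
  have hφ := hN ν hν hE
  have hF := coh_semFam (.lam M) hν
  rw [semFam_fix] at hφ ⊢
  have hlow : ∀ e, (∀ j < k, e j = fixFam 𝒜.rank (semFam 𝒜 (.lam M) ν) j) →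
      ∀ t ∈ T, Sat 𝒜.rank b A t e := fun e he t ht => by
    obtain ⟨l, hl, htl⟩ := hT ht
    exact (hφ t ht).congr htl (he l hl).symm
  suffices h : ∀ s ∈ S, Sat 𝒜.rank b A s (fixFam 𝒜.rank (semFam 𝒜 (.lam M) ν)) from
    fun s hs => hs.elim (h s) (hφ s)
  refine fixFam_induction hF k (p := fun e => ∀ s ∈ S, Sat 𝒜.rank b A s e)
    (fun d d' _ _ hdd' h s hs => (h s hs).congr (hS hs) hdd')
    (fun e he _ hek s hs => (sat_start he hek (hS hs)).2 hk) fun e he hl h s hs => ?_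
  exact hM ν hν hE ((S ∪ T, s) : Set (ITy Q A) × ITy Q A) ⟨rfl, hs⟩ e he
    fun t ht => ht.elim (h t) (hlow e hl t)

omit [Finite Q] in
theorem sgn_two_mul (k : ℕ) : sgn (2 * k) = false := by simp [sgn]

omit [Finite Q] in
theorem sgn_two_mul_add_one (k : ℕ) : sgn (2 * k + 1) = true := by simp [sgn]

omit [Finite Q] in
theorem sgn_ne_true {l : ℕ} (h : sgn l ≠ true) : ∃ k, l = 2 * k := by
  have : ¬ Odd l := by simpa [sgn] using h
  exact (Nat.not_odd_iff_even.1 this).exists_two_nsmul.imp fun k hk => by simpa using hk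

omit [Finite Q] in
theorem sgn_ne_false {l : ℕ} (h : sgn l ≠ false) : ∃ k, l = 2 * k + 1 := by
  have : Odd l := by simpa [sgn] using h
  exact this

omit [Finite Q] in
theorem Types_eq_TypesLT (ρ : Q → ℕ) (k : ℕ) (A : SType) : Types ρ k A = TypesLT ρ (k + 1) A := by
  ext t
  simp only [Types, TypesLT, Nat.lt_succ_iff]

omit [Finite Q] in
-- A type of rank `k` ends in a state of that rank, so the bound is automatic.
theorem types_le_maxRank [Fintype Q] {k : ℕ} {t : ITy Q A} (h : t ∈ types 𝒜.rank k A) :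
    t ∈ Types 𝒜.rank 𝒜.maxRank A := by
  refine ⟨k, ?_, h⟩
  induction A with
  | o => exact le_of_eq_of_le (Eq.symm h) (Finset.le_sup (f := 𝒜.rank) (Finset.mem_univ _))
  | arr A B _ ihB => exact ihB h.2

/-! ### Soundness of both systems. -/

theorem Derives.sound [Fintype Q] {M : Tm ar Γ A} {S : Set (ITy Q A)} (h : Derives 𝒜 E M S) :
    Sound 𝒜 true E M S := by
  induction h with
  | var x => exact fun ν _ hE => hE _ x
  | empty M => exact fun _ _ _ s hs => absurd hs (Set.notMem_empty s)
  | union _ _ ih ih' => exact ih.union ih'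
  | sub _ _ h ih => exact ih.sub h
  | const a q S hS => exact .const a q S ⟨S, hS, fun _ _ h => h⟩
  | omega k hS => exact .omega (by simp [sgn_two_mul]) hS
  | app _ _ ih ih' => exact ih.app ih'
  | lam k _ _ _ ih => exact ih.lam
  | fixOdd _ _ ih ih' => exact ih.fixApp ih'
  | fixEven k hS hT _ _ ih ih' => exact .fixInv (by simp [sgn_two_mul]) hS hT ih ih'

theorem DualDerives.sound [Fintype Q] {M : Tm ar Γ A} {S : Set (ITy Q A)}
    (h : DualDerives 𝒜 E M S) : Sound 𝒜 false E M S := by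
  induction h with
  | var x => exact fun ν _ hE => hE _ x
  | empty M => exact fun _ _ _ s hs => absurd hs (Set.notMem_empty s)
  | union _ _ ih ih' => exact ih.union ih'
  | sub _ _ h ih => exact ih.sub h
  | const a q T _ h =>
    refine .const a q T fun S hS => ?_
    obtain ⟨j, q', hT, hS⟩ := h S hS
    exact ⟨j, q', hS, hT⟩
  | omega k hS => exact .omega (by simp [sgn_two_mul_add_one]) hS
  | app _ _ ih ih' => exact ih.app ih'
  | lam k _ _ _ ih => exact ih.lam
  | fixOdd k hS hT _ _ ih ih' =>
    exact .fixInv (by simp [sgn_two_mul_add_one]) hS (Types_eq_TypesLT _ _ _ ▸ hT) ih ih'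
  | fixEven _ _ ih ih' => exact ih.fixApp ih'

omit [Finite Q]
variable [Fintype Q]

variable (𝒜) in
/-- The rules that the two type systems have in common, up to the sign. -/
structure Rules (b : Bool) (Der : {Γ : List SType} → Env Q Γ → {A : SType} → Tm ar Γ A →
    Set (ITy Q A) → Prop) : Prop where
  var {Γ : List SType} {E : Env Q Γ} {A : SType} (x : Var Γ A) : Der E (.var x) (E A x)
  empty {Γ : List SType} {E : Env Q Γ} {A : SType} (M : Tm ar Γ A) : Der E M ∅
  union {Γ : List SType} {E : Env Q Γ} {A : SType} {M : Tm ar Γ A} {S T : Set (ITy Q A)} :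
    Der E M S → Der E M T → Der E M (S ∪ T)
  sub {Γ : List SType} {E : Env Q Γ} {A : SType} {M : Tm ar Γ A} {S T : Set (ITy Q A)} :
    Der E M S → T ⊆ Types 𝒜.rank 𝒜.maxRank A → SetSub T S → Der E M T
  const {Γ : List SType} {E : Env Q Γ} (a : C) (q : Q) (T : Fin (ar a) → Set Q) :
    (∀ j, T j ⊆ Qle 𝒜.rank (𝒜.rank q)) → Forces 𝒜 b q a (fun j q' => q' ∈ T j) →
    Der E (.const a) {arrows (ar a) T q}
  omega {Γ : List SType} {E : Env Q Γ} {A : SType} (k : ℕ) {S : Set (ITy Q A)} :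
    sgn k ≠ b → S ⊆ types 𝒜.rank k A → Der E (.omega A) S
  app {Γ : List SType} {E : Env Q Γ} {A B : SType} {M : Tm ar Γ (.arr A B)} {N : Tm ar Γ A}
    {S : Set (ITy Q (.arr A B))} {T : Set (ITy Q A)} :
    Der E M S → Der E N T → Der E (.app M N) (tyApp S T)
  lam {Γ : List SType} {E : Env Q Γ} {A B : SType} {M : Tm ar (A :: Γ) B} (k : ℕ)
    {S : Set (ITy Q A)} {T : Set (ITy Q B)} :
    S ⊆ Types 𝒜.rank k A → T ⊆ types 𝒜.rank k B → Der (E.cons S) M T →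
    Der E (.lam M) (arrow S T)
  fixApp {Γ : List SType} {E : Env Q Γ} {A : SType} {M : Tm ar (A :: Γ) A}
    {S : Set (ITy Q (.arr A A))} {T : Set (ITy Q A)} :
    Der E (.lam M) S → Der E (.fix M) T → Der E (.fix M) (tyApp S T)
  fixInv {Γ : List SType} {E : Env Q Γ} {A : SType} {M : Tm ar (A :: Γ) A} (k : ℕ)
    {S T : Set (ITy Q A)} : sgn k ≠ b →
    S ⊆ types 𝒜.rank k A → T ⊆ TypesLT 𝒜.rank k A →
    Der E (.lam M) (arrow (S ∪ T) S) → Der E (.fix M) T → Der E (.fix M) (S ∪ T)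

/-! ### Both systems as instances of the common rules. -/

theorem rules_derives : Rules 𝒜 true (Derives 𝒜) where
  var := .var
  empty := .empty
  union := .union
  sub := .sub
  -- The system types a constant by a transition itself; enlarging its premises to `T` is
  -- subsumption.
  const a q T hT h := by
    obtain ⟨S, hS, hST⟩ := h
    refine .sub (.const a q S hS) ?_ ?_
    · rintro _ rfl
      exact types_le_maxRank ((arrows_mem_types (ar a)).2 ⟨rfl, hT⟩)
    · rintro _ rfl
      exact ⟨_, rfl, arrows_sub _ hST⟩
  omega l _ hl := by
    obtain ⟨k, rfl⟩ := sgn_ne_true hl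
    exact .omega k
  app := .app
  lam := .lam
  fixApp := .fixOdd
  fixInv l _ _ hl := by
    obtain ⟨k, rfl⟩ := sgn_ne_true hl
    exact .fixEven k

theorem rules_dualDerives : Rules 𝒜 false (DualDerives 𝒜) where
  var := .var
  empty := .empty
  union := .union
  sub := .sub
  const a q T hT h := .const a q T hT fun S hS => by
    obtain ⟨j, q', hS, hT⟩ := h S hS
    exact ⟨j, q', hT, hS⟩
  omega l _ hl := by
    obtain ⟨k, rfl⟩ := sgn_ne_false hl
    exact .omega k
  app := .app
  lam := .lam
  fixApp := .fixEven
  fixInv l _ _ hl hS hT := by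
    obtain ⟨k, rfl⟩ := sgn_ne_false hl
    rw [← Types_eq_TypesLT] at hT
    exact .fixOdd k hS hT

variable (𝒜) in
/-- The intersection types satisfied by a family of values. -/
def Theory (b : Bool) {A : SType} (d : ℕ → Val Q A) : Set (ITy Q A) :=
  {t ∈ Types 𝒜.rank 𝒜.maxRank A | Sat 𝒜.rank b A t d}

variable {Der : {Γ : List SType} → Env Q Γ → {A : SType} → Tm ar Γ A → Set (ITy Q A) → Prop}

/-! ### Completeness of the common rules. -/

theorem Rules.of_subset (R : Rules 𝒜 b Der) {M : Tm ar Γ A} {S T : Set (ITy Q A)}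
    (h : Der E M S) (hT : T ⊆ Types 𝒜.rank 𝒜.maxRank A) (hTS : T ⊆ S) : Der E M T :=
  R.sub h hT (SetSub.of_subset hTS)

/-- There are finitely many intersection types over a finite `Q`, so finitely many unions suffice.
-/
theorem Rules.of_forall (R : Rules 𝒜 b Der) {M : Tm ar Γ A} {S : Set (ITy Q A)}
    (h : ∀ s ∈ S, Der E M {s}) : Der E M S := by
  induction S, S.toFinite using Set.Finite.induction_on with
  | empty => exact R.empty M
  | @insert s S _ _ ih =>
    rw [Set.insert_eq]
    exact R.union (h s (Set.mem_insert s S)) (ih fun t ht => h t (Set.mem_insert_of_mem s ht))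

/-- Every type of an application comes from an arrow type of the function whose premises are all the
types of the argument of bounded rank. -/
theorem mem_tyApp_theory {f : ℕ → Val Q (.arr A B)} {g : ℕ → Val Q A} (hf : Coh 𝒜.rank f)
    (hg : Coh 𝒜.rank g) {k : ℕ} {t : ITy Q B} (ht : t ∈ types 𝒜.rank k B)
    (h : Sat 𝒜.rank b B t (famApp f g)) {T : Set (ITy Q A)}
    (hT : {s ∈ Types 𝒜.rank k A | Sat 𝒜.rank b A s g} ⊆ T) :
    t ∈ tyApp (Theory 𝒜 b f) T := by
  have hty : (({s ∈ Types 𝒜.rank k A | Sat 𝒜.rank b A s g}, t) : Set (ITy Q A) × ITy Q B) ∈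
      types 𝒜.rank k (.arr A B) := ⟨fun s hs => hs.1, ht⟩
  exact ⟨_, ⟨types_le_maxRank hty, sat_arrow_of_app hf hg ht h⟩, SetSub.of_subset hT⟩

theorem Types_le_maxRank {k : ℕ} : Types 𝒜.rank k A ⊆ Types 𝒜.rank 𝒜.maxRank A :=
  fun _ ⟨_, _, h⟩ => types_le_maxRank h

theorem Rules.der_const (R : Rules 𝒜 b Der) (a : C) (ν : ℕ → Assign Q Γ) :
    Der E (.const a) (Theory 𝒜 b (semFam 𝒜 (.const a) ν)) := by
  refine R.of_forall ?_
  rintro t ⟨⟨k, -, ht⟩, hs⟩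
  obtain ⟨T, q, rfl⟩ := exists_arrows (ar a) t
  obtain ⟨rfl, hT⟩ := (arrows_mem_types (ar a)).1 ht
  refine R.const a q T hT ?_
  have hsub (j) : (show Set (ITy Q .o) from T j) ⊆ Types 𝒜.rank (𝒜.rank q) .o :=
    fun q' hq' => ⟨𝒜.rank q', hT j hq', rfl⟩
  -- Tested on the least arguments satisfying the premises, membership of the arguments is
  -- membership in `T j`.
  have := (sat_curry (ar a)).1 hs (fun j k => leastVal 𝒜.rank b k .o (T j))
    (fun j => coh_leastVal (A := .o) (T j)) fun j => sat_leastVal (hsub j)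
  refine ((sMem_constOp le_rfl a _).1 this).mono fun j q' hq' h => ?_
  exact (sMem_leastVal hq').1 h

/-- For an arrow `T → s` the bound variable is given the least value satisfying `T`. By reflection
its theory is subsumed by `T`, so the induction hypothesis derives `s` under the assumption `T`. -/
theorem Rules.der_lam (R : Rules 𝒜 b Der) {M : Tm ar (A :: Γ) B}
    (ih : ∀ (ν : ℕ → Assign Q (A :: Γ)) (E : Env Q (A :: Γ)), AssignCoh 𝒜.rank ν →
      (∀ A x, SetSub (Theory 𝒜 b fun k => ν k A x) (E A x)) →
        Der E M (Theory 𝒜 b (semFam 𝒜 M ν)))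
    {ν : ℕ → Assign Q Γ} (hν : AssignCoh 𝒜.rank ν)
    (hE : ∀ A x, SetSub (Theory 𝒜 b fun k => ν k A x) (E A x)) :
    Der E (.lam M) (Theory 𝒜 b (semFam 𝒜 (.lam M) ν)) := by
  refine R.of_forall ?_
  rintro ⟨T, s⟩ ⟨⟨k, -, ht⟩, hs⟩
  have hT : T ⊆ Types 𝒜.rank k A := ht.1
  have hc := coh_leastVal (ρ := 𝒜.rank) (b := b) T
  have hsat := hs _ hc (sat_leastVal hT)
  rw [famApp_semFam_lam M ν hc] at hsat
  have hd := ih _ (E.cons T) (.cons hc hν) fun A x => by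
    cases x with
    | zero => exact fun t ht => exists_sub_of_sat_leastVal ht.1 ht.2
    | succ x => exact hE _ x
  have hts : ({s} : Set (ITy Q B)) ⊆ types 𝒜.rank k B := Set.singleton_subset_iff.2 ht.2
  have := R.lam k hT hts (R.of_subset hd (fun t h => types_le_maxRank (hts h))
    (Set.singleton_subset_iff.2 ⟨types_le_maxRank ht.2, hsat⟩))
  refine R.of_subset this (Set.singleton_subset_iff.2 (types_le_maxRank ht)) ?_
  rintro _ rfl
  exact ⟨rfl, rfl⟩

/-- Induction on the rank `k` of the types to be derived, with the two recursion rules covering the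
two parities. -/
theorem Rules.der_fix (R : Rules 𝒜 b Der) {M : Tm ar (A :: Γ) A} {ν : ℕ → Assign Q Γ}
    (hν : AssignCoh 𝒜.rank ν) (hM : Der E (.lam M) (Theory 𝒜 b (semFam 𝒜 (.lam M) ν))) :
    Der E (.fix M) (Theory 𝒜 b (semFam 𝒜 (.fix M) ν)) := by
  have hF := coh_semFam (.lam M) hν
  have hφ := coh_fixFam hF
  rw [semFam_fix]
  set φ := fixFam 𝒜.rank (semFam 𝒜 (.lam M) ν) with hφ_def
  have key : ∀ k, Der E (.fix M) {t ∈ types 𝒜.rank k A | Sat 𝒜.rank b A t φ} := by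
    intro k
    induction k using Nat.strong_induction_on with
    | _ k ih =>
    have hlow : Der E (.fix M) {t ∈ TypesLT 𝒜.rank k A | Sat 𝒜.rank b A t φ} := by
      refine R.of_forall ?_
      rintro t ⟨⟨l, hl, ht⟩, hs⟩
      exact R.of_subset (ih l hl) (Set.singleton_subset_iff.2 (types_le_maxRank ht))
        (Set.singleton_subset_iff.2 ⟨ht, hs⟩)
    by_cases hk : sgn k = b
    · suffices h : Der E (.fix M) {t ∈ Types 𝒜.rank k A | Sat 𝒜.rank b A t φ} from
        R.of_subset h (fun t ht => types_le_maxRank ht.1) fun t ht => ⟨⟨k, le_rfl, ht.1⟩, ht.2⟩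
      have hsplit : ∀ e, (∀ j < k, e j = φ j) → ∀ t ∈ Types 𝒜.rank k A, Sat 𝒜.rank b A t e →
          t ∈ types 𝒜.rank k A ∨ t ∈ {t ∈ TypesLT 𝒜.rank k A | Sat 𝒜.rank b A t φ} := by
        rintro e he t ⟨l, hl, ht⟩ hs
        rcases hl.lt_or_eq with hl | rfl
        · exact .inr ⟨⟨l, hl, ht⟩, hs.congr ht (he l hl)⟩
        · exact .inl ht
      -- Here the starting point has no type of rank `k`, so its types of rank at most `k` are types
      -- of the fixpoint of smaller rank, already derived; each iteration is one use of the
      -- unfolding rule.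
      refine fixFam_induction hF k
        (p := fun e => Der E (.fix M) {t ∈ Types 𝒜.rank k A | Sat 𝒜.rank b A t e}) ?_ ?_ ?_
      · intro d d' hd hd' hdd' h
        refine R.of_subset h (fun t ht => Types_le_maxRank ht.1) ?_
        rintro t ⟨⟨l, hl, ht⟩, hs⟩
        exact ⟨⟨l, hl, ht⟩, hs.congr ht (hd.eq_of_le hd' hl hdd').symm⟩
      · intro e he hel hek
        refine R.of_subset hlow (fun t ht => Types_le_maxRank ht.1) ?_
        rintro t ⟨ht, hs⟩
        exact (hsplit e hel t ht hs).resolve_left fun ht => (sat_start he hek ht).1 hs hk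
      · intro e he _ h
        refine R.of_subset (R.fixApp hM h) (fun t ht => Types_le_maxRank ht.1) ?_
        rintro t ⟨⟨l, hl, ht⟩, hs⟩
        exact mem_tyApp_theory hF he ht hs fun s hs => ⟨Types_subset A hl hs.1, hs.2⟩
    -- The invariant consists of all types of rank `k` of the fixpoint, together with its types of
    -- smaller rank as side assumptions.
    · have h := R.fixInv k hk (S := {t ∈ types 𝒜.rank k A | Sat 𝒜.rank b A t φ})
        (fun t ht => ht.1) (fun t ht => ht.1) (R.of_subset hM ?_ ?_) hlow
      · exact R.of_subset h (fun t ht => types_le_maxRank ht.1) Set.subset_union_left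
      all_goals
        rintro ⟨U, t⟩ ⟨hU, ht⟩
        have hU : U = _ := hU
        subst hU
      · refine types_le_maxRank (k := k) ⟨fun s hs => ?_, ht.1⟩
        rcases hs with hs | ⟨⟨l, hl, hs⟩, -⟩
        · exact ⟨k, le_rfl, hs.1⟩
        · exact ⟨l, hl.le, hs⟩
      · refine ⟨types_le_maxRank (k := k) ⟨fun s hs => ?_, ht.1⟩, fun g hg hs => ?_⟩
        · rcases hs with hs | ⟨⟨l, hl, hs⟩, -⟩
          · exact ⟨k, le_rfl, hs.1⟩
          · exact ⟨l, hl.le, hs⟩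
        -- An argument with all these types lies above the fixpoint on stratum `k`; by monotonicity
        -- and the fixpoint equation so does its image.
        · have hle : SLe b (φ k) (g k) := sLe_of_forall_sat hφ hg fun s hs' hsφ => by
            obtain ⟨l, hl, hl'⟩ := hs'
            rcases hl.lt_or_eq with hl | rfl
            · exact hs s (.inr ⟨⟨l, hl, hl'⟩, hsφ⟩)
            · exact hs s (.inl ⟨hl', hsφ⟩)
          refine Sat.mono ht.1 ?_ ht.2
          have := D_mono (hF.mem k) (hφ.mem k) (hg.mem k) hle
          rwa [show (semFam 𝒜 (.lam M) ν k).fn (φ k) = φ k from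
            congrFun (famApp_fixFam hF) k] at this
  refine R.of_forall ?_
  rintro t ⟨⟨k, hk, ht⟩, hs⟩
  exact R.of_subset (key k) (Set.singleton_subset_iff.2 ⟨k, hk, ht⟩)
    (Set.singleton_subset_iff.2 ⟨ht, hs⟩)

/-- The environment need only generate the theory of the assignment up to subsumption. This slack
allows an arbitrary set `T` to be assumed for a variable whose value is the least one satisfying
`T`. -/
theorem Rules.complete (R : Rules 𝒜 b Der) {Γ : List SType} {A : SType} (M : Tm ar Γ A) :
    ∀ (ν : ℕ → Assign Q Γ) (E : Env Q Γ), AssignCoh 𝒜.rank ν →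
      (∀ A x, SetSub (Theory 𝒜 b fun k => ν k A x) (E A x)) →
        Der E M (Theory 𝒜 b (semFam 𝒜 M ν)) := by
  induction M with
  | var x => exact fun ν E _ hE => R.sub (R.var x) (fun t ht => ht.1) (hE _ x)
  | const a => exact fun ν E _ _ => R.der_const a ν
  | omega A =>
    refine fun ν E _ _ => R.of_forall ?_
    rintro t ⟨⟨k, -, ht⟩, hs⟩
    exact R.omega k ((sat_omegaVal ht).1 hs) (Set.singleton_subset_iff.2 ht)
  | app M N ihM ihN =>
    intro ν E hν hE
    refine R.of_subset (R.app (ihM ν E hν hE) (ihN ν E hν hE)) (fun t ht => ht.1) ?_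
    rintro t ⟨⟨k, -, ht⟩, hs⟩
    exact mem_tyApp_theory (coh_semFam M hν) (coh_semFam N hν) ht hs
      fun s hs => ⟨Types_le_maxRank hs.1, hs.2⟩
  | lam M ih => exact fun ν E hν hE => R.der_lam ih hν hE
  | fix M ih => exact fun ν E hν hE => R.der_fix hν (R.der_lam ih hν hE)

theorem Rules.der_closed (R : Rules 𝒜 b Der) (M : Tm ar [] .o) {S : Set Q}
    (h : ∀ q ∈ S, SMem b q (semClosed 𝒜 (𝒜.rank q) M)) : Der (A := .o) Env.nil M S := by
  have := R.complete M (fun _ _ x => nomatch x) Env.nil (fun _ x => nomatch x) fun _ x => nomatch x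
  have hS : (show Set (ITy Q .o) from S) ⊆ Types 𝒜.rank 𝒜.maxRank .o :=
    fun q _ => types_le_maxRank (k := 𝒜.rank q) rfl
  exact R.of_subset this hS fun q hq => ⟨hS hq, h q hq⟩

omit [Fintype Q] in
theorem Sound.sMem {M : Tm ar [] .o} {S : Set Q} (h : Sound (A := .o) 𝒜 b Env.nil M S) :
    ∀ q ∈ S, SMem b q (semClosed 𝒜 (𝒜.rank q) M) :=
  h (fun _ _ x => nomatch x) (fun _ x => nomatch x) fun _ x => nomatch x

theorem rank_le_maxRank (q : Q) : 𝒜.rank q ≤ 𝒜.maxRank :=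
  Finset.le_sup (f := 𝒜.rank) (Finset.mem_univ q)

/-- The two type systems characterize the semantics of closed terms. -/
theorem semClosed_eq_iff (M : Tm ar [] .o) (S : Set Q) :
    {q | SMem true q (semClosed 𝒜 (𝒜.rank q) M)} = S ↔
      Derives (A := .o) 𝒜 Env.nil M S ∧ DualDerives (A := .o) 𝒜 Env.nil M (Sᶜ : Set Q) := by
  constructor
  · rintro rfl
    exact ⟨rules_derives.der_closed M fun q hq => hq,
      rules_dualDerives.der_closed M fun q hq => hq⟩
  · rintro ⟨h, h'⟩
    refine Set.Subset.antisymm (fun q hq => ?_) fun q hq => h.sound.sMem q hq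
    exact by_contra fun hn => h'.sound.sMem q hn hq

theorem setVal_o (S : Set Q) : setVal 𝒜.rank 𝒜.maxRank (A := .o) S = S := by
  refine Eq.trans ?_ (Set.biUnion_of_singleton S)
  refine iSup_congr fun t => iSup_congr fun _ => ?_
  exact Set.ext fun q => and_iff_left (rank_le_maxRank (Q := Q) t)

/-- The top stratum shows every state with the status it has at its own rank. -/
theorem semClosed_maxRank (M : Tm ar [] .o) :
    semClosed 𝒜 𝒜.maxRank M = ({q | SMem true q (semClosed 𝒜 (𝒜.rank q) M)} : Set Q) :=
  Set.ext fun q => (coh_semClosed M).mem_iff (rank_le_maxRank q)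

end Systems

end LambdaY

theorem mainTheorem7 {Q : Type*} [Fintype Q] {C : Type*} {ar : C → ℕ} (𝒜 : WeakAutomaton Q ar)
    (M : Tm ar [] .o) (S : Set Q) :
    (semClosed 𝒜 𝒜.maxRank M = setVal 𝒜.rank 𝒜.maxRank (A := .o) S ↔
      Derives 𝒜 Env.nil M S ∧ DualDerives 𝒜 Env.nil M Sᶜ) ∧
    ({q | 𝒜.Accepts (BT M) q} = S ↔
      Derives 𝒜 Env.nil M S ∧ DualDerives 𝒜 Env.nil M Sᶜ) := by
  -- Acceptance and semantics define the same set, so both equivalences become the one for the type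
  -- systems.
  have hacc : {q | 𝒜.Accepts (BT M) q} = {q | SMem true q (semClosed 𝒜 (𝒜.rank q) M)} :=
    Set.ext fun q => ⟨mem_sem_of_accepts, accepts_of_mem_sem⟩
  rw [setVal_o, semClosed_maxRank, hacc]
  exact ⟨semClosed_eq_iff M S, semClosed_eq_iff M S⟩
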